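/- Let $k=\mathbb Z$ or $k=\mathbb F_p$ for a prime $p$ (including $p=2$). For $n\ge 1$ let $R_n=k[x_1,\dots,x_n]=H^*(BT_n;k)$, each $x_a$ of (topological) degree $2$. For $1\le i<n$ let $s_i$ exchange $x_i$ and $x_{i+1}$, and let $B_i=R_n\otimes_{R_n^{s_i}}R_n$, which is the cohomology of the space $\mathcal F(\sigma_i)=BT_n\times_{BG_i}BT_n$, as an $R_n$-bimodule. Consider the two-term complexes of $R_n$-bimodules, with $R_n$ placed in complex degree $0$, $$F(\sigma_i)\colon\ B_i\longrightarrow R_n,\quad a\otimes b\mapsto ab,\qquad\qquad F(\sigma_i^{-1})\colon\ R_n\longrightarrow B_i\cdot\mathrm{Th},\quad 1\mapsto z_i\,\mathrm{Th},\quad z_i=x_i\otimes 1-1\otimes x_{i+1},$$ where $\mathrm{Th}=\mathrm{Th}(-\zeta_i)$ is the Thom class, of topological degree $-2$, of minus the line bundle $\zeta_i$ with $c_1(\zeta_i)=z_i$. For a braid word $\tilde\sigma=\sigma_{i_1}^{\epsilon_1}\cdots\sigma_{i_l}^{\epsilon_l}$ on $n$ strands put $$H^*(\mathcal F(\tilde\sigma_\bullet))=F(\tilde\sigma)=F(\sigma_{i_1}^{\epsilon_1})\otimes_{R_n}\cdots\otimes_{R_n}F(\sigma_{i_l}^{\epsilon_l}).$$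 For an $R_n$-bimodule $M$ let $HH_*(M,R_n)$ be its Hochschild homology, computed by the Koszul complex $M\otimes\Lambda(\lambda_1,\dots,\lambda_n)$ with $d\lambda_a=x_a\otimes 1-1\otimes x_a$, where $\lambda_a$ has Hochschild degree $1$ and topological degree $2$. For a complex $C$ of bimodules and $h\in\mathbb Z$, $HH_h(C,R_n)$ denotes the complex obtained by applying $HH_h(-,R_n)$ termwise (it is zero for $h<0$). If $k=\mathbb F_p$, the reduced powers $\mathcal P^c$ ($=\mathrm{Sq}^{2c}$ if $p=2$) act on the Koszul complexes of the terms of $F(\tilde\sigma)$, and hence on their Hochschild homology, by the Cartan formula and, with $\mathcal P_t=\sum_c\mathcal P^ct^c$, $$\mathcal P_t(x_a)=x_a+x_a^pt,\qquad \mathcal P_t(\mathrm{Th}(-\zeta_i))=\mathrm{Th}(-\zeta_i)\,(1+z_i^{p-1}t)^{-1},\qquad \mathcal P_t(\lambda_a)=\lambda_a\bigl(1+(x_a\otimes1-1\otimes x_a)^{p-1}t\bigr).$$ Let $\tilde\sigma$ be a braid word on $n\ge1$ strands and let $\tilde\nu$ be the same word regarded as a braid word on $n+1$ strands. Then for every $h\in\mathbb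 Z$ there are quasi-isomorphisms of cochain complexes $$HH_h\bigl(H^*(\mathcal F(\tilde\nu_\bullet))\otimes_{R_{n+1}}F(\sigma_n),R_{n+1}\bigr)\longrightarrow HH_{h-1}\bigl(H^*(\mathcal F(\tilde\sigma_\bullet)),R_n\bigr),$$ $$HH_h\bigl(H^*(\mathcal F(\tilde\nu_\bullet))\otimes_{R_{n+1}}F(\sigma_n^{-1}),R_{n+1}\bigr)\longrightarrow HH_h\bigl(H^*(\mathcal F(\tilde\sigma_\bullet)),R_n\bigr)[-1],$$ where $(K[-1])^j=K^{j-1}$. They are $R_n$-linear and homogeneous for the topological grading, of degree $-2$ in the first case and $+2$ in the second. If $k=\mathbb F_p$, they can moreover be chosen to commute with all reduced powers $\mathcal P^c$. -/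

import Mathlib

open CategoryTheory
open scoped TensorProduct

noncomputable section

namespace SoergelBraid

/-! ### Bimodules over a commutative ring -/

/-- The enveloping ring of `R`. For `R = k[x_1, …, x_n]` with `k = ℤ` or `k = ZMod p` this is also
`R ⊗[k] R`, since `ℤ → k` is surjective. -/
abbrev Env (R : Type) [CommRing R] : Type := R ⊗[ℤ] R

/-- `R`-bimodules are modules over the enveloping ring. -/
abbrev Bimod (R : Type) [CommRing R] := ModuleCat.{0} (Env R)

section Bimodules

variable {R : Type} [CommRing R]

/-- `r ↦ r ⊗ 1`: the left action. -/
def lef : R →+* Env R := (Algebra.TensorProduct.includeLeft : R →ₐ[ℤ] Env R).toRingHom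

/-- `r ↦ 1 ⊗ r`: the right action. -/
def rig : R →+* Env R := (Algebra.TensorProduct.includeRight : R →ₐ[ℤ] Env R).toRingHom

theorem env_eq (r s : R) : (r ⊗ₜ[ℤ] s : Env R) = lef r * rig s := by
  simp [lef, rig]

theorem lef_zero_smul {M : Type} [AddCommGroup M] [Module (Env R) M] (m : M) :
    (lef (0 : R) : Env R) • m = 0 :=
  (congrArg (fun e : Env R => e • m) (map_zero lef)).trans (zero_smul (Env R) m)

theorem rig_zero_smul {M : Type} [AddCommGroup M] [Module (Env R) M] (m : M) :
    (rig (0 : R) : Env R) • m = 0 :=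
  (congrArg (fun e : Env R => e • m) (map_zero rig)).trans (zero_smul (Env R) m)

/-- A bimodule regarded as an `R`-module through its left action. -/
def LeftRes (M : Type) : Type := M

/-- A bimodule regarded as an `R`-module through its right action. -/
def RightRes (M : Type) : Type := M

instance (M : Type) [h : AddCommGroup M] : AddCommGroup (LeftRes M) := h
instance (M : Type) [h : AddCommGroup M] : AddCommGroup (RightRes M) := h

instance (M : Type) [AddCommGroup M] [Module (Env R) M] : Module R (LeftRes M) :=
  Module.compHom M (lef (R := R))

instance (M : Type) [AddCommGroup M] [Module (Env R) M] : Module R (RightRes M) :=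
  Module.compHom M (rig (R := R))

/-- The tensor product `M ⊗_R N` of bimodules: the right action on `M` is balanced against the
left action on `N`. -/
def BTensor (R : Type) [CommRing R] (M N : Type) [AddCommGroup M] [Module (Env R) M]
    [AddCommGroup N] [Module (Env R) N] : Type := RightRes M ⊗[R] LeftRes N

section

variable (M N : Type) [AddCommGroup M] [Module (Env R) M] [AddCommGroup N] [Module (Env R) N]

instance : AddCommGroup (BTensor R M N) :=
  inferInstanceAs (AddCommGroup (RightRes M ⊗[R] LeftRes N))

variable {M N}

/-- Pure tensors. -/
def BTensor.tmul (m : M) (n : N) : BTensor R M N :=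
  TensorProduct.tmul R (M := RightRes M) (N := LeftRes N) m n

theorem BTensor.balanced (r : R) (m : M) (n : N) :
    (BTensor.tmul (rig r • m) n : BTensor R M N) = BTensor.tmul m (lef r • n) :=
  TensorProduct.smul_tmul (R := R) (M := RightRes M) (N := LeftRes N) r m n

theorem BTensor.add_tmul (m m' : M) (n : N) :
    (BTensor.tmul (m + m') n : BTensor R M N) = BTensor.tmul m n + BTensor.tmul m' n :=
  TensorProduct.add_tmul (R := R) (M := RightRes M) (N := LeftRes N) m m' n

theorem BTensor.tmul_add (m : M) (n n' : N) :
    (BTensor.tmul m (n + n') : BTensor R M N) = BTensor.tmul m n + BTensor.tmul m n' :=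
  TensorProduct.tmul_add (R := R) (M := RightRes M) (N := LeftRes N) m n n'

theorem BTensor.induction {q : BTensor R M N → Prop} (x : BTensor R M N) (zero : q 0)
    (tmul : ∀ m n, q (BTensor.tmul m n)) (add : ∀ x y, q x → q y → q (x + y)) : q x :=
  TensorProduct.induction_on (R := R) (M := RightRes M) (N := LeftRes N) x zero tmul add

variable (R M N) in
/-- The pure tensor map as a biadditive map. -/
def BTensor.mk : M →+ N →+ BTensor R M N :=
  AddMonoidHom.mk' (fun m => AddMonoidHom.mk' (fun n => BTensor.tmul m n) (BTensor.tmul_add m))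
    (fun m m' => AddMonoidHom.ext fun n => BTensor.add_tmul m m' n)

/-- The universal property: balanced biadditive maps factor through `M ⊗_R N`. -/
def BTensor.lift {P : Type} [AddCommGroup P] (f : M →+ N →+ P)
    (hf : ∀ (r : R) (m : M) (n : N), f (rig r • m) n = f m (lef r • n)) : BTensor R M N →+ P :=
  TensorProduct.liftAddHom (R := R) (M := RightRes M) (N := LeftRes N) f hf

theorem BTensor.lift_tmul {P : Type} [AddCommGroup P] (f : M →+ N →+ P)
    (hf : ∀ (r : R) (m : M) (n : N), f (rig r • m) n = f m (lef r • n)) (m : M) (n : N) :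
    BTensor.lift f hf (BTensor.tmul m n) = f m n := rfl

theorem BTensor.hom_ext {P : Type} [AddZeroClass P] {f g : BTensor R M N →+ P}
    (h : ∀ m n, f (BTensor.tmul m n) = g (BTensor.tmul m n)) : f = g := by
  refine AddMonoidHom.ext fun x => ?_
  induction x using BTensor.induction with
  | zero => rw [map_zero, map_zero]
  | tmul m n => exact h m n
  | add x y hx hy => rw [map_add, map_add, hx, hy]

variable (M N)

/-- The left action of `R` on `M ⊗_R N`, through `M`. -/
def tensorLeft : R →+* AddMonoid.End (BTensor R M N) where
  toFun r := BTensor.lift ((BTensor.mk R M N).comp (DistribSMul.toAddMonoidHom M (lef r : Env R)))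
    (fun s m n => by
      change BTensor.tmul (lef r • rig s • m) n = BTensor.tmul (lef r • m) (lef s • n)
      rw [smul_comm, BTensor.balanced])
  map_one' := BTensor.hom_ext fun m n => by
    change BTensor.tmul (lef (1 : R) • m) n = BTensor.tmul m n
    rw [map_one, one_smul]
  map_zero' := BTensor.hom_ext fun m n => by
    change BTensor.mk R M N (lef (0 : R) • m) n = 0
    rw [lef_zero_smul, map_zero]; rfl
  map_mul' r s := BTensor.hom_ext fun m n => by
    change BTensor.tmul (lef (r * s) • m) n = BTensor.tmul (lef r • lef s • m) n
    rw [map_mul, mul_smul]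
  map_add' r s := BTensor.hom_ext fun m n => by
    change BTensor.tmul (lef (r + s) • m) n = BTensor.tmul (lef r • m) n + BTensor.tmul (lef s • m) n
    rw [map_add, add_smul, BTensor.add_tmul]

/-- The right action of `R` on `M ⊗_R N`, through `N`. -/
def tensorRight : R →+* AddMonoid.End (BTensor R M N) where
  toFun r := BTensor.lift
    ((AddMonoidHom.compHom' (DistribSMul.toAddMonoidHom N (rig r : Env R))).comp (BTensor.mk R M N))
    (fun s m n => by
      change BTensor.tmul (rig s • m) (rig r • n) = BTensor.tmul m (rig r • lef s • n)
      rw [smul_comm, BTensor.balanced])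
  map_one' := BTensor.hom_ext fun m n => by
    change BTensor.tmul m (rig (1 : R) • n) = BTensor.tmul m n
    rw [map_one, one_smul]
  map_zero' := BTensor.hom_ext fun m n => by
    change BTensor.mk R M N m (rig (0 : R) • n) = 0
    rw [rig_zero_smul, map_zero]
  map_mul' r s := BTensor.hom_ext fun m n => by
    change BTensor.tmul m (rig (r * s) • n) = BTensor.tmul m (rig r • rig s • n)
    rw [map_mul, mul_smul]
  map_add' r s := BTensor.hom_ext fun m n => by
    change BTensor.tmul m (rig (r + s) • n) = BTensor.tmul m (rig r • n) + BTensor.tmul m (rig s • n)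
    rw [map_add, add_smul, BTensor.tmul_add]

theorem tensor_commute (r s : R) : Commute (tensorLeft M N r) (tensorRight M N s) :=
  BTensor.hom_ext fun _ _ => rfl

instance : Module (Env R) (BTensor R M N) :=
  Module.compHom (BTensor R M N)
    (Algebra.TensorProduct.lift (tensorLeft M N).toIntAlgHom (tensorRight M N).toIntAlgHom
      (tensor_commute M N)).toRingHom

variable {M N}

theorem BTensor.env_smul (r s : R) (m : M) (n : N) :
    ((lef r * rig s : Env R) • (BTensor.tmul m n : BTensor R M N)) =
      BTensor.tmul (lef r • m) (rig s • n) := by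
  rw [← env_eq]; rfl

theorem BTensor.lef_smul (r : R) (m : M) (n : N) :
    (lef r : Env R) • (BTensor.tmul m n : BTensor R M N) = BTensor.tmul (lef r • m) n := by
  have := BTensor.env_smul r 1 m n
  simpa using this

theorem BTensor.rig_smul (s : R) (m : M) (n : N) :
    (rig s : Env R) • (BTensor.tmul m n : BTensor R M N) = BTensor.tmul m (rig s • n) := by
  have := BTensor.env_smul 1 s m n
  simpa using this

end

theorem env_smul_hom {M M' : Type} [AddCommGroup M] [Module (Env R) M] [AddCommGroup M']
    [Module (Env R) M'] (f : M →+ M') (hl : ∀ (r : R) (x : M), f (lef r • x) = lef r • f x)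
    (hr : ∀ (r : R) (x : M), f (rig r • x) = rig r • f x) (e : Env R) (x : M) :
    f (e • x) = e • f x := by
  induction e using TensorProduct.induction_on with
  | zero =>
    exact (congrArg f (zero_smul (Env R) x)).trans
      ((map_zero f).trans (zero_smul (Env R) (f x)).symm)
  | add a b ha hb => rw [add_smul, add_smul, map_add, ha, hb]
  | tmul r s => rw [env_eq, mul_smul, mul_smul, hl, hr]

section

variable {M M' M'' N N' N'' : Type} [AddCommGroup M] [Module (Env R) M] [AddCommGroup M']
    [Module (Env R) M'] [AddCommGroup M''] [Module (Env R) M''] [AddCommGroup N] [Module (Env R) N]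
    [AddCommGroup N'] [Module (Env R) N'] [AddCommGroup N''] [Module (Env R) N'']

/-- Functoriality of the tensor product of bimodules: `m ⊗ n ↦ f m ⊗ g n`. -/
def BTensor.map (f : M →ₗ[Env R] M') (g : N →ₗ[Env R] N') :
    BTensor R M N →ₗ[Env R] BTensor R M' N' :=
  let φ : BTensor R M N →+ BTensor R M' N' :=
    BTensor.lift ((AddMonoidHom.compHom' g.toAddMonoidHom).comp
      ((BTensor.mk R M' N').comp f.toAddMonoidHom)) (fun s m n => by
        change BTensor.tmul (f (rig s • m)) (g n) = BTensor.tmul (f m) (g (lef s • n))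
        rw [map_smul, map_smul, BTensor.balanced])
  { φ with
    map_smul' := env_smul_hom φ
      (fun r x => by
        induction x using BTensor.induction with
        | zero => rw [smul_zero, map_zero, smul_zero]
        | add x y hx hy => rw [smul_add, map_add, map_add, smul_add, hx, hy]
        | tmul m n =>
          rw [BTensor.lef_smul]
          change BTensor.tmul (f (lef r • m)) (g n) = lef r • BTensor.tmul (f m) (g n)
          rw [map_smul, BTensor.lef_smul])
      (fun r x => by
        induction x using BTensor.induction with
        | zero => rw [smul_zero, map_zero, smul_zero]
        | add x y hx hy => rw [smul_add, map_add, map_add, smul_add, hx, hy]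
        | tmul m n =>
          rw [BTensor.rig_smul]
          change BTensor.tmul (f m) (g (rig r • n)) = rig r • BTensor.tmul (f m) (g n)
          rw [map_smul, BTensor.rig_smul]) }

theorem BTensor.map_tmul (f : M →ₗ[Env R] M') (g : N →ₗ[Env R] N') (m : M) (n : N) :
    BTensor.map f g (BTensor.tmul m n) = BTensor.tmul (f m) (g n) := rfl

theorem BTensor.linear_ext {f g : BTensor R M N →ₗ[Env R] M'}
    (h : ∀ m n, f (BTensor.tmul m n) = g (BTensor.tmul m n)) : f = g :=
  LinearMap.toAddMonoidHom_injective (BTensor.hom_ext h)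

theorem BTensor.map_comp (f : M →ₗ[Env R] M') (f' : M' →ₗ[Env R] M'') (g : N →ₗ[Env R] N')
    (g' : N' →ₗ[Env R] N'') :
    BTensor.map f' g' ∘ₗ BTensor.map f g = BTensor.map (f' ∘ₗ f) (g' ∘ₗ g) :=
  BTensor.linear_ext fun _ _ => rfl

theorem BTensor.map_zero_left (g : N →ₗ[Env R] N') :
    BTensor.map (0 : M →ₗ[Env R] M') g = 0 :=
  BTensor.linear_ext fun m n => by
    change BTensor.mk R M' N' 0 (g n) = 0
    rw [map_zero]; rfl

theorem BTensor.map_zero_right (f : M →ₗ[Env R] M') :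
    BTensor.map f (0 : N →ₗ[Env R] N') = 0 :=
  BTensor.linear_ext fun m n => by
    change BTensor.mk R M' N' (f m) 0 = 0
    rw [map_zero]

end

/-! ### The tensor product of complexes of bimodules -/

/-- Pairs of degrees with sum `j`. -/
abbrev Deg (j : ℤ) : Type := {ab : ℤ × ℤ // ab.1 + ab.2 = j}

/-- The pair `(a + 1, b)`. -/
def Deg.incl {j : ℤ} (ab : Deg j) : Deg (j + 1) :=
  ⟨(ab.1.1 + 1, ab.1.2), by have := ab.2; simp only; omega⟩

/-- The pair `(a, b + 1)`. -/
def Deg.incr {j : ℤ} (ab : Deg j) : Deg (j + 1) :=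
  ⟨(ab.1.1, ab.1.2 + 1), by have := ab.2; simp only; omega⟩

variable (C D : CochainComplex (Bimod R) ℤ)

/-- The degree `j` term `⨁_{a + b = j} C^a ⊗_R D^b`. -/
abbrev tensorX (j : ℤ) : Type := DirectSum (Deg j) fun ab => BTensor R (C.X ab.1.1) (D.X ab.1.2)

/-- The inclusion of a summand. -/
def tensorIncl {j : ℤ} (ab : Deg j) :
    BTensor R (C.X ab.1.1) (D.X ab.1.2) →ₗ[Env R] tensorX C D j :=
  DirectSum.lof (Env R) (Deg j) (fun ab => BTensor R (C.X ab.1.1) (D.X ab.1.2)) ab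

/-- `c ⊗ c' ↦ dc ⊗ c'`. -/
def tensorDLeft {j : ℤ} (ab : Deg j) :
    BTensor R (C.X ab.1.1) (D.X ab.1.2) →ₗ[Env R] tensorX C D (j + 1) :=
  tensorIncl C D ab.incl ∘ₗ BTensor.map (C.d ab.1.1 (ab.1.1 + 1)).hom LinearMap.id

/-- `c ⊗ c' ↦ c ⊗ dc'`. -/
def tensorDRight {j : ℤ} (ab : Deg j) :
    BTensor R (C.X ab.1.1) (D.X ab.1.2) →ₗ[Env R] tensorX C D (j + 1) :=
  tensorIncl C D ab.incr ∘ₗ BTensor.map LinearMap.id (D.d ab.1.2 (ab.1.2 + 1)).hom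

/-- The differential `c ⊗ c' ↦ dc ⊗ c' + (-1)^a c ⊗ dc'` for `c` of degree `a`. -/
def tensorD (j : ℤ) : tensorX C D j →ₗ[Env R] tensorX C D (j + 1) :=
  DirectSum.toModule (Env R) (Deg j) (tensorX C D (j + 1)) fun ab =>
    tensorDLeft C D ab + (ab.1.1.negOnePow : ℤ) • tensorDRight C D ab

theorem tensorD_incl {j : ℤ} (ab : Deg j) (x : BTensor R (C.X ab.1.1) (D.X ab.1.2)) :
    tensorD C D j (tensorIncl C D ab x) =
      tensorDLeft C D ab x + (ab.1.1.negOnePow : ℤ) • tensorDRight C D ab x :=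
  DirectSum.toModule_lof ..

theorem hom_d_comp (i j l : ℤ) (C : CochainComplex (Bimod R) ℤ) :
    (C.d j l).hom ∘ₗ (C.d i j).hom = 0 := by
  rw [← ModuleCat.hom_comp, C.d_comp_d]; rfl

theorem tensorD_comp (j : ℤ) : tensorD C D (j + 1) ∘ₗ tensorD C D j = 0 := by
  refine DirectSum.linearMap_ext _ fun ab => LinearMap.ext fun x => ?_
  change tensorD C D (j + 1) (tensorD C D j (tensorIncl C D ab x)) = 0
  rw [tensorD_incl, map_add, map_zsmul]
  have h1 : tensorD C D (j + 1) (tensorDLeft C D ab x) =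
      tensorDLeft C D ab.incl (BTensor.map (C.d ab.1.1 (ab.1.1 + 1)).hom LinearMap.id x) +
      ((ab.1.1 + 1).negOnePow : ℤ) • tensorDRight C D ab.incl
        (BTensor.map (C.d ab.1.1 (ab.1.1 + 1)).hom LinearMap.id x) := tensorD_incl ..
  have h2 : tensorD C D (j + 1) (tensorDRight C D ab x) =
      tensorDLeft C D ab.incr (BTensor.map LinearMap.id (D.d ab.1.2 (ab.1.2 + 1)).hom x) +
      (ab.1.1.negOnePow : ℤ) • tensorDRight C D ab.incr
        (BTensor.map LinearMap.id (D.d ab.1.2 (ab.1.2 + 1)).hom x) := tensorD_incl ..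
  have h3 : tensorDLeft C D ab.incl
      (BTensor.map (C.d ab.1.1 (ab.1.1 + 1)).hom LinearMap.id x) = 0 := by
    have : BTensor.map (C.d (ab.1.1 + 1) (ab.1.1 + 1 + 1)).hom
        (LinearMap.id : D.X ab.1.2 →ₗ[Env R] D.X ab.1.2) ∘ₗ
        BTensor.map (C.d ab.1.1 (ab.1.1 + 1)).hom LinearMap.id = 0 := by
      rw [BTensor.map_comp, hom_d_comp, BTensor.map_zero_left]
    change tensorIncl C D ab.incl.incl ((BTensor.map (C.d (ab.1.1 + 1) (ab.1.1 + 1 + 1)).hom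
        (LinearMap.id : D.X ab.1.2 →ₗ[Env R] D.X ab.1.2) ∘ₗ
        BTensor.map (C.d ab.1.1 (ab.1.1 + 1)).hom LinearMap.id) x) = 0
    exact (congrArg (tensorIncl C D ab.incl.incl) (LinearMap.congr_fun this x)).trans
      (map_zero (tensorIncl C D ab.incl.incl))
  have h4 : tensorDRight C D ab.incr
      (BTensor.map LinearMap.id (D.d ab.1.2 (ab.1.2 + 1)).hom x) = 0 := by
    have : BTensor.map (LinearMap.id : C.X ab.1.1 →ₗ[Env R] C.X ab.1.1)
        (D.d (ab.1.2 + 1) (ab.1.2 + 1 + 1)).hom ∘ₗ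
        BTensor.map LinearMap.id (D.d ab.1.2 (ab.1.2 + 1)).hom = 0 := by
      rw [BTensor.map_comp, hom_d_comp, BTensor.map_zero_right]
    change tensorIncl C D ab.incr.incr ((BTensor.map (LinearMap.id : C.X ab.1.1 →ₗ[Env R] C.X ab.1.1)
        (D.d (ab.1.2 + 1) (ab.1.2 + 1 + 1)).hom ∘ₗ
        BTensor.map LinearMap.id (D.d ab.1.2 (ab.1.2 + 1)).hom) x) = 0
    exact (congrArg (tensorIncl C D ab.incr.incr) (LinearMap.congr_fun this x)).trans
      (map_zero (tensorIncl C D ab.incr.incr))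
  have h5 : tensorDRight C D ab.incl
      (BTensor.map (C.d ab.1.1 (ab.1.1 + 1)).hom LinearMap.id x) = tensorDLeft C D ab.incr
      (BTensor.map LinearMap.id (D.d ab.1.2 (ab.1.2 + 1)).hom x) := by
    change tensorIncl C D ab.incl.incr ((BTensor.map LinearMap.id (D.d ab.1.2 (ab.1.2 + 1)).hom ∘ₗ
        BTensor.map (C.d ab.1.1 (ab.1.1 + 1)).hom LinearMap.id) x) =
      tensorIncl C D ab.incl.incr ((BTensor.map (C.d ab.1.1 (ab.1.1 + 1)).hom LinearMap.id ∘ₗ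
        BTensor.map LinearMap.id (D.d ab.1.2 (ab.1.2 + 1)).hom) x)
    rw [BTensor.map_comp, BTensor.map_comp]
    rfl
  rw [h1, h2, h3, h4, h5, zero_add, smul_zero, add_zero, ← add_smul, Int.negOnePow_succ]
  simp

/-- The tensor product over `R` of two complexes of bimodules. -/
def tensorComplex : CochainComplex (Bimod R) ℤ :=
  CochainComplex.of (fun j => ModuleCat.of (Env R) (tensorX C D j))
    (fun j => ModuleCat.ofHom (tensorD C D j))
    (fun j => by rw [← ModuleCat.ofHom_comp, tensorD_comp]; rfl)

end Bimodules

/-! ### Soergel bimodules and the complexes attached to braid words -/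

section Soergel

variable (k : Type) [CommRing k] {m : ℕ}

/-- `k[x_0, …, x_{n-1}]`, the cohomology of the classifying space of the diagonal torus of `U(n)`;
each variable has degree `2`. -/
abbrev Poly (n : ℕ) : Type := MvPolynomial (Fin n) k

/-- The polynomials invariant under exchanging the two variables `x_i` and `x_{i+1}`: the cohomology
of the classifying space of the `i`-th rank one parabolic subgroup. -/
def invariants (i : Fin m) : Subalgebra k (Poly k (m + 1)) :=
  AlgHom.equalizer (MvPolynomial.rename (Equiv.swap i.castSucc i.succ)) (AlgHom.id k _)

/-- `B_i = R ⊗_{R^{s_i}} R`. -/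
def SB (i : Fin m) : Type := Poly k (m + 1) ⊗[invariants k i] Poly k (m + 1)

instance (i : Fin m) : CommRing (SB k i) :=
  inferInstanceAs (CommRing (Poly k (m + 1) ⊗[invariants k i] Poly k (m + 1)))

/-- The two ring maps `R → B_i`. -/
def sbLeft (i : Fin m) : Poly k (m + 1) →+* SB k i :=
  (Algebra.TensorProduct.includeLeft : Poly k (m + 1) →ₐ[invariants k i]
    Poly k (m + 1) ⊗[invariants k i] Poly k (m + 1)).toRingHom

/-- The two ring maps `R → B_i`. -/
def sbRight (i : Fin m) : Poly k (m + 1) →+* SB k i :=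
  (Algebra.TensorProduct.includeRight : Poly k (m + 1) →ₐ[invariants k i]
    Poly k (m + 1) ⊗[invariants k i] Poly k (m + 1)).toRingHom

/-- `R ⊗ R → R ⊗_{R^{s_i}} R`. -/
def sbOfEnv (i : Fin m) : Env (Poly k (m + 1)) →+* SB k i :=
  (Algebra.TensorProduct.lift (sbLeft k i).toIntAlgHom (sbRight k i).toIntAlgHom
    (fun _ _ => Commute.all _ _)).toRingHom

instance (i : Fin m) : Module (Env (Poly k (m + 1))) (SB k i) :=
  Module.compHom (SB k i) (sbOfEnv k i)

/-- `R` as a bimodule over itself (type synonym). -/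
def UB (n : ℕ) : Type := Poly k n

instance (n : ℕ) : CommRing (UB k n) := inferInstanceAs (CommRing (Poly k n))

/-- Multiplication `R ⊗ R → R`. -/
def ubOfEnv (n : ℕ) : Env (Poly k n) →+* UB k n :=
  (Algebra.TensorProduct.lmul' ℤ : Poly k n ⊗[ℤ] Poly k n →ₐ[ℤ] Poly k n).toRingHom

instance (n : ℕ) : Module (Env (Poly k n)) (UB k n) :=
  Module.compHom (UB k n) (ubOfEnv k n)

/-- Multiplication `B_i → R`. -/
def sbMul (i : Fin m) : SB k i →+* UB k (m + 1) :=
  (Algebra.TensorProduct.lmul' (invariants k i) :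
    Poly k (m + 1) ⊗[invariants k i] Poly k (m + 1) →ₐ[invariants k i] Poly k (m + 1)).toRingHom

theorem sb_smul (i : Fin m) (e : Env (Poly k (m + 1))) (b : SB k i) :
    e • b = sbOfEnv k i e * b := rfl

theorem ub_smul (n : ℕ) (e : Env (Poly k n)) (b : UB k n) : e • b = ubOfEnv k n e * b := rfl

theorem sbOfEnv_lef (i : Fin m) (r : Poly k (m + 1)) : sbOfEnv k i (lef r) = sbLeft k i r := by
  change sbLeft k i r * sbRight k i 1 = _
  rw [map_one, mul_one]

theorem sbOfEnv_rig (i : Fin m) (r : Poly k (m + 1)) : sbOfEnv k i (rig r) = sbRight k i r := by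
  change sbLeft k i 1 * sbRight k i r = _
  rw [map_one, one_mul]

theorem sbMul_left (i : Fin m) (r : Poly k (m + 1)) :
    sbMul k i (sbLeft k i r) = ubOfEnv k (m + 1) (lef r) := by
  change r * 1 = r * 1
  rfl

theorem sbMul_right (i : Fin m) (r : Poly k (m + 1)) :
    sbMul k i (sbRight k i r) = ubOfEnv k (m + 1) (rig r) := by
  change 1 * r = 1 * r
  rfl

theorem sbMul_sbOfEnv (i : Fin m) (e : Env (Poly k (m + 1))) :
    sbMul k i (sbOfEnv k i e) = ubOfEnv k (m + 1) e := by
  induction e using TensorProduct.induction_on with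
  | zero =>
    exact ((congrArg (sbMul k i) (map_zero (sbOfEnv k i))).trans (map_zero _)).trans
      (map_zero (ubOfEnv k (m + 1))).symm
  | add a b ha hb => rw [map_add, map_add, map_add, ha, hb]
  | tmul r s =>
    rw [env_eq, map_mul, map_mul, map_mul, sbOfEnv_lef, sbOfEnv_rig, sbMul_left, sbMul_right]

/-- The bimodule map `br_i : B_i → R`, `a ⊗ b ↦ a b`. -/
def br (i : Fin m) : SB k i →ₗ[Env (Poly k (m + 1))] UB k (m + 1) where
  toFun := sbMul k i
  map_add' := map_add _
  map_smul' e b := by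
    rw [sb_smul, map_mul, sbMul_sbOfEnv]; rfl

/-- The element `X_i - Y_{i+1}` of `R ⊗ R`, whose image in `B_i` is the first Chern class of the line
bundle `ζ_i`. -/
def zEnv (i : Fin m) : Env (Poly k (m + 1)) :=
  lef (MvPolynomial.X i.castSucc) - rig (MvPolynomial.X i.succ)

/-- `c_1(ζ_i) = x_i ⊗ 1 - 1 ⊗ x_{i+1}` in `B_i`. -/
def zeta (i : Fin m) : SB k i := sbOfEnv k i (zEnv k i)

theorem sbLeft_invariant (i : Fin m) (f : Poly k (m + 1))
    (hf : MvPolynomial.rename (Equiv.swap i.castSucc i.succ) f = f) :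
    sbLeft k i f = sbRight k i f := by
  have h1 : sbLeft k i f = algebraMap (invariants k i)
      (Poly k (m + 1) ⊗[invariants k i] Poly k (m + 1)) ⟨f, hf⟩ := rfl
  have h2 : sbRight k i f = algebraMap (invariants k i)
      (Poly k (m + 1) ⊗[invariants k i] Poly k (m + 1)) ⟨f, hf⟩ :=
    (Algebra.TensorProduct.includeRight : Poly k (m + 1) →ₐ[invariants k i]
      Poly k (m + 1) ⊗[invariants k i] Poly k (m + 1)).commutes ⟨f, hf⟩
  rw [h1, h2]

theorem zeta_eq (i : Fin m) : zeta k i =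
    sbLeft k i (MvPolynomial.X i.castSucc) - sbRight k i (MvPolynomial.X i.succ) := by
  rw [zeta, zEnv, map_sub, sbOfEnv_lef, sbOfEnv_rig]

theorem zeta_mul (i : Fin m) (r : Poly k (m + 1)) :
    zeta k i * sbLeft k i r = zeta k i * sbRight k i r := by
  have hs : sbLeft k i (MvPolynomial.X i.castSucc) + sbLeft k i (MvPolynomial.X i.succ) =
      sbRight k i (MvPolynomial.X i.castSucc) + sbRight k i (MvPolynomial.X i.succ) := by
    rw [← map_add, ← map_add]
    apply sbLeft_invariant
    simp [add_comm]
  have hp : sbLeft k i (MvPolynomial.X i.castSucc) * sbLeft k i (MvPolynomial.X i.succ) =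
      sbRight k i (MvPolynomial.X i.castSucc) * sbRight k i (MvPolynomial.X i.succ) := by
    rw [← map_mul, ← map_mul]
    apply sbLeft_invariant
    simp [mul_comm]
  have h1 : zeta k i * sbLeft k i (MvPolynomial.X i.castSucc) =
      zeta k i * sbRight k i (MvPolynomial.X i.castSucc) := by
    rw [zeta_eq]
    linear_combination (sbLeft k i (MvPolynomial.X i.castSucc)) * hs - hp
  induction r using MvPolynomial.induction_on with
  | C c =>
    congr 1
    apply sbLeft_invariant
    simp
  | add p q hp hq => rw [map_add, map_add, mul_add, mul_add, hp, hq]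
  | mul_X p a hpa =>
    have key : zeta k i * sbLeft k i (MvPolynomial.X a) =
        zeta k i * sbRight k i (MvPolynomial.X a) := by
      by_cases ha : a = i.castSucc
      · rw [ha, h1]
      by_cases hb : a = i.succ
      · rw [hb]
        linear_combination (zeta k i) * hs - h1
      · congr 1
        apply sbLeft_invariant
        simp [Equiv.swap_apply_of_ne_of_ne ha hb]
    rw [map_mul, map_mul]
    linear_combination (sbLeft k i (MvPolynomial.X a)) * hpa + (sbRight k i p) * key

theorem zeta_mul_env (i : Fin m) (e : Env (Poly k (m + 1))) :
    zeta k i * sbLeft k i (ubOfEnv k (m + 1) e) = zeta k i * sbOfEnv k i e := by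
  induction e using TensorProduct.induction_on with
  | zero =>
    exact congrArg (zeta k i * ·) (((congrArg (sbLeft k i) (map_zero (ubOfEnv k (m + 1)))).trans
      (map_zero (sbLeft k i))).trans (map_zero (sbOfEnv k i)).symm)
  | add a b ha hb =>
    rw [map_add (sbOfEnv k i), mul_add, ← ha, ← hb, ← mul_add]
    congr 1
    exact (congrArg (sbLeft k i) (map_add (ubOfEnv k (m + 1)) a b)).trans
      (map_add (sbLeft k i) (ubOfEnv k (m + 1) a : Poly k (m + 1)) (ubOfEnv k (m + 1) b))
  | tmul r s =>
    rw [env_eq, map_mul (sbOfEnv k i), sbOfEnv_lef, sbOfEnv_rig, ← env_eq]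
    have : sbLeft k i (ubOfEnv k (m + 1) (r ⊗ₜ[ℤ] s)) = sbLeft k i r * sbLeft k i s :=
      map_mul (sbLeft k i) r s
    rw [this, mul_left_comm, zeta_mul, mul_left_comm]

/-- The bimodule map `rb_i : R → B_i`, `1 ↦ c_1(ζ_i)`. -/
def rb (i : Fin m) : UB k (m + 1) →ₗ[Env (Poly k (m + 1))] SB k i where
  toFun r := zeta k i * sbLeft k i r
  map_add' a b := by
    rw [← mul_add]; congr 1; exact map_add (sbLeft k i) a b
  map_smul' e b := by
    have : sbLeft k i (e • b : UB k (m + 1)) =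
        sbLeft k i (ubOfEnv k (m + 1) e) * sbLeft k i b :=
      map_mul (sbLeft k i) (ubOfEnv k (m + 1) e : Poly k (m + 1)) b
    rw [this, ← mul_assoc, zeta_mul_env, RingHom.id_apply, sb_smul]
    ring

/-- A letter `(i, true)` stands for `σ_i`, a letter `(i, false)` for `σ_i⁻¹`, in the braid group on
`m + 1` strands. -/
abbrev Letter (m : ℕ) : Type := Fin m × Bool

/-- Braid words on `m + 1` strands. -/
abbrev BraidWord (m : ℕ) : Type := List (Letter m)

/-- The zero bimodule. -/
abbrev zeroB (n : ℕ) : Bimod (Poly k n) := ModuleCat.of _ PUnit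

/-- The bimodule `R`. -/
abbrev unitB (n : ℕ) : Bimod (Poly k n) := ModuleCat.of _ (UB k n)

/-- The bimodule `B_i`. -/
abbrev soergelB (i : Fin m) : Bimod (Poly k (m + 1)) := ModuleCat.of _ (SB k i)

/-- Terms of `F(σ_i)`: `B_i` in degree `-1`, `R` in degree `0`. -/
def posX (i : Fin m) : ℤ → Bimod (Poly k (m + 1))
  | .ofNat 0 => unitB k (m + 1)
  | .ofNat (_ + 1) => zeroB k (m + 1)
  | .negSucc 0 => soergelB k i
  | .negSucc (_ + 1) => zeroB k (m + 1)

/-- Differential of `F(σ_i)`. -/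
def posD (i : Fin m) : ∀ j : ℤ, posX k i j ⟶ posX k i (j + 1)
  | .ofNat _ => 0
  | .negSucc 0 => (ModuleCat.ofHom (br k i) : soergelB k i ⟶ unitB k (m + 1))
  | .negSucc (_ + 1) => 0

/-- `F(σ_i) : B_i → R`, with `R` in degree `0`. -/
def posComplex (i : Fin m) : CochainComplex (Bimod (Poly k (m + 1))) ℤ :=
  CochainComplex.of (posX k i) (posD k i) (fun j => by
    match j with
    | .ofNat _ => exact Limits.zero_comp
    | .negSucc 0 => exact Limits.comp_zero
    | .negSucc (_ + 1) => exact Limits.zero_comp)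

/-- Terms of `F(σ_i⁻¹)`: `R` in degree `0`, `B_i` in degree `1`. -/
def negX (i : Fin m) : ℤ → Bimod (Poly k (m + 1))
  | .ofNat 0 => unitB k (m + 1)
  | .ofNat 1 => soergelB k i
  | .ofNat (_ + 2) => zeroB k (m + 1)
  | .negSucc _ => zeroB k (m + 1)

/-- Differential of `F(σ_i⁻¹)`. -/
def negD (i : Fin m) : ∀ j : ℤ, negX k i j ⟶ negX k i (j + 1)
  | .ofNat 0 => (ModuleCat.ofHom (rb k i) : unitB k (m + 1) ⟶ soergelB k i)
  | .ofNat (_ + 1) => 0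
  | .negSucc _ => 0

/-- `F(σ_i⁻¹) : R → B_i`, with `R` in degree `0`. The term `B_i` stands for the cohomology of the
Thom spectrum of `-ζ_i`: an element `b` stands for `b · Th(-ζ_i)`. -/
def negComplex (i : Fin m) : CochainComplex (Bimod (Poly k (m + 1))) ℤ :=
  CochainComplex.of (negX k i) (negD k i) (fun j => by
    match j with
    | .ofNat 0 => exact Limits.comp_zero
    | .ofNat (_ + 1) => exact Limits.zero_comp
    | .negSucc _ => exact Limits.zero_comp)

/-- Terms of the complex with the single term `R`, in degree `0`. -/
def oneX (n : ℕ) : ℤ → Bimod (Poly k n)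
  | .ofNat 0 => unitB k n
  | .ofNat (_ + 1) => zeroB k n
  | .negSucc _ => zeroB k n

/-- The complex of the empty word. -/
def oneComplex (n : ℕ) : CochainComplex (Bimod (Poly k n)) ℤ :=
  CochainComplex.of (oneX k n) (fun _ => 0) (fun _ => Limits.zero_comp)

/-- The two-term complex of a letter. -/
def letterComplex : Letter m → CochainComplex (Bimod (Poly k (m + 1))) ℤ
  | (i, true) => posComplex k i
  | (i, false) => negComplex k i

/-- `F(w) = F(σ_{i_1}^{ε_1}) ⊗_R F(σ_{i_2}^{ε_2}) ⊗_R ⋯`. -/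
def wordComplex : BraidWord m → CochainComplex (Bimod (Poly k (m + 1))) ℤ
  | [] => oneComplex k (m + 1)
  | l :: w => tensorComplex (letterComplex k l) (wordComplex w)

/-- The same word on one more strand. -/
def BraidWord.extend (w : BraidWord m) : BraidWord (m + 1) :=
  w.map fun l => (l.1.castSucc, l.2)

end Soergel

/-! ### Hochschild homology through the Koszul complex -/

section Koszul

variable (k : Type) [CommRing k] (n : ℕ)

/-- The element `x_a ⊗ 1 - 1 ⊗ x_a` of `R ⊗ R`. -/
def wEnv (a : Fin n) : Env (Poly k n) := lef (MvPolynomial.X a) - rig (MvPolynomial.X a)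

/-- Koszul chains of Hochschild degree `h`: a chain `f` stands for `∑_S f(S) λ_S`, where `S` runs
over the subsets of the index set with `h` elements and `λ_S` is the product of the exterior
generators `λ_a`, `a ∈ S`, in increasing order. -/
abbrev Kos (M : Type) (h : ℤ) : Type := {S : Finset (Fin n) // (S.card : ℤ) = h} → M

/-- The sign of the position of `a` with respect to `T`. -/
def kosSign (a : Fin n) (T : Finset (Fin n)) : ℤ := (-1) ^ (T.filter (· < a)).card

section

variable (M : Type) [AddCommGroup M] [Module (Env (Poly k n)) M]

/-- The Koszul differential, with `d(λ_a) = x_a ⊗ 1 - 1 ⊗ x_a`; it vanishes unless `h = h' + 1`. -/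
def kosD (h h' : ℤ) : Kos n M h →ₗ[Env (Poly k n)] Kos n M h' :=
  LinearMap.pi fun T => ∑ a : Fin n,
    if H : a ∉ T.1 ∧ ((insert a T.1).card : ℤ) = h then
      kosSign n a T.1 • wEnv k n a • LinearMap.proj ⟨insert a T.1, H.2⟩
    else 0

variable {M} in
theorem kosD_apply (h h' : ℤ) (f : Kos n M h) (T : {S : Finset (Fin n) // (S.card : ℤ) = h'}) :
    kosD k n M h h' f T = ∑ a : Fin n,
      if H : a ∉ T.1 ∧ ((insert a T.1).card : ℤ) = h then
        kosSign n a T.1 • wEnv k n a • f ⟨insert a T.1, H.2⟩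
      else 0 := by
  rw [kosD, LinearMap.pi_apply, LinearMap.sum_apply]
  refine Finset.sum_congr rfl fun a _ => ?_
  split_ifs <;> rfl

theorem kosD_shape (h h' : ℤ) (hh : h' + 1 ≠ h) : kosD k n M h h' = 0 := by
  refine LinearMap.ext fun f => funext fun T => ?_
  rw [kosD_apply]
  refine Finset.sum_eq_zero fun a _ => dif_neg fun H => hh ?_
  have h1 := H.2
  have h2 := T.2
  rw [Finset.card_insert_of_notMem H.1] at h1
  push_cast at h1
  omega

theorem kosSign_antisymm {a b : Fin n} {T : Finset (Fin n)} (ha : a ∉ T) (hb : b ∉ T)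
    (hab : a ≠ b) : kosSign n a T * kosSign n b (insert a T) =
      -(kosSign n b T * kosSign n a (insert b T)) := by
  have main : ∀ {a b : Fin n}, a ∉ T → a < b → kosSign n a T * kosSign n b (insert a T) =
      -(kosSign n b T * kosSign n a (insert b T)) := by
    intro a b ha hlt
    have h1 : (insert a T).filter (· < b) = insert a (T.filter (· < b)) := by
      rw [Finset.filter_insert, if_pos hlt]
    have h2 : (insert b T).filter (· < a) = T.filter (· < a) := by
      rw [Finset.filter_insert, if_neg (not_lt.2 hlt.le)]
    have h3 : a ∉ T.filter (· < b) := fun h => ha (Finset.mem_filter.1 h).1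
    rw [kosSign, kosSign, kosSign, kosSign, h1, h2, Finset.card_insert_of_notMem h3, pow_succ]
    ring
  rcases lt_or_gt_of_ne hab with h | h
  · exact main ha h
  · rw [main hb h, neg_neg]

theorem kosD_comp (h h' h'' : ℤ) : kosD k n M h' h'' ∘ₗ kosD k n M h h' = 0 := by
  by_cases e1 : h' + 1 = h
  swap
  · rw [kosD_shape k n M h h' e1, LinearMap.comp_zero]
  by_cases e2 : h'' + 1 = h'
  swap
  · rw [kosD_shape k n M h' h'' e2, LinearMap.zero_comp]
  refine LinearMap.ext fun f => funext fun T => ?_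
  let F : Finset (Fin n) → M := fun S => if H : (S.card : ℤ) = h then f ⟨S, H⟩ else 0
  let G : Fin n → Fin n → M := fun a b => if a ∉ T.1 ∧ b ∉ insert a T.1 then
    (kosSign n a T.1 * kosSign n b (insert a T.1)) • (wEnv k n a * wEnv k n b) •
      F (insert b (insert a T.1)) else 0
  have hG : ∀ a b, G a b + G b a = 0 := by
    intro a b
    by_cases hc : a ∉ T.1 ∧ b ∉ insert a T.1
    · have hab : a ≠ b := fun e => hc.2 (e ▸ Finset.mem_insert_self a T.1)
      have hb : b ∉ T.1 := fun e => hc.2 (Finset.mem_insert_of_mem e)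
      have ha : a ∉ insert b T.1 := by
        rw [Finset.mem_insert]; tauto
      have e1 : G a b = (kosSign n a T.1 * kosSign n b (insert a T.1)) •
        (wEnv k n a * wEnv k n b) • F (insert b (insert a T.1)) := if_pos hc
      have e2 : G b a = (kosSign n b T.1 * kosSign n a (insert b T.1)) •
        (wEnv k n b * wEnv k n a) • F (insert a (insert b T.1)) := if_pos ⟨hb, ha⟩
      rw [e1, e2, kosSign_antisymm n hc.1 hb hab, Finset.insert_comm, mul_comm (wEnv k n a), neg_smul,
        neg_add_cancel]
    · have e1 : G a b = 0 := if_neg hc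
      have e2 : G b a = 0 := if_neg (by
        rw [Finset.mem_insert] at hc ⊢
        tauto)
      rw [e1, e2, add_zero]
  have h1 : (kosD k n M h' h'' ∘ₗ kosD k n M h h') f T = ∑ a, ∑ b, G a b := by
    rw [LinearMap.comp_apply, kosD_apply]
    refine Finset.sum_congr rfl fun a _ => ?_
    by_cases ha : a ∈ T.1
    · rw [dif_neg (fun H => H.1 ha)]
      exact (Finset.sum_eq_zero fun b _ => if_neg (fun H => H.1 ha)).symm
    have hc : ((insert a T.1).card : ℤ) = h' := by
      have := T.2
      rw [Finset.card_insert_of_notMem ha]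
      push_cast
      omega
    rw [dif_pos ⟨ha, hc⟩, kosD_apply, Finset.smul_sum, Finset.smul_sum]
    refine Finset.sum_congr rfl fun b _ => ?_
    by_cases hb : b ∈ insert a T.1
    · rw [dif_neg (fun H => H.1 hb), smul_zero, smul_zero]
      exact (if_neg (fun H => H.2 hb)).symm
    have hc' : ((insert b (insert a T.1)).card : ℤ) = h := by
      rw [Finset.card_insert_of_notMem hb]
      push_cast
      omega
    have e : G a b = (kosSign n a T.1 * kosSign n b (insert a T.1)) •
        (wEnv k n a * wEnv k n b) • F (insert b (insert a T.1)) := if_pos ⟨ha, hb⟩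
    have e' : F (insert b (insert a T.1)) = f ⟨insert b (insert a T.1), hc'⟩ := dif_pos hc'
    rw [dif_pos ⟨hb, hc'⟩, e, e', mul_smul, mul_smul, smul_comm (wEnv k n a) (kosSign n b _)]
  rw [h1, ← Finset.sum_product']
  refine Finset.sum_involution (fun x _ => (x.2, x.1)) (fun x _ => hG x.1 x.2) ?_
    (fun _ _ => Finset.mem_univ _) (fun _ _ => rfl)
  intro x _ hx hxx
  have hx12 : x.2 = x.1 := congrArg Prod.fst hxx
  refine hx (if_neg fun H => H.2 ?_)
  rw [hx12]
  exact Finset.mem_insert_self _ _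

variable {M} in
theorem kosD_natural {N : Type} [AddCommGroup N] [Module (Env (Poly k n)) N]
    (f : M →ₗ[Env (Poly k n)] N) (h h' : ℤ) (c : Kos n M h)
    (T : {S : Finset (Fin n) // (S.card : ℤ) = h'}) :
    kosD k n N h h' (fun S => f (c S)) T = f (kosD k n M h h' c T) := by
  rw [kosD_apply, kosD_apply, map_sum]
  refine Finset.sum_congr rfl fun a _ => ?_
  split_ifs
  · rw [map_zsmul, map_smul]
  · rw [map_zero]

end

/-- The Koszul complex of a bimodule. -/
def kosComplex (M : Bimod (Poly k n)) : ChainComplex Ab ℤ where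
  X h := AddCommGrpCat.of (Kos n M h)
  d h h' := AddCommGrpCat.ofHom (kosD k n M h h').toAddMonoidHom
  shape h h' hh := by
    rw [kosD_shape k n M h h' hh]; rfl
  d_comp_d' h h' h'' _ _ := by
    rw [← AddCommGrpCat.ofHom_comp]
    have := congrArg LinearMap.toAddMonoidHom (kosD_comp k n M h h' h'')
    exact congrArg AddCommGrpCat.ofHom this

/-- The Koszul complex as a functor of the bimodule. -/
def kosFunctor : Bimod (Poly k n) ⥤ ChainComplex Ab ℤ where
  obj M := kosComplex k n M
  map {M N} f :=
    { f := fun h => AddCommGrpCat.ofHom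
        (AddMonoidHom.mk' (fun (c : Kos n M h) S => f.hom (c S))
          (fun c c' => funext fun S => map_add f.hom (c S) (c' S)))
      comm' := fun h h' _ => by
        refine AddCommGrpCat.ext fun c => funext fun T => ?_
        exact kosD_natural k n f.hom h h' c T }

instance : (kosFunctor k n).Additive where
  map_add {M N f g} := by
    refine HomologicalComplex.hom_ext _ _ fun h => AddCommGrpCat.ext fun c => rfl

/-- Hochschild homology `HH_h(M, R)` of a bimodule over `R = k[x_0, …, x_{n-1}]`: the homology in
degree `h` of its Koszul complex. -/
def HH (h : ℤ) : Bimod (Poly k n) ⥤ Ab :=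
  kosFunctor k n ⋙ HomologicalComplex.homologyFunctor Ab (ComplexShape.down ℤ) h

instance (h : ℤ) : (HH k n h).Additive := by
  unfold HH; infer_instance

variable {k n}

/-- The cochain complex `HH_h(C^•, R)` obtained by applying `HH_h` to each term of a complex of
bimodules. -/
def HHComplex (C : CochainComplex (Bimod (Poly k n)) ℤ) (h : ℤ) : CochainComplex Ab ℤ :=
  ((HH k n h).mapHomologicalComplex (ComplexShape.up ℤ)).obj C

/-- The action of a polynomial on `HH_h(M, R)`. -/
def HHAct (M : Bimod (Poly k n)) (h : ℤ) (r : Poly k n) : (HH k n h).obj M ⟶ (HH k n h).obj M :=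
  (HH k n h).map (ModuleCat.ofHom (LinearMap.lsmul (Env (Poly k n)) M (lef r)))

end Koszul

/-! ### Internal (topological) gradings -/

section Grading

variable {k : Type} [CommRing k] {n m : ℕ}

/-- Degree `d` part of `R`, where each variable has degree `2`. -/
def polyDeg (d : ℤ) : AddSubgroup (Poly k n) :=
  ⨆ (e : ℕ) (_ : 2 * (e : ℤ) = d), (MvPolynomial.homogeneousSubmodule (Fin n) k e).toAddSubgroup

/-- Degree `d` part of `R`, viewed as a bimodule. -/
def ubDeg (d : ℤ) : AddSubgroup (UB k n) := polyDeg (k := k) (n := n) d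

/-- Degree `d` part of `B_i`. -/
def sbDeg (i : Fin m) (d : ℤ) : AddSubgroup (SB k i) :=
  AddSubgroup.closure {x | ∃ (d₁ d₂ : ℤ) (a b : Poly k (m + 1)), d₁ + d₂ = d ∧ a ∈ polyDeg d₁ ∧
    b ∈ polyDeg d₂ ∧ x = sbLeft k i a * sbRight k i b}

/-- A family of subgroups of homogeneous elements in each term of a complex. -/
abbrev Degrees (C : CochainComplex (Bimod (Poly k n)) ℤ) : Type :=
  ∀ j : ℤ, ℤ → AddSubgroup (C.X j)

/-- The grading on `F(σ_i)`. -/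
def posDegrees (i : Fin m) : Degrees (posComplex k i)
  | .ofNat 0 => fun d => (ubDeg d : AddSubgroup (UB k (m + 1)))
  | .ofNat (_ + 1) => fun _ => ⊤
  | .negSucc 0 => fun d => (sbDeg i d : AddSubgroup (SB k i))
  | .negSucc (_ + 1) => fun _ => ⊤

/-- The grading on `F(σ_i⁻¹)`; the Thom class `Th(-ζ_i)` has degree `-2`. -/
def negDegrees (i : Fin m) : Degrees (negComplex k i)
  | .ofNat 0 => fun d => (ubDeg d : AddSubgroup (UB k (m + 1)))
  | .ofNat 1 => fun d => (sbDeg i (d + 2) : AddSubgroup (SB k i))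
  | .ofNat (_ + 2) => fun _ => ⊤
  | .negSucc _ => fun _ => ⊤

/-- The grading on the complex of the empty word. -/
def oneDegrees : Degrees (oneComplex k n)
  | .ofNat 0 => fun d => (ubDeg d : AddSubgroup (UB k n))
  | .ofNat (_ + 1) => fun _ => ⊤
  | .negSucc _ => fun _ => ⊤

/-- The grading on a tensor product of complexes. -/
def tensorDegrees {C D : CochainComplex (Bimod (Poly k n)) ℤ} (gC : Degrees C) (gD : Degrees D) :
    Degrees (tensorComplex C D) := fun j d =>
  (⨆ ab : Deg j, AddSubgroup.map (tensorIncl C D ab).toAddMonoidHom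
    (AddSubgroup.closure {x | ∃ (d₁ d₂ : ℤ) (c : C.X ab.1.1) (c' : D.X ab.1.2), d₁ + d₂ = d ∧
      c ∈ gC ab.1.1 d₁ ∧ c' ∈ gD ab.1.2 d₂ ∧ x = BTensor.tmul c c'}) :
    AddSubgroup (tensorX C D j))

variable (k) in
/-- The grading on the complex of a letter. -/
def letterDegrees : ∀ l : Letter m, Degrees (letterComplex k l)
  | (i, true) => posDegrees i
  | (i, false) => negDegrees i

variable (k) in
/-- The grading on the complex of a word. -/
def wordDegrees : ∀ w : BraidWord m, Degrees (wordComplex k w)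
  | [] => oneDegrees
  | l :: w => tensorDegrees (letterDegrees k l) (wordDegrees w)

/-- Degree `d` Koszul chains; the exterior generators have degree `2`. -/
def kosDeg {M : Type} [AddCommGroup M] (g : ℤ → AddSubgroup M) (h d : ℤ) :
    AddSubgroup (Kos n M h) :=
  AddSubgroup.pi Set.univ fun _ => g (d - 2 * h)

/-- Degree `d` part of `HH_h(M, R)`: the classes of homogeneous Koszul cycles. -/
def HHDeg {M : Bimod (Poly k n)} (g : ℤ → AddSubgroup M) (h d : ℤ) :
    AddSubgroup ((HH k n h).obj M) :=
  AddSubgroup.map ((kosComplex k n M).homologyπ h).hom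
    (AddSubgroup.comap ((kosComplex k n M).iCycles h).hom (kosDeg g h d : AddSubgroup (Kos n M h)))

end Grading

/-! ### Reduced powers -/

section Powers

/-- Power series acting on sequences: `(g ⋆ s)_c = ∑_{a + b = c} g_a s_b`. -/
def conv {A M : Type} [CommRing A] [AddCommGroup M] [Module A M] (g : PowerSeries A) (s : ℕ → M) :
    ℕ → M := fun c => ∑ ab ∈ Finset.HasAntidiagonal.antidiagonal c, PowerSeries.coeff ab.1 g • s ab.2

theorem sum_antidiagonal_assoc {M : Type} [AddCommMonoid M] (F : ℕ → ℕ → ℕ → M) (c : ℕ) :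
    ∑ ij ∈ Finset.HasAntidiagonal.antidiagonal c,
      ∑ ab ∈ Finset.HasAntidiagonal.antidiagonal ij.1, F ab.1 ab.2 ij.2 =
    ∑ ij ∈ Finset.HasAntidiagonal.antidiagonal c,
      ∑ ab ∈ Finset.HasAntidiagonal.antidiagonal ij.2, F ij.1 ab.1 ab.2 := by
  rw [Finset.sum_sigma', Finset.sum_sigma']
  refine Finset.sum_nbij' (fun x => ⟨(x.2.1, x.2.2 + x.1.2), (x.2.2, x.1.2)⟩)
    (fun x => ⟨(x.1.1 + x.2.1, x.2.2), (x.1.1, x.2.1)⟩) ?_ ?_ ?_ ?_ ?_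
  · rintro ⟨⟨i, j⟩, ⟨a, b⟩⟩ h
    simp only [Finset.mem_sigma, Finset.HasAntidiagonal.mem_antidiagonal] at h ⊢
    obtain ⟨h1, h2⟩ := h
    subst h2
    subst h1
    exact ⟨by ring, trivial⟩
  · rintro ⟨⟨i, j⟩, ⟨a, b⟩⟩ h
    simp only [Finset.mem_sigma, Finset.HasAntidiagonal.mem_antidiagonal] at h ⊢
    obtain ⟨h1, h2⟩ := h
    subst h2
    subst h1
    exact ⟨by ring, trivial⟩
  · rintro ⟨⟨i, j⟩, ⟨a, b⟩⟩ h
    simp only [Finset.mem_sigma, Finset.HasAntidiagonal.mem_antidiagonal] at h ⊢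
    obtain ⟨h1, h2⟩ := h
    subst h2
    rfl
  · rintro ⟨⟨i, j⟩, ⟨a, b⟩⟩ h
    simp only [Finset.mem_sigma, Finset.HasAntidiagonal.mem_antidiagonal] at h ⊢
    obtain ⟨h1, h2⟩ := h
    subst h2
    rfl
  · rintro ⟨⟨i, j⟩, ⟨a, b⟩⟩ _
    rfl

section

variable {A M : Type} [CommRing A] [AddCommGroup M] [Module A M]

theorem conv_add (g : PowerSeries A) (s u : ℕ → M) : conv g (s + u) = conv g s + conv g u := by
  funext c
  simp only [conv, Pi.add_apply, smul_add, Finset.sum_add_distrib]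

theorem conv_zero (g : PowerSeries A) : conv g (0 : ℕ → M) = 0 := by
  funext c
  simp [conv]

theorem conv_sub_left (g g' : PowerSeries A) (s : ℕ → M) :
    conv (g - g') s = conv g s - conv g' s := by
  funext c
  simp only [conv, Pi.sub_apply, map_sub, sub_smul, Finset.sum_sub_distrib]

theorem conv_mul (g g' : PowerSeries A) (s : ℕ → M) : conv (g * g') s = conv g (conv g' s) := by
  funext c
  simp only [conv, PowerSeries.coeff_mul, Finset.sum_smul, Finset.smul_sum, mul_smul]
  exact sum_antidiagonal_assoc
    (fun a b j => PowerSeries.coeff a g • PowerSeries.coeff b g' • s j) c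

theorem conv_C (a : A) (s : ℕ → M) (c : ℕ) : conv (PowerSeries.C a) s c = a • s c := by
  rw [conv, Finset.sum_eq_single (0, c)]
  · rw [PowerSeries.coeff_zero_C]
  · rintro ⟨i, j⟩ h hne
    have hi : i ≠ 0 := by
      rintro rfl
      rw [Finset.HasAntidiagonal.mem_antidiagonal, zero_add] at h
      exact hne (Prod.ext rfl h)
    rw [PowerSeries.coeff_C, if_neg hi, zero_smul]
  · intro h
    exact absurd (Finset.HasAntidiagonal.mem_antidiagonal.2 (zero_add c)) h

end

variable {k : Type} [CommRing k] {n m : ℕ} (p : ℕ)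

/-- The total reduced power `∑_c 𝒫^c t^c` on polynomials: the multiplicative operation with
`x ↦ x + x^p t` on each variable. -/
def powT : Poly k n →ₐ[k] PowerSeries (Poly k n) :=
  MvPolynomial.aeval fun a => PowerSeries.C (MvPolynomial.X a) +
    PowerSeries.X * PowerSeries.C (MvPolynomial.X a ^ p)

theorem powT_X (a : Fin n) : powT p (MvPolynomial.X a : Poly k n) =
    PowerSeries.C (MvPolynomial.X a) + PowerSeries.X * PowerSeries.C (MvPolynomial.X a ^ p) := by
  rw [powT, MvPolynomial.aeval_X]

theorem powT_rename (e : Fin n → Fin n) (f : Poly k n) :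
    powT p (MvPolynomial.rename e f) =
      PowerSeries.map (MvPolynomial.rename e : Poly k n →ₐ[k] Poly k n).toRingHom (powT p f) := by
  induction f using MvPolynomial.induction_on with
  | C c =>
    have h1 : (powT p (MvPolynomial.C c : Poly k n)) = PowerSeries.C (MvPolynomial.C c) := by
      rw [powT, MvPolynomial.aeval_C, PowerSeries.algebraMap_apply]; rfl
    rw [MvPolynomial.rename_C, h1, PowerSeries.map_C]
    congr 1
    exact (MvPolynomial.rename_C e c).symm
  | add f g hf hg => rw [map_add, map_add, map_add, map_add, hf, hg]
  | mul_X f a hf =>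
    rw [map_mul, map_mul, map_mul, map_mul, hf, MvPolynomial.rename_X, powT_X, powT_X, map_add,
      map_mul, PowerSeries.map_C, PowerSeries.map_C, PowerSeries.map_X]
    simp

/-- Operations `𝒫^0, 𝒫^1, …` on a bimodule satisfying the Cartan formula for both actions;
`P m c` is `𝒫^c m`. -/
structure PowerOps (k : Type) [CommRing k] (n p : ℕ) (M : Type) [AddCommGroup M] [Module (Env (Poly k n)) M] where
  P : M →+ (ℕ → M)
  cartan_left : ∀ (r : Poly k n) (x : M),
    P ((lef r : Env (Poly k n)) • x) = conv (PowerSeries.map (lef : Poly k n →+* Env (Poly k n)) (powT p r)) (P x)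
  cartan_right : ∀ (r : Poly k n) (x : M),
    P ((rig r : Env (Poly k n)) • x) = conv (PowerSeries.map (rig : Poly k n →+* Env (Poly k n)) (powT p r)) (P x)

/-- The operations on the zero bimodule. -/
def zeroOps : PowerOps k n p PUnit where
  P := 0
  cartan_left _ _ := (conv_zero _).symm
  cartan_right _ _ := (conv_zero _).symm

/-- A polynomial as an element of the bimodule `R`. -/
def toUB (x : Poly k n) : UB k n := x

theorem ub_lef_smul (r x : Poly k n) :
    (lef r : Env (Poly k n)) • toUB x = toUB (r * x) :=
  congrArg (fun y : Poly k n => y * x) (mul_one r)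

theorem ub_rig_smul (r x : Poly k n) :
    (rig r : Env (Poly k n)) • toUB x = toUB (r * x) :=
  congrArg (fun y : Poly k n => y * x) (one_mul r)

/-- The coefficients of the total power of a polynomial. -/
def unitPow (x : Poly k n) : ℕ → UB k n :=
  fun c => toUB (PowerSeries.coeff c (powT p x))

theorem unitPow_mul_left (r x : Poly k n) : unitPow p (r * x) =
    conv (PowerSeries.map (lef : Poly k n →+* Env (Poly k n)) (powT p r)) (unitPow p x) := by
  funext c
  have h : unitPow p (r * x) c = ∑ ab ∈ Finset.HasAntidiagonal.antidiagonal c,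
      toUB (PowerSeries.coeff ab.1 (powT p r) * PowerSeries.coeff ab.2 (powT p x)) := by
    refine Eq.trans ?_ (PowerSeries.coeff_mul c (powT p r) (powT p x))
    rw [← map_mul]; rfl
  rw [h]
  refine Finset.sum_congr rfl fun ab _ => ?_
  rw [PowerSeries.coeff_map, unitPow, ub_lef_smul]

theorem unitPow_mul_right (r x : Poly k n) : unitPow p (r * x) =
    conv (PowerSeries.map (rig : Poly k n →+* Env (Poly k n)) (powT p r)) (unitPow p x) := by
  funext c
  have h : unitPow p (r * x) c = ∑ ab ∈ Finset.HasAntidiagonal.antidiagonal c,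
      toUB (PowerSeries.coeff ab.1 (powT p r) * PowerSeries.coeff ab.2 (powT p x)) := by
    refine Eq.trans ?_ (PowerSeries.coeff_mul c (powT p r) (powT p x))
    rw [← map_mul]; rfl
  rw [h]
  refine Finset.sum_congr rfl fun ab _ => ?_
  rw [PowerSeries.coeff_map, unitPow, ub_rig_smul]

theorem unitPow_add (x y : Poly k n) : unitPow p (x + y) = unitPow p x + unitPow p y := by
  funext c
  have h : PowerSeries.coeff c (powT p (x + y)) =
      PowerSeries.coeff c (powT p x) + PowerSeries.coeff c (powT p y) := by
    rw [map_add, map_add]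
  exact h

/-- The operations on `R`. -/
def unitOps : PowerOps k n p (UB k n) where
  P := AddMonoidHom.mk' (fun x => unitPow p (x : Poly k n)) (unitPow_add p)
  cartan_left r x :=
    (congrArg (unitPow p) (ub_lef_smul r x)).trans (unitPow_mul_left p r (x : Poly k n))
  cartan_right r x :=
    (congrArg (unitPow p) (ub_rig_smul r x)).trans (unitPow_mul_right p r (x : Poly k n))

theorem map_powT_invariant (i : Fin m) (f : invariants k i) :
    PowerSeries.map (sbLeft k i) (powT p (f : Poly k (m + 1))) =
      PowerSeries.map (sbRight k i) (powT p (f : Poly k (m + 1))) := by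
  ext c
  rw [PowerSeries.coeff_map, PowerSeries.coeff_map]
  apply sbLeft_invariant
  have h : MvPolynomial.rename (Equiv.swap i.castSucc i.succ) (f : Poly k (m + 1)) = f := f.2
  have h2 := congrArg (PowerSeries.coeff c)
    (powT_rename p (Equiv.swap i.castSucc i.succ) (f : Poly k (m + 1)))
  rw [h, PowerSeries.coeff_map] at h2
  exact h2.symm

/-- `𝒫_t(a ⊗ b) = 𝒫_t(a) ⊗ 𝒫_t(b)` on `B_i`. -/
def sbPow (i : Fin m) : SB k i →+ PowerSeries (SB k i) :=
  TensorProduct.liftAddHom (R := invariants k i) (M := Poly k (m + 1)) (N := Poly k (m + 1))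
    ((AddMonoidHom.compHom' ((PowerSeries.map (sbRight k i)).comp
        (powT p : Poly k (m + 1) →ₐ[k] _).toRingHom).toAddMonoidHom).comp
      (AddMonoidHom.mul.comp ((PowerSeries.map (sbLeft k i)).comp
        (powT p : Poly k (m + 1) →ₐ[k] _).toRingHom).toAddMonoidHom))
    (fun f a b => by
      change PowerSeries.map (sbLeft k i) (powT p ((f : Poly k (m + 1)) * a)) *
          PowerSeries.map (sbRight k i) (powT p b) =
        PowerSeries.map (sbLeft k i) (powT p a) *
          PowerSeries.map (sbRight k i) (powT p ((f : Poly k (m + 1)) * b))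
      rw [map_mul, map_mul, map_mul, map_mul, map_powT_invariant]
      ring)

theorem sb_tmul (i : Fin m) (a b : Poly k (m + 1)) :
    sbLeft k i a * sbRight k i b = (a ⊗ₜ[invariants k i] b :
      Poly k (m + 1) ⊗[invariants k i] Poly k (m + 1)) := by
  refine (Algebra.TensorProduct.tmul_mul_tmul (R := invariants k i) a 1 1 b).trans ?_
  rw [mul_one, one_mul]

theorem sbPow_mul (i : Fin m) (a b : Poly k (m + 1)) :
    sbPow p i (sbLeft k i a * sbRight k i b) =
      PowerSeries.map (sbLeft k i) (powT p a) * PowerSeries.map (sbRight k i) (powT p b) := by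
  rw [sb_tmul]
  rfl

theorem SB.induction (i : Fin m) {q : SB k i → Prop} (x : SB k i) (zero : q 0)
    (tmul : ∀ a b, q (sbLeft k i a * sbRight k i b)) (add : ∀ x y, q x → q y → q (x + y)) : q x :=
  TensorProduct.induction_on (R := invariants k i) (M := Poly k (m + 1)) (N := Poly k (m + 1))
    x zero (fun a b => sb_tmul i a b ▸ tmul a b) add

theorem sbPow_left (i : Fin m) (r : Poly k (m + 1)) (x : SB k i) :
    sbPow p i (sbLeft k i r * x) = PowerSeries.map (sbLeft k i) (powT p r) * sbPow p i x := by
  induction x using SB.induction with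
  | zero => rw [mul_zero, map_zero, mul_zero]
  | add x y hx hy => rw [mul_add, map_add, map_add, mul_add, hx, hy]
  | tmul a b => rw [← mul_assoc, ← map_mul, sbPow_mul, sbPow_mul, map_mul, map_mul, mul_assoc]

theorem sbPow_right (i : Fin m) (r : Poly k (m + 1)) (x : SB k i) :
    sbPow p i (sbRight k i r * x) = PowerSeries.map (sbRight k i) (powT p r) * sbPow p i x := by
  induction x using SB.induction with
  | zero => rw [mul_zero, map_zero, mul_zero]
  | add x y hx hy => rw [mul_add, map_add, map_add, mul_add, hx, hy]
  | tmul a b =>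
    rw [mul_left_comm, ← map_mul, sbPow_mul, sbPow_mul, map_mul, map_mul, mul_left_comm]

/-- The operations on `B_i`, determined by `𝒫_t(a ⊗ b) = 𝒫_t(a) ⊗ 𝒫_t(b)`. -/
def sbOps (i : Fin m) : PowerOps k (m + 1) p (SB k i) where
  P := AddMonoidHom.mk' (fun x c => PowerSeries.coeff c (sbPow p i x)) (fun x y =>
    funext fun c => by
      rw [map_add, map_add]; rfl)
  cartan_left r x := by
    funext c
    change PowerSeries.coeff c (sbPow p i (lef r • x)) = _
    rw [sb_smul, sbOfEnv_lef, sbPow_left, PowerSeries.coeff_mul]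
    refine Finset.sum_congr rfl fun ab _ => ?_
    rw [PowerSeries.coeff_map, PowerSeries.coeff_map, sb_smul, sbOfEnv_lef]
    rfl
  cartan_right r x := by
    funext c
    change PowerSeries.coeff c (sbPow p i (rig r • x)) = _
    rw [sb_smul, sbOfEnv_rig, sbPow_right, PowerSeries.coeff_mul]
    refine Finset.sum_congr rfl fun ab _ => ?_
    rw [PowerSeries.coeff_map, PowerSeries.coeff_map, sb_smul, sbOfEnv_rig]
    rfl

/-- The power series `(1 + z^{p-1} t)⁻¹ = ∑_b (-z^{p-1})^b t^b`. -/
def thomInv {A : Type} [CommRing A] (z : A) : PowerSeries A :=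
  PowerSeries.mk fun b => (-(z ^ (p - 1))) ^ b

theorem thomInv_mul {A : Type} [CommRing A] (z : A) :
    thomInv p z * (1 + PowerSeries.X * PowerSeries.C (z ^ (p - 1))) = 1 := by
  ext c
  rw [mul_add, mul_one, ← mul_assoc, map_add, PowerSeries.coeff_mul_C, thomInv]
  cases c with
  | zero => simp
  | succ c =>
    rw [PowerSeries.coeff_succ_mul_X, PowerSeries.coeff_mk, PowerSeries.coeff_mk,
      PowerSeries.coeff_one, if_neg (Nat.succ_ne_zero c), pow_succ]
    ring

variable {p} in
/-- Twisting operations by a Thom class `Th` with `𝒫_t(Th) = Th · (1 + z^{p-1} t)⁻¹`, the Thom class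
of minus a line bundle with first Chern class `z`: an element `x` stands for `x · Th`. -/
def PowerOps.twist {M : Type} [AddCommGroup M] [Module (Env (Poly k n)) M]
    (o : PowerOps k n p M) (z : Env (Poly k n)) : PowerOps k n p M where
  P := AddMonoidHom.mk' (fun x => conv (thomInv p z) (o.P x)) (fun x y => by
    rw [map_add, conv_add])
  cartan_left r x := by
    change conv (thomInv p z) (o.P (lef r • x)) = conv _ (conv (thomInv p z) (o.P x))
    rw [o.cartan_left, ← conv_mul, ← conv_mul, mul_comm]
  cartan_right r x := by
    change conv (thomInv p z) (o.P (rig r • x)) = conv _ (conv (thomInv p z) (o.P x))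
    rw [o.cartan_right, ← conv_mul, ← conv_mul, mul_comm]

section

variable {M N : Type} [AddCommGroup M] [Module (Env (Poly k n)) M]
  [AddCommGroup N] [Module (Env (Poly k n)) N]

/-- `(s ⊗ u)_c = ∑_{a + b = c} s_a ⊗ u_b`. -/
def tconv (s : ℕ → M) (u : ℕ → N) : ℕ → BTensor (Poly k n) M N := fun c =>
  ∑ ab ∈ Finset.HasAntidiagonal.antidiagonal c, BTensor.tmul (s ab.1) (u ab.2)

variable (k n M N) in
/-- `tconv` as a biadditive map. -/
def tconvHom : (ℕ → M) →+ (ℕ → N) →+ (ℕ → BTensor (Poly k n) M N) :=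
  AddMonoidHom.mk' (fun s => AddMonoidHom.mk' (fun u => tconv s u) (fun u u' => funext fun c => by
      simp only [tconv, Pi.add_apply, BTensor.tmul_add, Finset.sum_add_distrib]))
    (fun s s' => AddMonoidHom.ext fun u => funext fun c => by
      change tconv (k := k) (n := n) (s + s') u c = tconv s u c + tconv s' u c
      simp only [tconv, Pi.add_apply, BTensor.add_tmul, Finset.sum_add_distrib])

theorem tmul_sum {ι : Type} (t : Finset ι) (x : M) (f : ι → N) :
    (BTensor.tmul x (∑ i ∈ t, f i) : BTensor (Poly k n) M N) = ∑ i ∈ t, BTensor.tmul x (f i) :=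
  map_sum (BTensor.mk (Poly k n) M N x) f t

theorem sum_tmul {ι : Type} (t : Finset ι) (f : ι → M) (x : N) :
    (BTensor.tmul (∑ i ∈ t, f i) x : BTensor (Poly k n) M N) = ∑ i ∈ t, BTensor.tmul (f i) x :=
  map_sum ((BTensor.mk (Poly k n) M N).flip x) f t

theorem tconv_left (g : PowerSeries (Poly k n)) (s : ℕ → M) (u : ℕ → N) :
    tconv (conv (PowerSeries.map lef g) s) u =
      conv (PowerSeries.map lef g) (tconv (k := k) (n := n) s u) := by
  funext c
  simp only [tconv, conv, sum_tmul, Finset.smul_sum, PowerSeries.coeff_map, BTensor.lef_smul]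
  exact sum_antidiagonal_assoc
    (fun a b j => BTensor.tmul (lef (PowerSeries.coeff a g) • s b) (u j)) c

theorem tconv_balanced (g : PowerSeries (Poly k n)) (s : ℕ → M) (u : ℕ → N) :
    (tconv (conv (PowerSeries.map rig g) s) u : ℕ → BTensor (Poly k n) M N) =
      tconv s (conv (PowerSeries.map lef g) u) := by
  funext c
  simp only [tconv, conv, sum_tmul, tmul_sum, PowerSeries.coeff_map, BTensor.balanced]
  refine Eq.trans ?_ (sum_antidiagonal_assoc
    (fun b a j => BTensor.tmul (s b) (lef (PowerSeries.coeff a g) • u j)) c)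
  refine Finset.sum_congr rfl fun ij _ => ?_
  exact Finset.Nat.sum_antidiagonal_swap (f := fun ab : ℕ × ℕ =>
    BTensor.tmul (s ab.1) (lef (PowerSeries.coeff ab.2 g) • u ij.2))

theorem tconv_right (g : PowerSeries (Poly k n)) (s : ℕ → M) (u : ℕ → N) :
    tconv s (conv (PowerSeries.map rig g) u) =
      conv (PowerSeries.map rig g) (tconv (k := k) (n := n) s u) := by
  funext c
  simp only [tconv, conv, tmul_sum, Finset.smul_sum, PowerSeries.coeff_map, BTensor.rig_smul]
  rw [← sum_antidiagonal_assoc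
      (fun b a j => BTensor.tmul (s b) (rig (PowerSeries.coeff a g) • u j)) c,
    ← sum_antidiagonal_assoc
      (fun a b j => BTensor.tmul (s b) (rig (PowerSeries.coeff a g) • u j)) c]
  refine Finset.sum_congr rfl fun ij _ => ?_
  exact (Finset.Nat.sum_antidiagonal_swap (f := fun ab : ℕ × ℕ =>
    BTensor.tmul (s ab.2) (rig (PowerSeries.coeff ab.1 g) • u ij.2)))

variable {p} in
/-- The operations on `M ⊗_R N`: `𝒫^c(x ⊗ y) = ∑_{a + b = c} 𝒫^a(x) ⊗ 𝒫^b(y)`. -/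
def PowerOps.tensor (o : PowerOps k n p M) (o' : PowerOps k n p N) :
    PowerOps k n p (BTensor (Poly k n) M N) :=
  let Q : BTensor (Poly k n) M N →+ (ℕ → BTensor (Poly k n) M N) :=
    BTensor.lift ((AddMonoidHom.compHom' o'.P).comp ((tconvHom k n M N).comp o.P)) (fun r x y => by
      change tconv (k := k) (n := n) (o.P ((rig r : Env (Poly k n)) • x)) (o'.P y) =
        tconv (o.P x) (o'.P ((lef r : Env (Poly k n)) • y))
      rw [o.cartan_right, o'.cartan_left, tconv_balanced])
  { P := Q
    cartan_left := fun r x => by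
      induction x using BTensor.induction with
      | zero => rw [smul_zero, map_zero, conv_zero]
      | add x y hx hy => rw [smul_add, map_add, map_add, conv_add, hx, hy]
      | tmul x y =>
        rw [BTensor.lef_smul]
        change tconv (k := k) (n := n) (o.P ((lef r : Env (Poly k n)) • x)) (o'.P y) = conv _ (tconv (o.P x) (o'.P y))
        rw [o.cartan_left, tconv_left]
    cartan_right := fun r x => by
      induction x using BTensor.induction with
      | zero => rw [smul_zero, map_zero, conv_zero]
      | add x y hx hy => rw [smul_add, map_add, map_add, conv_add, hx, hy]
      | tmul x y =>
        rw [BTensor.rig_smul]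
        change tconv (k := k) (n := n) (o.P x) (o'.P ((rig r : Env (Poly k n)) • y)) = conv _ (tconv (o.P x) (o'.P y))
        rw [o'.cartan_right, tconv_right] }

end

theorem directSum_conv_apply {ι A : Type} [CommRing A] {M : ι → Type} [∀ i, AddCommGroup (M i)]
    [∀ i, Module A (M i)] (g : PowerSeries A) (s : ℕ → DirectSum ι M) (c : ℕ) (i : ι) :
    conv g s c i = conv g (fun c => s c i) c :=
  map_sum (DFinsupp.evalAddMonoidHom i : DirectSum ι M →+ M i) _ _

variable {p} in
/-- Operations on a direct sum, componentwise. -/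
def directSumPow {ι : Type} {M : ι → Type} [∀ i, AddCommGroup (M i)]
    [∀ i, Module (Env (Poly k n)) (M i)] (o : ∀ i, PowerOps k n p (M i)) :
    DirectSum ι M →+ (ℕ → DirectSum ι M) :=
  AddMonoidHom.mk' (fun x c =>
      DirectSum.map (fun i => (Pi.evalAddMonoidHom (fun _ : ℕ => M i) c).comp (o i).P) x)
    (fun x y => funext fun _ => map_add _ x y)

variable {p} in
/-- The operations on a direct sum. -/
def PowerOps.directSum {ι : Type} {M : ι → Type} [∀ i, AddCommGroup (M i)]
    [∀ i, Module (Env (Poly k n)) (M i)] (o : ∀ i, PowerOps k n p (M i)) :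
    PowerOps k n p (DirectSum ι M) where
  P := directSumPow o
  cartan_left r x := funext fun c => DFinsupp.ext fun i => by
    refine (congrFun ((o i).cartan_left r (x i)) c).trans ?_
    exact (directSum_conv_apply
      (PowerSeries.map (lef : Poly k n →+* Env (Poly k n)) (powT p r)) (directSumPow o x) c i).symm
  cartan_right r x := funext fun c => DFinsupp.ext fun i => by
    refine (congrFun ((o i).cartan_right r (x i)) c).trans ?_
    exact (directSum_conv_apply
      (PowerSeries.map (rig : Poly k n →+* Env (Poly k n)) (powT p r)) (directSumPow o x) c i).symm

/-- Operations on every term of a complex. -/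
abbrev PowerFamily (C : CochainComplex (Bimod (Poly k n)) ℤ) : Type :=
  ∀ j : ℤ, PowerOps k n p (C.X j)

/-- The operations on `F(σ_i)`. -/
def posPowers (i : Fin m) : PowerFamily p (posComplex k i)
  | .ofNat 0 => (unitOps p : PowerOps k (m + 1) p (UB k (m + 1)))
  | .ofNat (_ + 1) => zeroOps p
  | .negSucc 0 => (sbOps p i : PowerOps k (m + 1) p (SB k i))
  | .negSucc (_ + 1) => zeroOps p

/-- The operations on `F(σ_i⁻¹)`, with the term `B_i` twisted by the Thom class of `-ζ_i`. -/
def negPowers (i : Fin m) : PowerFamily p (negComplex k i)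
  | .ofNat 0 => (unitOps p : PowerOps k (m + 1) p (UB k (m + 1)))
  | .ofNat 1 => ((sbOps p i).twist (zEnv k i) : PowerOps k (m + 1) p (SB k i))
  | .ofNat (_ + 2) => zeroOps p
  | .negSucc _ => zeroOps p

/-- The operations on the complex of the empty word. -/
def onePowers : PowerFamily p (oneComplex k n)
  | .ofNat 0 => (unitOps p : PowerOps k n p (UB k n))
  | .ofNat (_ + 1) => zeroOps p
  | .negSucc _ => zeroOps p

variable {p} in
/-- The operations on a tensor product of complexes. -/
def tensorPowers {C D : CochainComplex (Bimod (Poly k n)) ℤ} (oC : PowerFamily p C)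
    (oD : PowerFamily p D) : PowerFamily p (tensorComplex C D) := fun j =>
  (PowerOps.directSum fun ab : Deg j => (oC ab.1.1).tensor (oD ab.1.2) :
    PowerOps k n p (tensorX C D j))

variable (k) in
/-- The operations on the complex of a letter. -/
def letterPowers : ∀ l : Letter m, PowerFamily p (letterComplex k l)
  | (i, true) => posPowers p i
  | (i, false) => negPowers p i

variable (k) in
/-- The operations on the complex of a word. -/
def wordPowers : ∀ w : BraidWord m, PowerFamily p (wordComplex k w)
  | [] => onePowers p
  | l :: w => tensorPowers (letterPowers k p l) (wordPowers w)

/-- The power series `∏_{a ∈ S} (1 + (x_a ⊗ 1 - 1 ⊗ x_a)^{p-1} t)`. -/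
def lamSeries (S : Finset (Fin n)) : PowerSeries (Env (Poly k n)) :=
  ∏ a ∈ S, (1 + PowerSeries.X * PowerSeries.C (wEnv k n a ^ (p - 1)))

variable {p} in
/-- The operations on Koszul chains, determined by the Cartan formula and
`𝒫_t(λ_a) = λ_a (1 + (x_a ⊗ 1 - 1 ⊗ x_a)^{p-1} t)`. -/
def kosPow {M : Type} [AddCommGroup M] [Module (Env (Poly k n)) M]
    (o : PowerOps k n p M) (c : ℕ) (h : ℤ) : Kos n M h →+ Kos n M h :=
  AddMonoidHom.mk' (fun f S => conv (lamSeries (k := k) p S.1) (o.P (f S)) c) (fun f f' =>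
    funext fun S => by
      change conv _ (o.P (f S + f' S)) c = conv _ (o.P (f S)) c + conv _ (o.P (f' S)) c
      rw [map_add, conv_add]; rfl)

theorem wEnv_pow [CharP k p] (hp : p.Prime) (a : Fin n) :
    (wEnv k n a) ^ p = lef (MvPolynomial.X a ^ p) - rig (MvPolynomial.X a ^ p) := by
  have h0 : ((p : ℕ) : Env (Poly k n)) = 0 := by
    have h1 : ((p : ℕ) : Poly k n) = 0 := by
      rw [← map_natCast (MvPolynomial.C : k →+* Poly k n), CharP.cast_eq_zero, map_zero]
    rw [← map_natCast (lef : Poly k n →+* Env (Poly k n)), h1]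
    exact map_zero lef
  obtain ⟨r, hr⟩ := exists_add_pow_prime_eq hp (wEnv k n a) (rig (MvPolynomial.X a))
  rw [h0, wEnv, sub_add_cancel] at hr
  rw [map_pow, map_pow, hr, wEnv]
  ring

/-- `conv` as an additive map. -/
def convHom {A M : Type} [CommRing A] [AddCommGroup M] [Module A M] (g : PowerSeries A) (c : ℕ) :
    (ℕ → M) →+ M :=
  AddMonoidHom.mk' (fun s => conv g s c) (fun s u => congrFun (conv_add g s u) c)

theorem lamSeries_insert {a : Fin n} {T : Finset (Fin n)} (ha : a ∉ T) :
    lamSeries (k := k) p (insert a T) =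
      (1 + PowerSeries.X * PowerSeries.C (wEnv k n a ^ (p - 1))) * lamSeries p T :=
  Finset.prod_insert ha

variable {p} in
theorem pow_wEnv_smul [CharP k p] (hp : p.Prime) {M : Type} [AddCommGroup M]
    [Module (Env (Poly k n)) M] (o : PowerOps k n p M) (a : Fin n) (x : M) :
    o.P (wEnv k n a • x) = conv (PowerSeries.C (wEnv k n a) *
      (1 + PowerSeries.X * PowerSeries.C (wEnv k n a ^ (p - 1)))) (o.P x) := by
  have h1 : PowerSeries.C (wEnv k n a) *
      (1 + PowerSeries.X * PowerSeries.C (wEnv k n a ^ (p - 1))) =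
      PowerSeries.map lef (powT p (MvPolynomial.X a)) -
        PowerSeries.map rig (powT p (MvPolynomial.X a)) := by
    have h2 : PowerSeries.C (wEnv k n a) * PowerSeries.C (wEnv k n a ^ (p - 1)) =
        PowerSeries.C (lef (MvPolynomial.X a ^ p)) - PowerSeries.C (rig (MvPolynomial.X a ^ p)) := by
      rw [← map_mul, mul_pow_sub_one hp.ne_zero, wEnv_pow p hp, map_sub]
    have h3 : PowerSeries.C (wEnv k n a) =
        PowerSeries.C (lef (MvPolynomial.X a)) - PowerSeries.C (rig (MvPolynomial.X a)) := by
      rw [wEnv, map_sub]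
    simp only [powT_X, map_add, map_mul, PowerSeries.map_C, PowerSeries.map_X]
    linear_combination PowerSeries.X * h2 + h3
  rw [h1, conv_sub_left, ← o.cartan_left, ← o.cartan_right, ← map_sub, wEnv, sub_smul]

variable {p} in
theorem kosPow_comm [CharP k p] (hp : p.Prime) {M : Type} [AddCommGroup M]
    [Module (Env (Poly k n)) M] (o : PowerOps k n p M) (c : ℕ) (h h' : ℤ)
    (f : Kos n M h) : kosD k n M h h' (kosPow o c h f) = kosPow o c h' (kosD k n M h h' f) := by
  funext T
  have hR : kosPow o c h' (kosD k n M h h' f) T = convHom (lamSeries (k := k) p T.1) c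
      (o.P (kosD k n M h h' f T)) := rfl
  rw [hR, kosD_apply, kosD_apply, map_sum, map_sum]
  refine Finset.sum_congr rfl fun a _ => ?_
  split_ifs with H
  · rw [map_zsmul, map_zsmul]
    congr 1
    change wEnv k n a • conv (lamSeries (k := k) p (insert a T.1)) (o.P _) c =
      conv (lamSeries (k := k) p T.1) (o.P (wEnv k n a • _)) c
    rw [pow_wEnv_smul hp, ← conv_mul, ← conv_C, ← conv_mul, lamSeries_insert p H.1]
    congr 1
    ring
  · rw [map_zero, map_zero]

variable {p} in
/-- The operation `𝒫^c` on the Koszul complex. -/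
def kosPowMap [CharP k p] [hp : Fact p.Prime] {M : Bimod (Poly k n)}
    (o : PowerOps k n p M) (c : ℕ) : kosComplex k n M ⟶ kosComplex k n M where
  f h := AddCommGrpCat.ofHom (kosPow o c h)
  comm' h h' _ := AddCommGrpCat.ext fun f => kosPow_comm hp.out o c h h' f

variable {p} in
/-- The operation `𝒫^c` on Hochschild homology. -/
def HHPow [CharP k p] [hp : Fact p.Prime] {M : Bimod (Poly k n)}
    (o : PowerOps k n p M) (c : ℕ) (h : ℤ) : (HH k n h).obj M ⟶ (HH k n h).obj M :=
  HomologicalComplex.homologyMap (kosPowMap o c) h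

end Powers

/-! ### Maps between complexes of Hochschild homology groups -/

section Maps

variable {k : Type} [CommRing k] {n : ℕ} {C : CochainComplex (Bimod (Poly k (n + 1))) ℤ}
  {D : CochainComplex (Bimod (Poly k n)) ℤ} {h h' : ℤ} {τ : ℤ → ℤ}

/-- A family of maps is linear over `k[x_0, …, x_{n-1}]`, acting on the source through its inclusion
into the polynomial ring with one more variable. -/
def IsPolyLinear (φ : ∀ j, (HHComplex C h).X j ⟶ (HHComplex D h').X (τ j)) : Prop :=
  ∀ (j : ℤ) (r : Poly k n),
    HHAct (C.X j) h (MvPolynomial.rename Fin.castSucc r) ≫ φ j = φ j ≫ HHAct (D.X (τ j)) h' r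

/-- A family of maps raises the internal degree by `e`. -/
def IsHomogeneousOfDegree (gC : Degrees C) (gD : Degrees D) (e : ℤ)
    (φ : ∀ j, (HHComplex C h).X j ⟶ (HHComplex D h').X (τ j)) : Prop :=
  ∀ (j d : ℤ), HHDeg (gC j) h d ≤ AddSubgroup.comap (φ j).hom (HHDeg (gD (τ j)) h' (d + e))

/-- A family of maps commutes with all reduced powers. -/
def RespectsPowers {p : ℕ} [CharP k p] [Fact p.Prime] (oC : PowerFamily p C) (oD : PowerFamily p D)
    (φ : ∀ j, (HHComplex C h).X j ⟶ (HHComplex D h').X (τ j)) : Prop :=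
  ∀ (j : ℤ) (c : ℕ), HHPow (oC j) c h ≫ φ j = φ j ≫ HHPow (oD (τ j)) c h'

/-- The components `K^j → L^{j-1}` of a morphism of complexes `K → L[-1]`. -/
def unshift {K L : CochainComplex Ab ℤ} (f : K ⟶ L⟦(-1 : ℤ)⟧) (j : ℤ) : K.X j ⟶ L.X (j - 1) :=
  f.f j ≫ (L.shiftFunctorObjXIso (-1) j (j - 1) rfl).hom

end Maps

section Stabilization

variable (k : Type) [CommRing k] {m : ℕ}

/-- `F(ν) ⊗_R F(σ^{±1})`, where `ν` is the word `w` regarded on one more strand and `σ` is the last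
generator on that many strands (`true` for `σ`, `false` for `σ⁻¹`). -/
def stabComplex (w : BraidWord m) (ε : Bool) : CochainComplex (Bimod (Poly k (m + 1 + 1))) ℤ :=
  tensorComplex (wordComplex k w.extend) (letterComplex k (Fin.last m, ε))

/-- Its internal grading. -/
def stabDegrees (w : BraidWord m) (ε : Bool) : Degrees (stabComplex k w ε) :=
  tensorDegrees (wordDegrees k w.extend) (letterDegrees k (Fin.last m, ε))

/-- Its reduced powers. -/
def stabPowers (p : ℕ) (w : BraidWord m) (ε : Bool) : PowerFamily p (stabComplex k w ε) :=
  tensorPowers (wordPowers k p w.extend) (letterPowers k p (Fin.last m, ε))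

end Stabilization

end SoergelBraid

end

/-!
Write `R = k[x_1, …, x_n]` and `R[t]` for the polynomial ring in one more variable, `x` for `x_n` and
`B` for the bimodule `B_n` of the new generator, which exchanges `x` and `t`.

**The word on one more strand.** The complex of a word `w` over `R[t]` is `C[t]`, where `C` is its
complex over `R` and `t` is central. The bimodule `M[t]` is characterised by a universal property
(`IsPolyExt`), which is inherited by tensor products and direct sums, so only the unit bimodule and
the `B_i` have to be examined. For the latter, `B_i` is free as a left module on `1` and
`1 ⊗ x_i - x_i ⊗ 1`, with divided differences as coordinates (`sb_eq_coords`). The identification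
respects internal degrees and reduced powers (`IsPolyExtComplex`, `exists_isPolyExtComplex_word`).

**Two short exact sequences.** Let `E = M[t]` and `A = E ⊗ B`. There are bimodule maps
`br : A → E` and `rb : E → A` with `br ∘ rb` the multiplication by `x - t`, with `x` acting on the
right. Since evaluation of `t` at the right action of `x` identifies `E / (x - t)E` with `M`
(`IsPolyExt.eval`), the sequences
`0 → HH_h(A) → HH_h(E) → HH_{h-1}(M) → 0` and `0 → HH_h(E) → HH_h(A) → HH_h(M) → 0`
can be expected, and they are exact. The reason is that over the larger ring the Koszul complex of
`E` is two copies of its Koszul complex over `R`, because `t` is central, while that of `A` is the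
cone of `W = t ⊗ 1 - 1 ⊗ t`, whose kernel is the image of `rb` and whose image is the kernel of `br`.
Exactness is then a chase of elements (`IsStabilization`; from `IsPolyExt.negHom_rb` to
`IsPolyExt.rb_injective`). The map to `HH_h(M)` forgets the last exterior generator `λ_{n+1}` and
evaluates. The map to `HH_{h-1}(M)` is not only the evaluated coefficient of `λ_{n+1}`: for it to
vanish on the image of `HH_h(A)`, the contraction by `λ_n` of the other part has to be subtracted
(`posChain`).

**The quasi-isomorphisms.** In degree `j` the complex `C[t] ⊗ F(σ^{±1})` is the direct sum of `E^j`
and `A^{j+1}`, respectively `A^{j-1}`, and its differential is that of the cone of `br`, respectively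
of `rb`. By the exact sequences, the projection to the quotient `HH(C)` is a quasi-isomorphism
(`IsPolyExtComplex.quasiIso_posMap`, `IsPolyExtComplex.quasiIso_negMap`).

**Degrees and reduced powers.** Losing an exterior generator lowers the internal degree by `2`, and
dropping the Thom class raises it by `2`. Evaluation commutes with the reduced powers, and the twist
by the Thom class is invisible modulo `x - t` (`exists_ofUB_br_twist`). The chain map `posChain`
commutes with the reduced powers only up to multiples of powers of `x ⊗ 1 - 1 ⊗ x`, which act by zero
on Hochschild homology (`IsReduction.posHom_HHPow`).
-/

noncomputable section

namespace SoergelBraid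

/-! ### Homology of complexes of abelian groups in terms of elements -/

section Elements

variable {ι : Type} {c : ComplexShape ι} (K L : HomologicalComplex Ab c)

theorem exists_cycle {i j : ι} (hij : c.next i = j) (x : K.X i) (hx : K.d i j x = 0) :
    ∃ z : K.cycles i, K.iCycles i z = x := by
  subst hij
  exact ⟨(K.sc i).abCyclesIso.inv ⟨x, hx⟩, (K.sc i).abCyclesIso_inv_apply_iCycles ⟨x, hx⟩⟩

theorem iCycles_injective (i : ι) : Function.Injective (K.iCycles i) :=
  (AddCommGrpCat.mono_iff_injective _).1 inferInstance

theorem homologyπ_surjective (i : ι) : Function.Surjective (K.homologyπ i) :=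
  (AddCommGrpCat.epi_iff_surjective _).1 inferInstance

theorem homologyπ_eq_zero_iff {i j : ι} (hij : c.prev j = i) (z : K.cycles j) :
    K.homologyπ j z = 0 ↔ ∃ y : K.X i, K.d i j y = K.iCycles j z := by
  have hex := ShortComplex.exact_of_g_is_cokernel (ShortComplex.mk _ _ (K.toCycles_comp_homologyπ i j))
    (K.homologyIsCokernel i j hij)
  constructor
  · intro h
    obtain ⟨y, hy⟩ := (ShortComplex.ab_exact_iff _).1 hex z h
    refine ⟨y, ?_⟩
    rw [← hy, ← K.toCycles_i i j]; rfl
  · rintro ⟨y, hy⟩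
    have : K.toCycles i j y = z := by
      apply iCycles_injective
      rw [← hy, ← K.toCycles_i i j]; rfl
    rw [← this, ← ConcreteCategory.comp_apply, K.toCycles_comp_homologyπ]; rfl

/-- A termwise surjective morphism of complexes of abelian groups is a quasi-isomorphism if every
cycle in its kernel is the boundary of an element of its kernel. -/
theorem quasiIso_of_surjective_of_acyclic {K L : CochainComplex Ab ℤ} (f : K ⟶ L)
    (hs : ∀ j, Function.Surjective (f.f j))
    (hk : ∀ (j : ℤ) (x : K.X (j + 1)), K.d (j + 1) (j + 1 + 1) x = 0 → f.f (j + 1) x = 0 →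
      ∃ y : K.X j, K.d j (j + 1) y = x ∧ f.f j y = 0) : QuasiIso f := by
  have hcomm : ∀ (i j : ℤ) (x : K.X i), f.f j (K.d i j x) = L.d i j (f.f i x) := fun i j x => by
    have := ConcreteCategory.congr_hom (f.comm i j) x
    exact this.symm
  rw [quasiIso_iff]
  intro j'
  obtain ⟨j, rfl⟩ : ∃ j, j' = j + 1 := ⟨j' - 1, by ring⟩
  rw [quasiIsoAt_iff_isIso_homologyMap, ConcreteCategory.isIso_iff_bijective]
  have hπ : ∀ z, HomologicalComplex.homologyMap f (j + 1) (K.homologyπ (j + 1) z) =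
      L.homologyπ (j + 1) (HomologicalComplex.cyclesMap f (j + 1) z) := fun z =>
    ConcreteCategory.congr_hom (HomologicalComplex.homologyπ_naturality f (j + 1)) z
  have hi : ∀ z, L.iCycles (j + 1) (HomologicalComplex.cyclesMap f (j + 1) z) =
      f.f (j + 1) (K.iCycles (j + 1) z) := fun z =>
    ConcreteCategory.congr_hom (HomologicalComplex.cyclesMap_i f (j + 1)) z
  have hprev : (ComplexShape.up ℤ).prev (j + 1) = j := by simp
  have hnext : (ComplexShape.up ℤ).next (j + 1) = j + 1 + 1 := by simp
  have hd : ∀ z, K.d (j + 1) (j + 1 + 1) (K.iCycles (j + 1) z) = 0 := fun z =>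
    ConcreteCategory.congr_hom (K.iCycles_d (j + 1) (j + 1 + 1)) z
  have hdL : ∀ z, L.d (j + 1) (j + 1 + 1) (L.iCycles (j + 1) z) = 0 := fun z =>
    ConcreteCategory.congr_hom (L.iCycles_d (j + 1) (j + 1 + 1)) z
  have hdd : ∀ y, K.d (j + 1) (j + 1 + 1) (K.d j (j + 1) y) = 0 := fun y =>
    ConcreteCategory.congr_hom (K.d_comp_d j (j + 1) (j + 1 + 1)) y
  have hdd' : ∀ y, K.d (j + 1 + 1) (j + 1 + 1 + 1) (K.d (j + 1) (j + 1 + 1) y) = 0 := fun y =>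
    ConcreteCategory.congr_hom (K.d_comp_d (j + 1) (j + 1 + 1) (j + 1 + 1 + 1)) y
  constructor
  · rw [injective_iff_map_eq_zero]
    intro x hx
    obtain ⟨z, rfl⟩ := homologyπ_surjective K _ x
    rw [hπ, homologyπ_eq_zero_iff L hprev] at hx
    obtain ⟨y, hy⟩ := hx
    obtain ⟨y', rfl⟩ := hs j y
    rw [hi, ← hcomm] at hy
    obtain ⟨u, hu, -⟩ := hk j (K.iCycles (j + 1) z - K.d j (j + 1) y')
      (by rw [map_sub, hd, hdd, sub_zero]) (by rw [map_sub, hy, sub_self])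
    rw [homologyπ_eq_zero_iff K hprev]
    exact ⟨u + y', by rw [map_add, hu, sub_add_cancel]⟩
  · intro x
    obtain ⟨z, rfl⟩ := homologyπ_surjective L _ x
    obtain ⟨y, hy⟩ := hs (j + 1) (L.iCycles (j + 1) z)
    obtain ⟨u, hu, hu'⟩ := hk (j + 1) (K.d (j + 1) (j + 1 + 1) y) (hdd' y)
      (by rw [hcomm, hy, hdL])
    obtain ⟨v, hv⟩ := exists_cycle K hnext (y - u) (by rw [map_sub, hu, sub_self])
    refine ⟨K.homologyπ (j + 1) v, ?_⟩
    rw [hπ]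
    congr 1
    apply iCycles_injective
    rw [hi, hv, map_sub, hy, hu', sub_zero]

end Elements

/-! ### Hochschild classes of Koszul cycles -/

section Classes

variable {k : Type} [CommRing k] {n : ℕ}

section

variable (M : Bimod (Poly k n)) (h : ℤ)

/-- Koszul cycles of Hochschild degree `h`. -/
def kosCycles : AddSubgroup (Kos n M h) := (kosD k n M h (h - 1)).toAddMonoidHom.ker

/-- The class of a Koszul cycle in Hochschild homology. -/
def HHmk : kosCycles M h →+ (HH k n h).obj M :=
  ((kosComplex k n M).homologyπ h).hom.comp
    (((kosComplex k n M).sc h).abCyclesIso.inv.hom.comp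
      (AddMonoidHom.mk' (fun x : kosCycles M h => (⟨x.1, by
        have e : (ComplexShape.down ℤ).next h = h - 1 := by simp
        change (kosComplex k n M).d h ((ComplexShape.down ℤ).next h) x.1 = 0
        rw [e]; exact x.2⟩ : AddMonoidHom.ker ((kosComplex k n M).sc h).g.hom))
        (fun _ _ => rfl)))

variable {M h}

/-- The class of a Koszul cycle, as a function of the chain and of the proof that it is a cycle. -/
def HHcls (f : Kos n M h) (hf : kosD k n M h (h - 1) f = 0) : (HH k n h).obj M :=
  HHmk M h ⟨f, hf⟩

theorem exists_cycles_HHcls (f : Kos n M h) (hf : kosD k n M h (h - 1) f = 0) :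
    ∃ z : (kosComplex k n M).cycles h, (kosComplex k n M).iCycles h z = f ∧
      HHcls f hf = (kosComplex k n M).homologyπ h z :=
  ⟨_, ((kosComplex k n M).sc h).abCyclesIso_inv_apply_iCycles _, rfl⟩

theorem homologyπ_eq_HHcls (z : (kosComplex k n M).cycles h) :
    ∃ hf, (kosComplex k n M).homologyπ h z = HHcls ((kosComplex k n M).iCycles h z) hf := by
  have hf : kosD k n M h (h - 1) ((kosComplex k n M).iCycles h z) = 0 :=
    ConcreteCategory.congr_hom ((kosComplex k n M).iCycles_d h (h - 1)) z
  obtain ⟨z', h1, h2⟩ := exists_cycles_HHcls _ hf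
  exact ⟨hf, by rw [h2, iCycles_injective _ _ h1]⟩

theorem HHcls_surjective (x : (HH k n h).obj M) : ∃ f hf, x = HHcls (k := k) (M := M) f hf := by
  obtain ⟨z, rfl⟩ := homologyπ_surjective (kosComplex k n M) h x
  obtain ⟨hf, e⟩ := homologyπ_eq_HHcls z
  exact ⟨_, hf, e⟩

theorem HHcls_eq_zero_iff (f : Kos n M h) (hf : kosD k n M h (h - 1) f = 0) :
    HHcls f hf = 0 ↔ ∃ g : Kos n M (h + 1), kosD k n M (h + 1) h g = f := by
  obtain ⟨z, h1, h2⟩ := exists_cycles_HHcls f hf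
  rw [h2, ← h1]
  exact homologyπ_eq_zero_iff _ (by simp) z

theorem HHcls_sub (f g : Kos n M h) (hf hg) :
    HHcls f hf - HHcls g hg = HHcls (k := k) (M := M) (f - g) (by rw [map_sub, hf, hg, sub_zero]) :=
  (map_sub (HHmk M h) ⟨f, hf⟩ ⟨g, hg⟩).symm

theorem HHcls_eq_iff (f g : Kos n M h) (hf hg) : HHcls f hf = HHcls (k := k) (M := M) g hg ↔
    ∃ y : Kos n M (h + 1), kosD k n M (h + 1) h y = f - g := by
  rw [← sub_eq_zero, HHcls_sub, HHcls_eq_zero_iff]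

theorem homologyMap_HHcls {N : Bimod (Poly k n)} (φ : kosComplex k n M ⟶ kosComplex k n N)
    (f : Kos n M h) (hf) (hf' : kosD k n N h (h - 1) (φ.f h f) = 0) :
    HomologicalComplex.homologyMap φ h (HHcls f hf) = HHcls (k := k) (M := N) (φ.f h f) hf' := by
  obtain ⟨z, h1, h2⟩ := exists_cycles_HHcls f hf
  obtain ⟨z', h1', h2'⟩ := exists_cycles_HHcls (φ.f h f) hf'
  rw [h2, h2']
  refine (ConcreteCategory.congr_hom (HomologicalComplex.homologyπ_naturality φ h) z).trans ?_
  change (kosComplex k n N).homologyπ h (HomologicalComplex.cyclesMap φ h z) = _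
  congr 1
  apply iCycles_injective
  rw [h1', ← h1]
  exact ConcreteCategory.congr_hom (HomologicalComplex.cyclesMap_i φ h) z

theorem kosD_map_eq_zero {N : Bimod (Poly k n)} (φ : M ⟶ N) {h h' : ℤ} {f : Kos n M h}
    (hf : kosD k n M h h' f = 0) : kosD k n N h h' (fun S => φ.hom (f S)) = 0 :=
  funext fun T => by rw [kosD_natural, hf]; exact map_zero φ.hom

theorem HH_map_HHcls {N : Bimod (Poly k n)} (φ : M ⟶ N) (f : Kos n M h) (hf) :
    (HH k n h).map φ (HHcls f hf) =
      HHcls (k := k) (M := N) (fun S => φ.hom (f S)) (kosD_map_eq_zero φ hf) :=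
  homologyMap_HHcls ((kosFunctor k n).map φ) f hf _

theorem kosD_kosPow_eq_zero {p : ℕ} [CharP k p] [hp : Fact p.Prime] (o : PowerOps k n p M) (c : ℕ)
    {h h' : ℤ} {f : Kos n M h} (hf : kosD k n M h h' f = 0) :
    kosD k n M h h' (kosPow o c h f) = 0 := by
  rw [kosPow_comm hp.out, hf, map_zero]

theorem HHPow_HHcls {p : ℕ} [CharP k p] [hp : Fact p.Prime] (o : PowerOps k n p M) (c : ℕ)
    (f : Kos n M h) (hf) :
    HHPow o c h (HHcls f hf) = HHcls (k := k) (M := M) (kosPow o c h f)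
      (kosD_kosPow_eq_zero o c hf) :=
  homologyMap_HHcls (kosPowMap o c) f hf _

theorem mem_HHDeg_iff (g : ℤ → AddSubgroup M) (d : ℤ) (x : (HH k n h).obj M) :
    x ∈ HHDeg g h d ↔ ∃ f hf, f ∈ kosDeg g h d ∧ x = HHcls (k := k) (M := M) f hf := by
  constructor
  · rintro ⟨z, hz, rfl⟩
    obtain ⟨hf, e⟩ := homologyπ_eq_HHcls z
    exact ⟨_, hf, hz, e⟩
  · rintro ⟨f, hf, hd, rfl⟩
    obtain ⟨z, h1, h2⟩ := exists_cycles_HHcls f hf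
    refine ⟨z, ?_, h2.symm⟩
    change (kosComplex k n M).iCycles h z ∈ kosDeg g h d
    rw [h1]; exact hd

end

/-- A map of Koszul chains that preserves cycles and boundaries, possibly changing the ring and the
Hochschild degree, induces a map on Hochschild homology. -/
theorem exists_HH_hom {n' : ℕ} {M : Bimod (Poly k n)} {N : Bimod (Poly k n')} {h h' : ℤ}
    (u : Kos n M h →+ Kos n' N h')
    (hz : ∀ f, kosD k n M h (h - 1) f = 0 → kosD k n' N h' (h' - 1) (u f) = 0)
    (hb : ∀ g : Kos n M (h + 1), ∃ g', kosD k n' N (h' + 1) h' g' = u (kosD k n M (h + 1) h g)) :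
    ∃ φ : (HH k n h).obj M ⟶ (HH k n' h').obj N,
      ∀ f hf, φ (HHcls f hf) = HHcls (u f) (hz f hf) := by
  let v : kosCycles M h →+ (HH k n' h').obj N :=
    (HHmk N h').comp (AddMonoidHom.mk' (fun x => ⟨u x.1, hz x.1 x.2⟩)
      (fun x y => Subtype.ext (map_add u x.1 y.1)))
  have hs : Function.Surjective (HHmk M h) := fun x => by
    obtain ⟨f, hf, e⟩ := HHcls_surjective x
    exact ⟨⟨f, hf⟩, e.symm⟩
  have hv : (HHmk M h).ker ≤ v.ker := fun x hx => by
    obtain ⟨g, hg⟩ := (HHcls_eq_zero_iff x.1 x.2).1 hx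
    refine (HHcls_eq_zero_iff (u x.1) (hz x.1 x.2)).2 ?_
    rw [← hg]
    exact hb g
  exact ⟨AddCommGrpCat.ofHom ((HHmk M h).liftOfSurjective hs ⟨v, hv⟩), fun f hf =>
    (HHmk M h).liftOfRightInverse_comp_apply _ _ ⟨v, hv⟩ ⟨f, hf⟩⟩

end Classes

/-! ### Divided differences and the freeness of `B_i` -/

section DividedDifference

variable (k : Type) [CommRing k] {m : ℕ} (i : Fin m)

/-- The exchange of the variables `x_i` and `x_{i+1}`. -/
def swapVars : Poly k (m + 1) →ₐ[k] Poly k (m + 1) :=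
  MvPolynomial.rename (Equiv.swap i.castSucc i.succ)

/-- The root `x_i - x_{i+1}`. -/
def root : Poly k (m + 1) := MvPolynomial.X i.castSucc - MvPolynomial.X i.succ

theorem swapVars_castSucc :
    swapVars k i (MvPolynomial.X i.castSucc) = MvPolynomial.X i.succ := by simp [swapVars]

theorem swapVars_succ :
    swapVars k i (MvPolynomial.X i.succ) = MvPolynomial.X i.castSucc := by simp [swapVars]

variable {i} in
theorem swapVars_of_ne {a : Fin (m + 1)} (h : a ≠ i.castSucc) (h' : a ≠ i.succ) :
    swapVars k i (MvPolynomial.X a) = MvPolynomial.X a := by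
  simp [swapVars, Equiv.swap_apply_of_ne_of_ne h h']

theorem swapVars_swapVars (f : Poly k (m + 1)) : swapVars k i (swapVars k i f) = f := by
  have : ((Equiv.swap i.castSucc i.succ : Equiv.Perm (Fin (m + 1))) : Fin (m + 1) → Fin (m + 1)) ∘
      (Equiv.swap i.castSucc i.succ) = id := by
    funext a; simp
  rw [swapVars, MvPolynomial.rename_rename, this, MvPolynomial.rename_id_apply]

theorem root_dvd (f : Poly k (m + 1)) : root k i ∣ f - swapVars k i f := by
  induction f using MvPolynomial.induction_on with
  | C c => simp [swapVars]
  | add f g hf hg =>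
    rw [map_add, add_sub_add_comm]
    exact dvd_add hf hg
  | mul_X f a hf =>
    have h1 : root k i ∣ MvPolynomial.X a - swapVars k i (MvPolynomial.X a) := by
      by_cases ha : a = i.castSucc
      · rw [ha, swapVars_castSucc]; exact dvd_refl _
      by_cases hb : a = i.succ
      · rw [hb, swapVars_succ]; exact ⟨-1, by rw [root]; ring⟩
      · rw [swapVars_of_ne k ha hb, sub_self]; exact dvd_zero _
    have : f * MvPolynomial.X a - swapVars k i (f * MvPolynomial.X a) =
        (f - swapVars k i f) * MvPolynomial.X a +
        swapVars k i f * (MvPolynomial.X a - swapVars k i (MvPolynomial.X a)) := by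
      rw [map_mul]; ring
    rw [this]
    exact dvd_add (hf.mul_right _) (h1.mul_left _)

/-- The divided difference `(f - s_i f) / (x_i - x_{i+1})`, as a choice of a quotient. Over a domain the
quotient is unique (`eq_divDiff`). -/
def divDiff (f : Poly k (m + 1)) : Poly k (m + 1) := (root_dvd k i f).choose

theorem root_mul_divDiff (f : Poly k (m + 1)) :
    root k i * divDiff k i f = f - swapVars k i f := (root_dvd k i f).choose_spec.symm

/-- The multiplication map of `B_i` with values in the polynomial ring. -/
def sbMulPoly : SB k i →+* Poly k (m + 1) := sbMul k i

theorem sbMulPoly_mul (a b : Poly k (m + 1)) :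
    sbMulPoly k i (sbLeft k i a * sbRight k i b) = a * b := by
  rw [sb_tmul]; rfl

theorem sbMulPoly_left (a : Poly k (m + 1)) : sbMulPoly k i (sbLeft k i a) = a := by
  simpa using sbMulPoly_mul k i a 1

theorem sbMulPoly_right (a : Poly k (m + 1)) : sbMulPoly k i (sbRight k i a) = a := by
  simpa using sbMulPoly_mul k i 1 a

/-- The element `1 ⊗ x_i - x_i ⊗ 1` of `B_i`. -/
def sbW : SB k i :=
  sbRight k i (MvPolynomial.X i.castSucc) - sbLeft k i (MvPolynomial.X i.castSucc)

theorem sbLeft_add_eq : sbLeft k i (MvPolynomial.X i.castSucc) + sbLeft k i (MvPolynomial.X i.succ) =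
    sbRight k i (MvPolynomial.X i.castSucc) + sbRight k i (MvPolynomial.X i.succ) := by
  rw [← map_add, ← map_add]
  apply sbLeft_invariant
  simp [add_comm]

variable [IsDomain k]

theorem root_ne_zero : root k i ≠ 0 := by
  rw [root, sub_ne_zero]
  intro h
  have := MvPolynomial.X_injective h
  exact absurd (congrArg Fin.val this) (by simp)

variable {k i} in
theorem eq_divDiff {f g : Poly k (m + 1)} (h : root k i * g = f - swapVars k i f) :
    g = divDiff k i f :=
  mul_left_cancel₀ (root_ne_zero k i) (h.trans (root_mul_divDiff k i f).symm)

theorem divDiff_add (f g : Poly k (m + 1)) :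
    divDiff k i (f + g) = divDiff k i f + divDiff k i g :=
  (eq_divDiff (by rw [mul_add, root_mul_divDiff, root_mul_divDiff, map_add]; ring)).symm

theorem divDiff_mul (f g : Poly k (m + 1)) :
    divDiff k i (f * g) = f * divDiff k i g + divDiff k i f * swapVars k i g :=
  (eq_divDiff (by
    have h1 := root_mul_divDiff k i f
    have h2 := root_mul_divDiff k i g
    rw [map_mul]
    linear_combination f * h2 + swapVars k i g * h1)).symm

theorem divDiff_of_invariant {f : Poly k (m + 1)} (h : swapVars k i f = f) :
    divDiff k i f = 0 :=
  (eq_divDiff (by rw [h, sub_self, mul_zero])).symm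

theorem divDiff_castSucc : divDiff k i (MvPolynomial.X i.castSucc) = 1 :=
  (eq_divDiff (by rw [swapVars_castSucc, mul_one, root])).symm

theorem divDiff_succ : divDiff k i (MvPolynomial.X i.succ) = -1 :=
  (eq_divDiff (by rw [swapVars_succ, root]; ring)).symm

theorem swapVars_divDiff (f : Poly k (m + 1)) :
    swapVars k i (divDiff k i f) = divDiff k i f := by
  apply eq_divDiff
  have h := congrArg (swapVars k i) (root_mul_divDiff k i f)
  rw [map_mul, map_sub, swapVars_swapVars, root, map_sub, swapVars_castSucc, swapVars_succ] at h
  rw [root]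
  linear_combination -h

/-- The second coordinate of an element of `B_i` with respect to the basis `1`,
`1 ⊗ x_i - x_i ⊗ 1` of `B_i` as a left module; on pure tensors it is `a ⊗ b ↦ a ∂_i b`. The first
coordinate is the multiplication map. -/
def sbCoord : SB k i →+ Poly k (m + 1) :=
  TensorProduct.liftAddHom (R := invariants k i) (M := Poly k (m + 1)) (N := Poly k (m + 1))
    (AddMonoidHom.mk' (fun a => AddMonoidHom.mk' (fun b => a * divDiff k i b)
      (fun b b' => by rw [divDiff_add, mul_add])) (fun a a' => AddMonoidHom.ext fun b =>
        add_mul _ _ _))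
    (fun f a b => by
      change (f : Poly k (m + 1)) * a * divDiff k i b = a * divDiff k i ((f : Poly k (m + 1)) * b)
      have hf : swapVars k i (f : Poly k (m + 1)) = f := f.2
      rw [divDiff_mul, divDiff_of_invariant k i hf]
      ring)

theorem sbCoord_mul (a b : Poly k (m + 1)) :
    sbCoord k i (sbLeft k i a * sbRight k i b) = a * divDiff k i b := by
  rw [sb_tmul]; rfl

/-- The coordinates of `1 ⊗ b`. The left and right copies of `∂_i b` and of `b - x_i ∂_i b` agree, since
both polynomials are invariant. -/
theorem sbRight_eq (b : Poly k (m + 1)) :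
    sbRight k i b = sbLeft k i b + sbLeft k i (divDiff k i b) * sbW k i := by
  have h1 : sbLeft k i (divDiff k i b) = sbRight k i (divDiff k i b) :=
    sbLeft_invariant k i _ (swapVars_divDiff k i b)
  have h2 : sbLeft k i (b - MvPolynomial.X i.castSucc * divDiff k i b) =
      sbRight k i (b - MvPolynomial.X i.castSucc * divDiff k i b) := by
    apply sbLeft_invariant
    change swapVars k i _ = _
    have h := root_mul_divDiff k i b
    rw [map_sub, map_mul, swapVars_divDiff, swapVars_castSucc]
    rw [root] at h
    linear_combination h
  rw [map_sub, map_sub, map_mul, map_mul] at h2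
  rw [sbW]
  linear_combination -h2 - (sbRight k i (MvPolynomial.X i.castSucc)) * h1

/-- `B_i` is free as a left module, with basis `1`, `1 ⊗ x_i - x_i ⊗ 1`. -/
theorem sb_eq_coords (b : SB k i) :
    b = sbLeft k i (sbMulPoly k i b) + sbLeft k i (sbCoord k i b) * sbW k i := by
  induction b using SB.induction with
  | zero => simp
  | add x y hx hy =>
    rw [map_add (sbCoord k i), map_add, map_add, map_add]
    linear_combination hx + hy
  | tmul a b =>
    rw [sbCoord_mul, sbMulPoly_mul, sbRight_eq, map_mul, map_mul]
    ring

theorem sbCoord_left (r : Poly k (m + 1)) (b : SB k i) :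
    sbCoord k i (sbLeft k i r * b) = r * sbCoord k i b := by
  induction b using SB.induction with
  | zero => rw [mul_zero, map_zero, mul_zero]
  | add x y hx hy => rw [mul_add, map_add, map_add, mul_add, hx, hy]
  | tmul a b => rw [← mul_assoc, ← map_mul, sbCoord_mul, sbCoord_mul, mul_assoc]

theorem sbCoord_right (r : Poly k (m + 1)) (b : SB k i) :
    sbCoord k i (sbRight k i r * b) =
      swapVars k i r * sbCoord k i b + divDiff k i r * sbMulPoly k i b := by
  induction b using SB.induction with
  | zero => simp
  | add x y hx hy => rw [mul_add, map_add, map_add, map_add, hx, hy]; ring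
  | tmul a b =>
    rw [mul_left_comm, ← map_mul, sbCoord_mul, sbCoord_mul, sbMulPoly_mul, mul_comm r, divDiff_mul]
    ring

theorem sbCoord_one : sbCoord k i 1 = 0 := by
  have := sbCoord_mul k i 1 1
  rw [map_one, map_one, mul_one] at this
  rw [this, divDiff_of_invariant k i (map_one _), mul_zero]

end DividedDifference

/-! ### Adjoining a central variable to a bimodule -/

section PolyExt

variable {k : Type} [CommRing k] {n : ℕ}

/-- The inclusion of polynomial rings that adds a last variable. -/
abbrev inc : Poly k n →ₐ[k] Poly k (n + 1) := MvPolynomial.rename Fin.castSucc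

variable (k n) in
/-- The last variable. -/
abbrev lastX : Poly k (n + 1) := MvPolynomial.X (Fin.last n)

variable (k n) in
/-- The map `ι : M → E` exhibits the bimodule `E` as `M[t]`, where `t` is a central variable and
the last variable of the larger polynomial ring acts as `t`. The last two conditions say that `E`
is the universal abelian group with an endomorphism `t` under `M`. -/
structure IsPolyExt {M E : Type} [AddCommGroup M] [Module (Env (Poly k n)) M] [AddCommGroup E]
    [Module (Env (Poly k (n + 1))) E] (ι : M →+ E) : Prop where
  lef_smul : ∀ (r : Poly k n) (x : M),
    ι ((lef r : Env (Poly k n)) • x) = (lef (inc r) : Env (Poly k (n + 1))) • ι x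
  rig_smul : ∀ (r : Poly k n) (x : M),
    ι ((rig r : Env (Poly k n)) • x) = (rig (inc r) : Env (Poly k (n + 1))) • ι x
  central : ∀ e : E, (lef (lastX k n) : Env (Poly k (n + 1))) • e =
    (rig (lastX k n) : Env (Poly k (n + 1))) • e
  exists_lift : ∀ (P : Type) [AddCommGroup P] (φ : M →+ P) (T : P →+ P), ∃ g : E →+ P,
    (∀ x, g (ι x) = φ x) ∧ ∀ e, g ((lef (lastX k n) : Env (Poly k (n + 1))) • e) = T (g e)
  generate : ∀ S : AddSubgroup E, (∀ x, ι x ∈ S) →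
    (∀ e ∈ S, (lef (lastX k n) : Env (Poly k (n + 1))) • e ∈ S) → S = ⊤

variable (k n) in
/-- Homogeneous elements of `E = M[t]` are sums of `t^i x` with `x` homogeneous. -/
def IsGradedExt {M E : Type} [AddCommGroup M] [AddCommGroup E]
    [Module (Env (Poly k (n + 1))) E] (gM : ℤ → AddSubgroup M) (gE : ℤ → AddSubgroup E)
    (ι : M →+ E) : Prop :=
  ∀ d, gE d ≤ AddSubgroup.closure {e | ∃ (i : ℕ) (x : M), x ∈ gM (d - 2 * i) ∧
    e = (lef (lastX k n ^ i) : Env (Poly k (n + 1))) • ι x}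

/-- The map `ι` commutes with the reduced powers. -/
def IsPowerExt {M E : Type} [AddCommGroup M] [Module (Env (Poly k n)) M] [AddCommGroup E]
    [Module (Env (Poly k (n + 1))) E] {p : ℕ} (oM : PowerOps k n p M) (oE : PowerOps k (n + 1) p E)
    (ι : M →+ E) : Prop :=
  ∀ x c, oE.P (ι x) c = ι (oM.P x c)

variable (k n) in
/-- The right action of a polynomial of degree `e` raises degrees by `e`. -/
def IsRigStable {M : Type} [AddCommGroup M] [Module (Env (Poly k n)) M] (gM : ℤ → AddSubgroup M) :
    Prop :=
  ∀ (d e : ℤ), ∀ r ∈ polyDeg (k := k) (n := n) e, ∀ x ∈ gM d,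
    (rig r : Env (Poly k n)) • x ∈ gM (d + e)

theorem IsPolyExt.hom_ext {M E : Type} [AddCommGroup M] [Module (Env (Poly k n)) M]
    [AddCommGroup E] [Module (Env (Poly k (n + 1))) E] {ι : M →+ E} (H : IsPolyExt k n ι)
    {P : Type} [AddCommGroup P] (T : P → P) {g g' : E →+ P} (h : ∀ x, g (ι x) = g' (ι x))
    (hg : ∀ e, g ((lef (lastX k n) : Env (Poly k (n + 1))) • e) = T (g e))
    (hg' : ∀ e, g' ((lef (lastX k n) : Env (Poly k (n + 1))) • e) = T (g' e)) : g = g' := by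
  have := H.generate (AddMonoidHom.eqLocus g g') h (fun e he => by
    change g _ = g' _
    rw [hg, hg', show g e = g' e from he])
  exact AddMonoidHom.ext fun e => show e ∈ AddMonoidHom.eqLocus g g' from this ▸ AddSubgroup.mem_top e

/-! ### The extension of the unit bimodule -/

/-- Polynomials in `n + 1` variables as polynomials in the last variable. -/
def toPolynomial : Poly k (n + 1) →ₐ[k] Polynomial (Poly k n) :=
  MvPolynomial.aeval (Fin.lastCases Polynomial.X fun a => Polynomial.C (MvPolynomial.X a))

theorem toPolynomial_inc (f : Poly k n) : toPolynomial (inc f) = Polynomial.C f := by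
  have : (toPolynomial (k := k)).comp (inc (n := n)) = Polynomial.CAlgHom := by
    ext a
    simp [toPolynomial]
  exact DFunLike.congr_fun this f

theorem toPolynomial_lastX : toPolynomial (lastX k n) = Polynomial.X := by
  simp [toPolynomial]

theorem exists_polynomial_lift {A P : Type} [CommRing A] [AddCommGroup P] (φ : A →+ P)
    (T : P →+ P) : ∃ g : Polynomial A →+ P, (∀ a, g (Polynomial.C a) = φ a) ∧
      ∀ f, g (Polynomial.X * f) = T (g f) := by
  let T' : AddMonoid.End P := T
  let g : Polynomial A →+ P := AddMonoidHom.mk' (fun f => f.sum fun i a => (T' ^ i) (φ a))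
    (fun f f' => Polynomial.sum_add_index f f' _ (fun i => by rw [map_zero, map_zero])
      (fun i a b => by rw [map_add, map_add]))
  have hg : ∀ i a, g (Polynomial.monomial i a) = (T' ^ i) (φ a) := fun i a =>
    Polynomial.sum_monomial_index a (fun i a => (T' ^ i) (φ a)) (by rw [map_zero, map_zero])
  refine ⟨g, fun a => ?_, fun f => ?_⟩
  · rw [← Polynomial.monomial_zero_left, hg]; rfl
  · induction f using Polynomial.induction_on' with
    | add f f' h h' => rw [mul_add, map_add, map_add, map_add, h, h']
    | monomial i a => rw [Polynomial.X_mul_monomial, hg, hg, pow_succ']; rfl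

/-- The inclusion of polynomial rings, as a map of unit bimodules. -/
def ubInc : UB k n →+ UB k (n + 1) := (inc : Poly k n →ₐ[k] Poly k (n + 1)).toRingHom.toAddMonoidHom

theorem poly_generate (S : AddSubgroup (Poly k (n + 1))) (h : ∀ f, inc f ∈ S)
    (h' : ∀ f ∈ S, lastX k n * f ∈ S) (f : Poly k (n + 1)) : f ∈ S := by
  have : ∀ g : Poly k n, inc g * f ∈ S := by
    induction f using MvPolynomial.induction_on with
    | C c =>
      intro g
      have : inc g * MvPolynomial.C c = inc (g * MvPolynomial.C c) := by
        rw [map_mul, MvPolynomial.rename_C]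
      rw [this]; exact h _
    | add f f' hf hf' => intro g; rw [mul_add]; exact S.add_mem (hf g) (hf' g)
    | mul_X f a hf =>
      intro g
      induction a using Fin.lastCases with
      | last =>
        have := h' _ (hf g)
        rwa [mul_left_comm, mul_comm (lastX k n)] at this
      | cast a =>
        have := hf (g * MvPolynomial.X a)
        rwa [map_mul, MvPolynomial.rename_X, mul_assoc, mul_comm _ f] at this
  simpa using this 1

theorem isPolyExt_ubInc : IsPolyExt k n (ubInc : UB k n →+ UB k (n + 1)) where
  lef_smul r x := by
    have := map_mul (inc : Poly k n →ₐ[k] Poly k (n + 1)) r x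
    exact (congrArg ubInc (ub_lef_smul r x)).trans
      ((congrArg toUB this).trans (ub_lef_smul (inc r) (inc (x : Poly k n))).symm)
  rig_smul r x := by
    have := map_mul (inc : Poly k n →ₐ[k] Poly k (n + 1)) r x
    exact (congrArg ubInc (ub_rig_smul r x)).trans
      ((congrArg toUB this).trans (ub_rig_smul (inc r) (inc (x : Poly k n))).symm)
  central e := (ub_lef_smul _ e).trans (ub_rig_smul _ e).symm
  exists_lift P _ φ T := by
    obtain ⟨g, h1, h2⟩ := exists_polynomial_lift (A := Poly k n) φ T
    refine ⟨g.comp (toPolynomial (k := k) (n := n)).toRingHom.toAddMonoidHom, fun x => ?_,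
      fun e => ?_⟩
    · exact (congrArg g (toPolynomial_inc (x : Poly k n))).trans (h1 x)
    · refine Eq.trans ?_ (h2 (toPolynomial (e : Poly k (n + 1))))
      refine congrArg g ((congrArg toPolynomial (ub_lef_smul (lastX k n) e)).trans ?_)
      refine (map_mul toPolynomial (lastX k n) (e : Poly k (n + 1))).trans ?_
      rw [toPolynomial_lastX]
  generate S h h' := by
    refine (AddSubgroup.eq_top_iff' S).2 fun x => ?_
    exact poly_generate (S : AddSubgroup (Poly k (n + 1))) h
      (fun f hf => by
        have h2 : (lef (lastX k n) : Env (Poly k (n + 1))) • toUB f ∈ S := h' f hf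
        rwa [ub_lef_smul] at h2) x

theorem powT_inc (p : ℕ) (f : Poly k n) :
    powT p (inc f) = PowerSeries.map (inc : Poly k n →ₐ[k] Poly k (n + 1)).toRingHom (powT p f) := by
  induction f using MvPolynomial.induction_on with
  | C c =>
    have h1 : ∀ n, (powT p (MvPolynomial.C c : Poly k n)) = PowerSeries.C (MvPolynomial.C c) := by
      intro n
      rw [powT, MvPolynomial.aeval_C, PowerSeries.algebraMap_apply]; rfl
    rw [MvPolynomial.rename_C, h1, h1, PowerSeries.map_C]
    congr 1
    exact (MvPolynomial.rename_C Fin.castSucc c).symm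
  | add f g hf hg => rw [map_add, map_add, map_add, map_add, hf, hg]
  | mul_X f a hf =>
    rw [map_mul, map_mul, map_mul, map_mul, hf, MvPolynomial.rename_X, powT_X, powT_X, map_add,
      map_mul, PowerSeries.map_C, PowerSeries.map_C, PowerSeries.map_X]
    simp

theorem coeff_powT_inc (p : ℕ) (f : Poly k n) (c : ℕ) :
    PowerSeries.coeff c (powT p (inc f)) = inc (PowerSeries.coeff c (powT p f)) := by
  rw [powT_inc, PowerSeries.coeff_map]; rfl

theorem isPowerExt_ubInc (p : ℕ) :
    IsPowerExt (unitOps p : PowerOps k n p (UB k n)) (unitOps p) ubInc :=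
  fun x c => congrArg toUB (coeff_powT_inc p x c)

/-- The products `t^i x` with `x` homogeneous in fewer variables span the homogeneous polynomials. -/
theorem polyDeg_le (d : ℤ) : polyDeg (k := k) (n := n + 1) d ≤
    AddSubgroup.closure {f | ∃ (i : ℕ) (g : Poly k n), g ∈ polyDeg (k := k) (d - 2 * i) ∧
      f = lastX k n ^ i * inc g} := by
  refine iSup₂_le fun e he f hf => ?_
  have hf : f.IsHomogeneous e := hf
  rw [f.as_sum]
  refine AddSubgroup.sum_mem _ fun s hs => AddSubgroup.subset_closure ?_
  have hse : s.degree = e := by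
    have := hf (MvPolynomial.mem_support_iff.1 hs)
    rwa [Finsupp.degree_eq_weight_one]
  have hs' : s = Finsupp.mapDomain Fin.castSucc (s.comapDomain Fin.castSucc
      (Fin.castSucc_injective n).injOn) + Finsupp.single (Fin.last n) (s (Fin.last n)) := by
    ext a
    induction a using Fin.lastCases with
    | last =>
      rw [Finsupp.add_apply, Finsupp.mapDomain_of_notMem_range, zero_add, Finsupp.single_eq_same]
      rintro ⟨b, hb⟩
      exact absurd hb (Fin.castSucc_lt_last b).ne
    | cast a =>
      rw [Finsupp.add_apply, Finsupp.mapDomain_apply (Fin.castSucc_injective n),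
        Finsupp.comapDomain_apply, Finsupp.single_eq_of_ne (Fin.castSucc_lt_last a).ne, add_zero]
  set s' := s.comapDomain Fin.castSucc (Fin.castSucc_injective n).injOn
  have hdeg : s'.degree + s (Fin.last n) = e := by
    have := congrArg Finsupp.degree hs'
    rw [map_add, Finsupp.degree_mapDomain, Finsupp.degree_single] at this
    rw [← this, hse]
  refine ⟨s (Fin.last n), MvPolynomial.monomial s' (f.coeff s), ?_, ?_⟩
  · refine AddSubgroup.mem_iSup_of_mem s'.degree (AddSubgroup.mem_iSup_of_mem ?_ ?_)
    · rw [← he, ← hdeg]; push_cast; ring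
    · exact MvPolynomial.isHomogeneous_monomial _ rfl
  · rw [MvPolynomial.rename_monomial, MvPolynomial.X_pow_eq_monomial, MvPolynomial.monomial_mul,
      one_mul]
    congr 2
    exact hs'.trans (add_comm _ _)

theorem isGradedExt_ubInc :
    IsGradedExt k n (fun d => ubDeg (k := k) (n := n) d) (fun d => ubDeg (k := k) d) ubInc := by
  intro d f hf
  refine (AddSubgroup.closure_mono ?_ : _ ≤ _) (polyDeg_le d hf)
  rintro _ ⟨i, g, hg, rfl⟩
  exact ⟨i, g, hg, (ub_lef_smul _ (inc g)).symm⟩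

theorem mul_mem_polyDeg {d e : ℤ} {f g : Poly k n} (hf : f ∈ polyDeg (k := k) d)
    (hg : g ∈ polyDeg (k := k) e) : f * g ∈ polyDeg (k := k) (d + e) := by
  have h1 : polyDeg (k := k) d ≤ AddSubgroup.comap (AddMonoidHom.mulRight g)
      (polyDeg (k := k) (n := n) (d + e)) := by
    refine iSup₂_le fun i hi f hf => ?_
    have h2 : polyDeg (k := k) e ≤ AddSubgroup.comap (AddMonoidHom.mulLeft f)
        (polyDeg (k := k) (n := n) (d + e)) := by
      refine iSup₂_le fun j hj g hg => ?_
      refine AddSubgroup.mem_iSup_of_mem (i + j) (AddSubgroup.mem_iSup_of_mem ?_ ?_)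
      · rw [← hi, ← hj]; push_cast; ring
      · exact MvPolynomial.IsHomogeneous.mul hf hg
    exact h2 hg
  exact h1 hf

theorem isRigStable_ubDeg : IsRigStable k n (fun d => ubDeg (k := k) (n := n) d) :=
  fun d e r hr x hx => by
    have := mul_mem_polyDeg hr (show (x : Poly k n) ∈ polyDeg (k := k) d from hx)
    rw [add_comm] at this
    exact (ub_rig_smul r x).symm ▸ this

/-! ### The extension of `B_i` -/

section SB

variable {m : ℕ} (i : Fin m)

theorem swapVars_inc (f : Poly k (m + 1)) :
    swapVars k i.castSucc (inc f) = inc (swapVars k i f) := by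
  rw [swapVars, swapVars, MvPolynomial.rename_rename, MvPolynomial.rename_rename]
  congr 2
  funext a
  change Equiv.swap i.castSucc.castSucc i.castSucc.succ a.castSucc =
    (Equiv.swap i.castSucc i.succ a).castSucc
  rw [Fin.succ_castSucc, (Fin.castSucc_injective (m + 1)).swap_apply]

theorem sbLeft_inc_eq (f : invariants k i) :
    sbLeft k i.castSucc (inc (f : Poly k (m + 1))) = sbRight k i.castSucc (inc f) := by
  apply sbLeft_invariant
  have hf : swapVars k i (f : Poly k (m + 1)) = f := f.2
  exact (swapVars_inc i f.1).trans (congrArg inc hf)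

/-- The inclusion `a ⊗ b ↦ a ⊗ b` of `B_i` into its analogue with one more variable. -/
def sbInc : SB k i →+ SB k i.castSucc :=
  TensorProduct.liftAddHom (R := invariants k i) (M := Poly k (m + 1)) (N := Poly k (m + 1))
    ((AddMonoidHom.compHom' ((sbRight k i.castSucc).comp
        (inc : Poly k (m + 1) →ₐ[k] _).toRingHom).toAddMonoidHom).comp
      (AddMonoidHom.mul.comp ((sbLeft k i.castSucc).comp
        (inc : Poly k (m + 1) →ₐ[k] _).toRingHom).toAddMonoidHom))
    (fun f a b => by
      change sbLeft k i.castSucc (inc ((f : Poly k (m + 1)) * a)) * sbRight k i.castSucc (inc b) =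
        sbLeft k i.castSucc (inc a) * sbRight k i.castSucc (inc ((f : Poly k (m + 1)) * b))
      rw [map_mul, map_mul, map_mul, map_mul, sbLeft_inc_eq]
      ring)

theorem sbInc_mul (a b : Poly k (m + 1)) : sbInc i (sbLeft k i a * sbRight k i b) =
    sbLeft k i.castSucc (inc a) * sbRight k i.castSucc (inc b) := by
  rw [sb_tmul]; rfl

theorem sbInc_left (r : Poly k (m + 1)) (b : SB k i) :
    sbInc i (sbLeft k i r * b) = sbLeft k i.castSucc (inc r) * sbInc i b := by
  induction b using SB.induction with
  | zero => rw [mul_zero, map_zero, mul_zero]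
  | add x y hx hy => rw [mul_add, map_add, map_add, mul_add, hx, hy]
  | tmul a b => rw [← mul_assoc, ← map_mul, sbInc_mul, sbInc_mul, map_mul, map_mul, mul_assoc]

theorem sbInc_right (r : Poly k (m + 1)) (b : SB k i) :
    sbInc i (sbRight k i r * b) = sbRight k i.castSucc (inc r) * sbInc i b := by
  induction b using SB.induction with
  | zero => rw [mul_zero, map_zero, mul_zero]
  | add x y hx hy => rw [mul_add, map_add, map_add, mul_add, hx, hy]
  | tmul a b =>
    rw [mul_left_comm, ← map_mul, sbInc_mul, sbInc_mul, map_mul, map_mul, mul_left_comm]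

theorem sbLeft_lastX : sbLeft k i.castSucc (lastX k (m + 1)) =
    sbRight k i.castSucc (lastX k (m + 1)) := by
  apply sbLeft_invariant
  have h1 : Fin.last (m + 1) ≠ i.castSucc.castSucc := (Fin.castSucc_lt_last _).ne'
  have h2 : Fin.last (m + 1) ≠ i.castSucc.succ := by
    rw [Fin.succ_castSucc]; exact (Fin.castSucc_lt_last _).ne'
  exact swapVars_of_ne k h1 h2

theorem divDiff_inc [IsDomain k] (f : Poly k (m + 1)) :
    divDiff k i.castSucc (inc f) = inc (divDiff k i f) := by
  refine (eq_divDiff ?_).symm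
  have h := congrArg inc (root_mul_divDiff k i f)
  rw [map_mul, map_sub, ← swapVars_inc, root, map_sub, MvPolynomial.rename_X,
    MvPolynomial.rename_X] at h
  rw [root, Fin.succ_castSucc, h]

theorem sbMulPoly_sbInc (b : SB k i) :
    sbMulPoly k i.castSucc (sbInc i b) = inc (sbMulPoly k i b) := by
  induction b using SB.induction with
  | zero => simp
  | add x y hx hy => simp only [map_add, hx, hy]
  | tmul a b => rw [sbInc_mul, sbMulPoly_mul, sbMulPoly_mul, map_mul]

theorem sbCoord_sbInc [IsDomain k] (b : SB k i) :
    sbCoord k i.castSucc (sbInc i b) = inc (sbCoord k i b) := by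
  induction b using SB.induction with
  | zero => simp
  | add x y hx hy => simp only [map_add, hx, hy]
  | tmul a b => rw [sbInc_mul, sbCoord_mul, sbCoord_mul, map_mul, divDiff_inc]

theorem isPolyExt_sbInc [IsDomain k] : IsPolyExt k (m + 1) (sbInc (k := k) i) where
  lef_smul r x := by rw [sb_smul, sb_smul, sbOfEnv_lef, sbOfEnv_lef, sbInc_left]
  rig_smul r x := by rw [sb_smul, sb_smul, sbOfEnv_rig, sbOfEnv_rig, sbInc_right]
  central e := by rw [sb_smul, sb_smul, sbOfEnv_lef, sbOfEnv_rig, sbLeft_lastX]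
  exists_lift P _ φ T := by
    obtain ⟨g, h1, h2⟩ := exists_polynomial_lift (A := Poly k (m + 1))
      (φ.comp (sbLeft k i).toAddMonoidHom) T
    obtain ⟨g', h1', h2'⟩ := exists_polynomial_lift (A := Poly k (m + 1))
      (φ.comp ((AddMonoidHom.mulRight (sbW k i)).comp (sbLeft k i).toAddMonoidHom)) T
    let e : Poly k (m + 1 + 1) →+ Polynomial (Poly k (m + 1)) :=
      (toPolynomial (k := k)).toRingHom.toAddMonoidHom
    have he : ∀ f, e (inc f) = Polynomial.C f := toPolynomial_inc
    have he' : ∀ f, e (lastX k (m + 1) * f) = Polynomial.X * e f := fun f =>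
      (map_mul toPolynomial _ f).trans (congrArg (· * e f) toPolynomial_lastX)
    refine ⟨g.comp (e.comp (sbMulPoly k i.castSucc).toAddMonoidHom) +
      g'.comp (e.comp (sbCoord k i.castSucc)), fun x => ?_, fun b => ?_⟩
    · change g (e (sbMulPoly k i.castSucc (sbInc i x))) +
        g' (e (sbCoord k i.castSucc (sbInc i x))) = φ x
      rw [sbMulPoly_sbInc, sbCoord_sbInc, he, he, h1, h1']
      conv_rhs => rw [sb_eq_coords k i x]
      exact (map_add φ _ _).symm
    · change g (e (sbMulPoly k i.castSucc _)) + g' (e (sbCoord k i.castSucc _)) =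
        T (g (e (sbMulPoly k i.castSucc b)) + g' (e (sbCoord k i.castSucc b)))
      rw [sb_smul, sbOfEnv_lef, sbCoord_left, map_mul, sbMulPoly_left, he', he', h2, h2', map_add]
  generate S h h' := by
    have key : ∀ a b, sbLeft k i.castSucc a * sbRight k i.castSucc b ∈ S := by
      intro a b
      refine poly_generate (S.comap ((AddMonoidHom.mulRight (sbRight k i.castSucc b)).comp
        (sbLeft k i.castSucc).toAddMonoidHom)) (fun a' => ?_) (fun f hf => ?_) a
      · refine poly_generate (S.comap ((AddMonoidHom.mulLeft (sbLeft k i.castSucc (inc a'))).comp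
          (sbRight k i.castSucc).toAddMonoidHom)) (fun b' => ?_) (fun f hf => ?_) b
        · change sbLeft k i.castSucc (inc a') * sbRight k i.castSucc (inc b') ∈ S
          rw [← sbInc_mul]; exact h _
        · change sbLeft k i.castSucc (inc a') * sbRight k i.castSucc (lastX k (m + 1) * f) ∈ S
          rw [map_mul, ← sbLeft_lastX, mul_left_comm, ← sbOfEnv_lef]
          exact h' _ hf
      · change sbLeft k i.castSucc (lastX k (m + 1) * f) * sbRight k i.castSucc b ∈ S
        rw [map_mul, mul_assoc, ← sbOfEnv_lef]
        exact h' _ hf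
    refine (AddSubgroup.eq_top_iff' S).2 fun x => ?_
    induction x using SB.induction with
    | zero => exact S.zero_mem
    | add x y hx hy => exact S.add_mem hx hy
    | tmul a b => exact key a b

theorem sbOps_mul (p : ℕ) (a b : Poly k (m + 1)) (c : ℕ) :
    (sbOps p i).P (sbLeft k i a * sbRight k i b) c =
      ∑ ab ∈ Finset.HasAntidiagonal.antidiagonal c, sbLeft k i (PowerSeries.coeff ab.1 (powT p a)) *
        sbRight k i (PowerSeries.coeff ab.2 (powT p b)) := by
  change PowerSeries.coeff c (sbPow p i _) = _
  rw [sbPow_mul, PowerSeries.coeff_mul]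
  simp only [PowerSeries.coeff_map]

theorem isPowerExt_sbInc (p : ℕ) :
    IsPowerExt (sbOps p i : PowerOps k (m + 1) p (SB k i)) (sbOps p i.castSucc) (sbInc i) := by
  intro x c
  induction x using SB.induction with
  | zero => simp only [map_zero, Pi.zero_apply]
  | add x y hx hy => simp only [map_add, Pi.add_apply, hx, hy]
  | tmul a b =>
    rw [sbInc_mul, sbOps_mul, sbOps_mul, map_sum]
    simp only [sbInc_mul, coeff_powT_inc]

theorem conv_map {A A' M M' : Type} [CommRing A] [CommRing A'] [AddCommGroup M] [Module A M]
    [AddCommGroup M'] [Module A' M'] (ι : M →+ M') (g : PowerSeries A) (g' : PowerSeries A')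
    (h : ∀ b x, ι (PowerSeries.coeff b g • x) = PowerSeries.coeff b g' • ι x) (s : ℕ → M) (c : ℕ) :
    ι (conv g s c) = conv g' (fun c => ι (s c)) c := by
  rw [conv, conv, map_sum]
  exact Finset.sum_congr rfl fun ab _ => h _ _

theorem sbInc_zeta : sbInc i (zeta k i) = zeta k i.castSucc := by
  have h1 := sbInc_mul (k := k) i 1 (MvPolynomial.X i.succ)
  have h2 := sbInc_mul (k := k) i (MvPolynomial.X i.castSucc) 1
  simp only [map_one, one_mul, mul_one, MvPolynomial.rename_X] at h1 h2
  rw [zeta_eq, zeta_eq, map_sub, h1, h2, Fin.succ_castSucc]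

theorem sbInc_zeta_pow_mul (q : ℕ) (x : SB k i) :
    sbInc i (zeta k i ^ q * x) = zeta k i.castSucc ^ q * sbInc i x := by
  induction q with
  | zero => simp
  | succ q ih =>
    have h : ∀ y, sbInc i (zeta k i * y) = zeta k i.castSucc * sbInc i y := fun y => by
      rw [zeta_eq, zeta_eq, sub_mul, sub_mul, map_sub, sbInc_left, sbInc_right,
        MvPolynomial.rename_X, MvPolynomial.rename_X, Fin.succ_castSucc]
    rw [pow_succ', mul_assoc, h, ih, pow_succ', mul_assoc]

theorem sbInc_neg_zeta_pow_mul (q b : ℕ) (x : SB k i) :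
    sbInc i ((-zeta k i ^ q) ^ b * x) = (-zeta k i.castSucc ^ q) ^ b * sbInc i x := by
  induction b with
  | zero => simp
  | succ b ih =>
    rw [pow_succ', mul_assoc, neg_mul, map_neg, sbInc_zeta_pow_mul, ih, pow_succ', mul_assoc,
      neg_mul]

theorem isPowerExt_twist (p : ℕ) :
    IsPowerExt ((sbOps p i).twist (zEnv k i) : PowerOps k (m + 1) p (SB k i))
      ((sbOps p i.castSucc).twist (zEnv k i.castSucc)) (sbInc i) := by
  intro x c
  change conv _ ((sbOps p i.castSucc).P (sbInc i x)) c = sbInc i (conv _ ((sbOps p i).P x) c)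
  have h : (sbOps p i.castSucc).P (sbInc i x) = fun c => sbInc i ((sbOps p i).P x c) :=
    funext fun c => isPowerExt_sbInc i p x c
  rw [h]
  refine (conv_map (sbInc i) _ _ (fun b y => ?_) _ c).symm
  rw [thomInv, thomInv, PowerSeries.coeff_mk, PowerSeries.coeff_mk, sb_smul, sb_smul, map_pow,
    map_pow, map_neg, map_neg, map_pow, map_pow]
  exact sbInc_neg_zeta_pow_mul i (p - 1) b y

theorem isGradedExt_sbInc (e : ℤ) :
    IsGradedExt k (m + 1) (fun d => sbDeg (k := k) i (d + e)) (fun d => sbDeg i.castSucc (d + e))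
      (sbInc i) := by
  intro d
  refine (AddSubgroup.closure_le _).2 ?_
  rintro _ ⟨d₁, d₂, a, b, hd, ha, hb, rfl⟩
  set S := AddSubgroup.closure {e' | ∃ (j : ℕ) (x : SB k i), x ∈ sbDeg (k := k) i (d - 2 * j + e) ∧
    e' = (lef (lastX k (m + 1) ^ j) : Env (Poly k (m + 1 + 1))) • sbInc i x}
  have h1 := AddSubgroup.closure_le (S.comap ((AddMonoidHom.mulRight (sbRight k i.castSucc b)).comp
    (sbLeft k i.castSucc).toAddMonoidHom)) |>.2 ?_ (polyDeg_le d₁ ha)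
  · exact h1
  rintro _ ⟨j, a', ha', rfl⟩
  have h2 := AddSubgroup.closure_le (S.comap ((AddMonoidHom.mulLeft
    (sbLeft k i.castSucc (lastX k (m + 1) ^ j * inc a'))).comp
    (sbRight k i.castSucc).toAddMonoidHom)) |>.2 ?_ (polyDeg_le d₂ hb)
  · exact h2
  rintro _ ⟨j', b', hb', rfl⟩
  refine AddSubgroup.subset_closure ⟨j + j', sbLeft k i a' * sbRight k i b',
    AddSubgroup.subset_closure ⟨_, _, a', b', ?_, ha', hb', rfl⟩, ?_⟩
  · push_cast
    linear_combination hd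
  · change sbLeft k i.castSucc (lastX k (m + 1) ^ j * inc a') *
      sbRight k i.castSucc (lastX k (m + 1) ^ j' * inc b') = _
    rw [sb_smul, sbOfEnv_lef, sbInc_mul, map_mul, map_mul, map_pow, map_pow, map_pow,
      ← sbLeft_lastX]
    ring

theorem sbRight_mul_mem_sbDeg {r : Poly k (m + 1)} {d e : ℤ} (hr : r ∈ polyDeg (k := k) e)
    {x : SB k i} (hx : x ∈ sbDeg (k := k) i d) :
    sbRight k i r * x ∈ sbDeg (k := k) i (d + e) := by
  induction hx using AddSubgroup.closure_induction with
  | zero => rw [mul_zero]; exact AddSubgroup.zero_mem _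
  | add x y _ _ hx hy => rw [mul_add]; exact AddSubgroup.add_mem _ hx hy
  | neg x _ hx => rw [mul_neg]; exact AddSubgroup.neg_mem _ hx
  | mem x hx =>
    obtain ⟨d₁, d₂, f, g, hd, hf, hg, rfl⟩ := hx
    refine AddSubgroup.subset_closure ⟨d₁, e + d₂, f, r * g, ?_, hf, mul_mem_polyDeg hr hg, ?_⟩
    · linear_combination hd
    · rw [map_mul]; ring

theorem isRigStable_sbDeg (e : ℤ) : IsRigStable k (m + 1) (fun d => sbDeg (k := k) i (d + e)) := by
  intro d e' r hr x hx
  have h := sbRight_mul_mem_sbDeg i hr hx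
  rw [← sbOfEnv_rig, show d + e + e' = d + e' + e by ring] at h
  exact h

end SB

end PolyExt

/-! ### Extensions of tensor products and direct sums -/

section TensorExt

variable {k : Type} [CommRing k] {n : ℕ}

section

variable {M N E F : Type} [AddCommGroup M] [Module (Env (Poly k n)) M]
  [AddCommGroup N] [Module (Env (Poly k n)) N] [AddCommGroup E] [Module (Env (Poly k (n + 1))) E]
  [AddCommGroup F] [Module (Env (Poly k (n + 1))) F] {ιM : M →+ E} {ιN : N →+ F}

/-- The map `M ⊗ N → M[t] ⊗ N[t]`. -/
def tensorExt (HM : IsPolyExt k n ιM) (HN : IsPolyExt k n ιN) :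
    BTensor (Poly k n) M N →+ BTensor (Poly k (n + 1)) E F :=
  BTensor.lift ((AddMonoidHom.compHom' ιN).comp ((BTensor.mk (Poly k (n + 1)) E F).comp ιM))
    (fun r x y => by
      change BTensor.tmul (ιM _) (ιN y) = BTensor.tmul (ιM x) (ιN _)
      rw [HM.rig_smul, HN.lef_smul, BTensor.balanced])

theorem tensorExt_tmul (HM : IsPolyExt k n ιM) (HN : IsPolyExt k n ιN) (x : M) (y : N) :
    tensorExt HM HN (BTensor.tmul x y) = BTensor.tmul (ιM x) (ιN y) := rfl

theorem tmul_lastX_smul (HM : IsPolyExt k n ιM) (e : E) (f : F) :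
    (BTensor.tmul e ((lef (lastX k n) : Env (Poly k (n + 1))) • f) : BTensor (Poly k (n + 1)) E F) =
      (lef (lastX k n) : Env (Poly k (n + 1))) • BTensor.tmul e f := by
  rw [← BTensor.balanced, ← HM.central, BTensor.lef_smul]

/-- A balanced pairing of `M` and `N` with values in a group with an endomorphism extends to a
balanced pairing of `M[t]` and `N[t]`. -/
theorem exists_pairing (HM : IsPolyExt k n ιM) (HN : IsPolyExt k n ιN) {P : Type} [AddCommGroup P]
    (φ : BTensor (Poly k n) M N →+ P) (T : P →+ P) : ∃ G : E →+ F →+ P,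
      (∀ x y, G (ιM x) (ιN y) = φ (BTensor.tmul x y)) ∧
      (∀ e f, G ((lef (lastX k n) : Env (Poly k (n + 1))) • e) f = T (G e f)) ∧
      ∀ r e f, G ((rig r : Env (Poly k (n + 1))) • e) f =
        G e ((lef r : Env (Poly k (n + 1))) • f) := by
  choose g hg hg' using fun x : M => HN.exists_lift P (φ.comp (BTensor.mk (Poly k n) M N x)) T
  let Φ : M →+ F →+ P := AddMonoidHom.mk' g (fun x y => by
    refine HN.hom_ext T (fun z => ?_) (hg' _) (fun f => ?_)
    · rw [AddMonoidHom.add_apply, hg, hg, hg, ← AddMonoidHom.add_apply, ← AddMonoidHom.comp_add,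
        map_add]
    · rw [AddMonoidHom.add_apply, AddMonoidHom.add_apply, hg', hg', map_add])
  obtain ⟨G, h1, h2⟩ := HM.exists_lift (F →+ P) Φ (AddMonoidHom.compHom T)
  have h1' : ∀ x y, G (ιM x) (ιN y) = φ (BTensor.tmul x y) := fun x y => by
    rw [h1]; exact hg x y
  have h2' : ∀ e f, G ((lef (lastX k n) : Env (Poly k (n + 1))) • e) f = T (G e f) := fun e f => by
    rw [h2]; rfl
  have h3 : ∀ e f, G e ((lef (lastX k n) : Env (Poly k (n + 1))) • f) = T (G e f) := by
    intro e f
    have : G.flip ((lef (lastX k n) : Env (Poly k (n + 1))) • f) = T.comp (G.flip f) := by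
      refine HM.hom_ext T (fun x => ?_) (fun e => h2' e _) (fun e => congrArg T (h2' e f))
      change G (ιM x) _ = T (G (ιM x) f)
      rw [h1]; exact hg' x f
    exact DFunLike.congr_fun this e
  refine ⟨G, h1', h2', ?_⟩
  have hinc : ∀ (r : Poly k n) e f, G ((rig (inc r) : Env (Poly k (n + 1))) • e) f =
      G e ((lef (inc r) : Env (Poly k (n + 1))) • f) := by
    intro r e f
    have : (G.flip f).comp (DistribSMul.toAddMonoidHom E (rig (inc r) : Env (Poly k (n + 1)))) =
        G.flip ((lef (inc r) : Env (Poly k (n + 1))) • f) := by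
      refine HM.hom_ext T (fun x => ?_) (fun e => ?_) (fun e => h2' e _)
      · have : (G (ιM ((rig r : Env (Poly k n)) • x))) = (G (ιM x)).comp
            (DistribSMul.toAddMonoidHom F (lef (inc r) : Env (Poly k (n + 1)))) := by
          refine HN.hom_ext T (fun y => ?_) (fun f => h3 _ _) (fun f => ?_)
          · change G (ιM _) (ιN y) = G (ιM x) ((lef (inc r) : Env (Poly k (n + 1))) • ιN y)
            rw [← HN.lef_smul, h1', h1', BTensor.balanced]
          · change G (ιM x) ((lef (inc r) : Env (Poly k (n + 1))) •
              (lef (lastX k n) : Env (Poly k (n + 1))) • f) = _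
            rw [smul_comm, h3]; rfl
        change G ((rig (inc r) : Env (Poly k (n + 1))) • ιM x) f = _
        rw [← HM.rig_smul, this]; rfl
      · change G ((rig (inc r) : Env (Poly k (n + 1))) •
          (lef (lastX k n) : Env (Poly k (n + 1))) • e) f = _
        rw [smul_comm, h2']; rfl
    exact DFunLike.congr_fun this e
  intro r
  induction r using MvPolynomial.induction_on with
  | C c =>
    intro e f
    have := hinc (MvPolynomial.C c) e f
    rwa [MvPolynomial.rename_C] at this
  | add r s hr hs =>
    intro e f
    rw [map_add, map_add, add_smul, add_smul, map_add, map_add, AddMonoidHom.add_apply, hr, hs]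
  | mul_X r a hr =>
    intro e f
    have ha : G ((rig (MvPolynomial.X a) : Env (Poly k (n + 1))) • e) =
        (G e).comp (DistribSMul.toAddMonoidHom F (lef (MvPolynomial.X a) : Env (Poly k (n + 1)))) := by
      refine AddMonoidHom.ext fun f => ?_
      change _ = G e ((lef (MvPolynomial.X a) : Env (Poly k (n + 1))) • f)
      induction a using Fin.lastCases with
      | last => rw [← HM.central, h2', h3]
      | cast a =>
        have := hinc (MvPolynomial.X a) e f
        rwa [MvPolynomial.rename_X] at this
    rw [map_mul, map_mul, mul_smul, mul_smul, hr, ha, smul_comm]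
    rfl

theorem isPolyExt_tensorExt (HM : IsPolyExt k n ιM) (HN : IsPolyExt k n ιN) :
    IsPolyExt k n (tensorExt HM HN) where
  lef_smul r z := by
    induction z using BTensor.induction with
    | zero => rw [smul_zero, map_zero, smul_zero]
    | add x y hx hy => rw [smul_add, map_add, map_add, smul_add, hx, hy]
    | tmul x y =>
      rw [BTensor.lef_smul, tensorExt_tmul, tensorExt_tmul, BTensor.lef_smul, HM.lef_smul]
  rig_smul r z := by
    induction z using BTensor.induction with
    | zero => rw [smul_zero, map_zero, smul_zero]
    | add x y hx hy => rw [smul_add, map_add, map_add, smul_add, hx, hy]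
    | tmul x y =>
      rw [BTensor.rig_smul, tensorExt_tmul, tensorExt_tmul, BTensor.rig_smul, HN.rig_smul]
  central z := by
    induction z using BTensor.induction with
    | zero => rw [smul_zero, smul_zero]
    | add x y hx hy => rw [smul_add, smul_add, hx, hy]
    | tmul x y =>
      rw [BTensor.rig_smul, ← HN.central, tmul_lastX_smul HM]
  exists_lift P _ φ T := by
    obtain ⟨G, h1, h2, h3⟩ := exists_pairing HM HN φ T
    refine ⟨BTensor.lift G h3, fun z => ?_, fun z => ?_⟩
    · refine DFunLike.congr_fun (f := (BTensor.lift G h3).comp (tensorExt HM HN)) (g := φ) ?_ z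
      exact BTensor.hom_ext h1
    · induction z using BTensor.induction with
      | zero => rw [smul_zero, map_zero, map_zero]
      | add x y hx hy => rw [smul_add, map_add, map_add, map_add, hx, hy]
      | tmul e f => rw [BTensor.lef_smul]; exact h2 e f
  generate S h h' := by
    have key : ∀ e f, BTensor.tmul e f ∈ S := by
      intro e f
      have h1 : ∀ x, BTensor.tmul (ιM x) f ∈ S := fun x => by
        have := HN.generate (S.comap (BTensor.mk (Poly k (n + 1)) E F (ιM x)))
          (fun y => h (BTensor.tmul x y)) (fun f hf => by
            change BTensor.tmul _ _ ∈ S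
            rw [tmul_lastX_smul HM]
            exact h' _ hf)
        exact (AddSubgroup.eq_top_iff' _).1 this f
      have := HM.generate (S.comap ((BTensor.mk (Poly k (n + 1)) E F).flip f)) h1 (fun e he => by
        change BTensor.tmul _ _ ∈ S
        rw [← BTensor.lef_smul]
        exact h' _ he)
      exact (AddSubgroup.eq_top_iff' _).1 this e
    refine (AddSubgroup.eq_top_iff' S).2 fun z => ?_
    induction z using BTensor.induction with
    | zero => exact S.zero_mem
    | add x y hx hy => exact S.add_mem hx hy
    | tmul e f => exact key e f

variable (k n) in
/-- Degree `d` part of a tensor product of graded bimodules. -/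
def tensorDeg (gM : ℤ → AddSubgroup M) (gN : ℤ → AddSubgroup N) (d : ℤ) :
    AddSubgroup (BTensor (Poly k n) M N) :=
  AddSubgroup.closure {x | ∃ (d₁ d₂ : ℤ) (c : M) (c' : N), d₁ + d₂ = d ∧
      c ∈ gM d₁ ∧ c' ∈ gN d₂ ∧ x = BTensor.tmul c c'}

theorem lef_pow_smul_tmul (HM : IsPolyExt k n ιM) (i j : ℕ) (e : E) (f : F) :
    (BTensor.tmul ((lef (lastX k n ^ i) : Env (Poly k (n + 1))) • e)
      ((lef (lastX k n ^ j) : Env (Poly k (n + 1))) • f) : BTensor (Poly k (n + 1)) E F) =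
      (lef (lastX k n ^ (i + j)) : Env (Poly k (n + 1))) • BTensor.tmul e f := by
  have h : ∀ f', (BTensor.tmul ((lef (lastX k n ^ i) : Env (Poly k (n + 1))) • e) f' :
      BTensor (Poly k (n + 1)) E F) =
      (lef (lastX k n ^ i) : Env (Poly k (n + 1))) • BTensor.tmul e f' := fun f' =>
    (BTensor.lef_smul _ _ _).symm
  rw [h, pow_add, map_mul, mul_smul]
  congr 1
  induction j with
  | zero => rw [pow_zero, map_one, one_smul, one_smul]
  | succ j ih => rw [pow_succ', map_mul, mul_smul, tmul_lastX_smul HM, ih, mul_smul]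

theorem isGradedExt_tensorExt (HM : IsPolyExt k n ιM) (HN : IsPolyExt k n ιN)
    {gM : ℤ → AddSubgroup M} {gN : ℤ → AddSubgroup N} {gE : ℤ → AddSubgroup E}
    {gF : ℤ → AddSubgroup F} (hM : IsGradedExt k n gM gE ιM) (hN : IsGradedExt k n gN gF ιN) :
    IsGradedExt k n (tensorDeg k n gM gN) (tensorDeg k (n + 1) gE gF) (tensorExt HM HN) := by
  intro d
  refine (AddSubgroup.closure_le _).2 ?_
  rintro _ ⟨d₁, d₂, e, f, hd, he, hf, rfl⟩
  set S := AddSubgroup.closure {e' | ∃ (i : ℕ) (x : BTensor (Poly k n) M N),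
    x ∈ tensorDeg k n gM gN (d - 2 * i) ∧
    e' = (lef (lastX k n ^ i) : Env (Poly k (n + 1))) • tensorExt HM HN x}
  have h1 := (AddSubgroup.closure_le (S.comap ((BTensor.mk (Poly k (n + 1)) E F).flip f))).2 ?_
    (hM d₁ he)
  · exact h1
  rintro _ ⟨i, x, hx, rfl⟩
  have h2 := (AddSubgroup.closure_le (S.comap (BTensor.mk (Poly k (n + 1)) E F
    ((lef (lastX k n ^ i) : Env (Poly k (n + 1))) • ιM x)))).2 ?_ (hN d₂ hf)
  · exact h2
  rintro _ ⟨j, y, hy, rfl⟩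
  refine AddSubgroup.subset_closure ⟨i + j, BTensor.tmul x y,
    AddSubgroup.subset_closure ⟨_, _, x, y, ?_, hx, hy, rfl⟩, ?_⟩
  · push_cast
    linear_combination hd
  · exact lef_pow_smul_tmul HM i j (ιM x) (ιN y)

theorem isRigStable_tensorDeg {gM : ℤ → AddSubgroup M} {gN : ℤ → AddSubgroup N}
    (hN : IsRigStable k n gN) : IsRigStable k n (tensorDeg k n gM gN) := by
  intro d e r hr x hx
  induction hx using AddSubgroup.closure_induction with
  | zero => rw [smul_zero]; exact AddSubgroup.zero_mem _
  | add x y _ _ hx hy => rw [smul_add]; exact AddSubgroup.add_mem _ hx hy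
  | neg x _ hx => rw [smul_neg]; exact AddSubgroup.neg_mem _ hx
  | mem x hx =>
    obtain ⟨d₁, d₂, c, c', hd, hc, hc', rfl⟩ := hx
    refine AddSubgroup.subset_closure ⟨d₁, d₂ + e, c, _, ?_, hc, hN d₂ e r hr c' hc',
      BTensor.rig_smul _ _ _⟩
    linear_combination hd

theorem isPowerExt_tensorExt (HM : IsPolyExt k n ιM) (HN : IsPolyExt k n ιN) {p : ℕ}
    {oM : PowerOps k n p M} {oN : PowerOps k n p N} {oE : PowerOps k (n + 1) p E}
    {oF : PowerOps k (n + 1) p F} (hM : IsPowerExt oM oE ιM) (hN : IsPowerExt oN oF ιN) :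
    IsPowerExt (oM.tensor oN) (oE.tensor oF) (tensorExt HM HN) := by
  intro z c
  induction z using BTensor.induction with
  | zero => simp only [map_zero, Pi.zero_apply]
  | add x y hx hy => simp only [map_add, Pi.add_apply, hx, hy]
  | tmul x y =>
    change tconv (oE.P (ιM x)) (oF.P (ιN y)) c = tensorExt HM HN (tconv (oM.P x) (oN.P y) c)
    rw [tconv, tconv, map_sum]
    exact Finset.sum_congr rfl fun ab _ => by rw [hM, hN, tensorExt_tmul]

end

section

variable {ι : Type} {M E : ι → Type} [∀ i, AddCommGroup (M i)]
  [∀ i, Module (Env (Poly k n)) (M i)] [∀ i, AddCommGroup (E i)]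
  [∀ i, Module (Env (Poly k (n + 1))) (E i)] {φ : ∀ i, M i →+ E i}

theorem isPolyExt_directSum [DecidableEq ι] (H : ∀ i, IsPolyExt k n (φ i)) :
    IsPolyExt k n (DirectSum.map φ : DirectSum ι M →+ DirectSum ι E) where
  lef_smul r x := DFinsupp.ext fun i => (H i).lef_smul r (x i)
  rig_smul r x := DFinsupp.ext fun i => (H i).rig_smul r (x i)
  central e := DFinsupp.ext fun i => (H i).central (e i)
  exists_lift P _ ψ T := by
    choose g hg hg' using fun i => (H i).exists_lift P (ψ.comp (DirectSum.of M i)) T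
    refine ⟨DirectSum.toAddMonoid g, fun x => ?_, fun e => ?_⟩
    · induction x using DirectSum.induction_on with
      | zero => simp only [map_zero]
      | of i x => rw [DirectSum.map_of, DirectSum.toAddMonoid_of, hg]; rfl
      | add x y hx hy => rw [map_add, map_add, map_add, hx, hy]
    · induction e using DirectSum.induction_on with
      | zero => simp only [smul_zero, map_zero]
      | of i x =>
        have : (lef (lastX k n) : Env (Poly k (n + 1))) • DirectSum.of E i x =
            DirectSum.of E i ((lef (lastX k n) : Env (Poly k (n + 1))) • x) :=
          (map_smul (DirectSum.lof (Env (Poly k (n + 1))) ι E i) _ x).symm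
        rw [this, DirectSum.toAddMonoid_of, DirectSum.toAddMonoid_of, hg']
      | add x y hx hy => rw [smul_add, map_add, map_add, map_add, hx, hy]
  generate S h h' := by
    refine (AddSubgroup.eq_top_iff' S).2 fun z => ?_
    induction z using DirectSum.induction_on with
    | zero => exact S.zero_mem
    | of i x =>
      have := (H i).generate (S.comap (DirectSum.of E i)) (fun x => by
        change DirectSum.of E i (φ i x) ∈ S
        rw [← DirectSum.map_of]
        exact h _) (fun e he => by
          change DirectSum.of E i _ ∈ S
          have h2 := h' _ he
          rwa [show (lef (lastX k n) : Env (Poly k (n + 1))) • DirectSum.of E i e =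
            DirectSum.of E i ((lef (lastX k n) : Env (Poly k (n + 1))) • e) from
            (map_smul (DirectSum.lof (Env (Poly k (n + 1))) ι E i) _ e).symm] at h2)
      exact (AddSubgroup.eq_top_iff' _).1 this x
    | add x y hx hy => exact S.add_mem hx hy

theorem isPowerExt_directSum {p : ℕ} {oM : ∀ i, PowerOps k n p (M i)}
    {oE : ∀ i, PowerOps k (n + 1) p (E i)} (h : ∀ i, IsPowerExt (oM i) (oE i) (φ i)) :
    IsPowerExt (PowerOps.directSum oM) (PowerOps.directSum oE) (DirectSum.map φ) :=
  fun x c => DFinsupp.ext fun i => h i (x i) c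

end

theorem isPolyExt_zero : IsPolyExt k n (0 : (PUnit : Type) →+ (PUnit : Type)) where
  lef_smul _ _ := rfl
  rig_smul _ _ := rfl
  central _ := rfl
  exists_lift P _ φ T := ⟨0, fun x => by
      rw [Subsingleton.elim x 0, map_zero, map_zero], fun _ => (map_zero T).symm⟩
  generate S h _ := (AddSubgroup.eq_top_iff' S).2 fun x => Subsingleton.elim 0 x ▸ S.zero_mem

end TensorExt

/-! ### The complex of a word on one more strand -/

section Complexes

theorem tensorComplex_d {R : Type} [CommRing R] (C D : CochainComplex (Bimod R) ℤ) (j : ℤ) :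
    (tensorComplex C D).d j (j + 1) = ModuleCat.ofHom (tensorD C D j) :=
  CochainComplex.of_d (fun j => ModuleCat.of (Env R) (tensorX C D j))
    (fun j => ModuleCat.ofHom (tensorD C D j)) j

variable {k : Type} [CommRing k] {n m : ℕ}

/-- The maps `ι_j` exhibit the complex `D` as `C[t]`, together with its internal grading and its
reduced powers. -/
structure IsPolyExtComplex {C : CochainComplex (Bimod (Poly k n)) ℤ}
    {D : CochainComplex (Bimod (Poly k (n + 1))) ℤ} (gC : Degrees C) (gD : Degrees D)
    (oC : ∀ p, PowerFamily p C) (oD : ∀ p, PowerFamily p D) (ι : ∀ j, C.X j →+ D.X j) : Prop where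
  ext : ∀ j, IsPolyExt k n (ι j)
  comm : ∀ j x, ι (j + 1) ((C.d j (j + 1)).hom x) = (D.d j (j + 1)).hom (ι j x)
  graded : ∀ j, IsGradedExt k n (gC j) (gD j) (ι j)
  stable : ∀ j, IsRigStable k n (gC j)
  power : ∀ p j, IsPowerExt (oC p j) (oD p j) (ι j)

section

variable {C C' : CochainComplex (Bimod (Poly k n)) ℤ}
  {D D' : CochainComplex (Bimod (Poly k (n + 1))) ℤ} {gC : Degrees C} {gC' : Degrees C'}
  {gD : Degrees D} {gD' : Degrees D'} {oC : ∀ p, PowerFamily p C} {oC' : ∀ p, PowerFamily p C'}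
  {oD : ∀ p, PowerFamily p D} {oD' : ∀ p, PowerFamily p D'} {ι : ∀ j, C.X j →+ D.X j}
  {ι' : ∀ j, C'.X j →+ D'.X j}

/-- The map `C ⊗ C' → C[t] ⊗ C'[t]` in each degree. -/
def tensorComplexExt (H : IsPolyExtComplex gC gD oC oD ι)
    (H' : IsPolyExtComplex gC' gD' oC' oD' ι') (j : ℤ) : tensorX C C' j →+ tensorX D D' j :=
  DirectSum.map fun ab : Deg j => tensorExt (H.ext ab.1.1) (H'.ext ab.1.2)

theorem tensorComplexExt_incl (H : IsPolyExtComplex gC gD oC oD ι)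
    (H' : IsPolyExtComplex gC' gD' oC' oD' ι') {j : ℤ} (ab : Deg j)
    (x : BTensor (Poly k n) (C.X ab.1.1) (C'.X ab.1.2)) :
    tensorComplexExt H H' j (tensorIncl C C' ab x) =
      tensorIncl D D' ab (tensorExt (H.ext ab.1.1) (H'.ext ab.1.2) x) :=
  DirectSum.map_of (fun ab : Deg j => tensorExt (H.ext ab.1.1) (H'.ext ab.1.2)) ab x

theorem tensorComplexExt_comm (H : IsPolyExtComplex gC gD oC oD ι)
    (H' : IsPolyExtComplex gC' gD' oC' oD' ι') (j : ℤ) (x : tensorX C C' j) :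
    tensorComplexExt H H' (j + 1) (tensorD C C' j x) =
      tensorD D D' j (tensorComplexExt H H' j x) := by
  induction x using DirectSum.induction_on with
  | zero => simp only [map_zero]
  | add x y hx hy => simp only [map_add, hx, hy]
  | of ab x =>
    change tensorComplexExt H H' (j + 1) (tensorD C C' j (tensorIncl C C' ab x)) =
      tensorD D D' j (tensorComplexExt H H' j (tensorIncl C C' ab x))
    rw [tensorComplexExt_incl, tensorD_incl, tensorD_incl, map_add, map_zsmul]
    have h1 : tensorComplexExt H H' (j + 1) (tensorDLeft C C' ab x) =
        tensorDLeft D D' ab (tensorExt (H.ext ab.1.1) (H'.ext ab.1.2) x) := by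
      refine (tensorComplexExt_incl H H' ab.incl _).trans ?_
      change tensorIncl D D' ab.incl _ = tensorIncl D D' ab.incl _
      congr 1
      induction x using BTensor.induction with
      | zero => simp only [map_zero]
      | add x y hx hy => simp only [map_add, hx, hy]
      | tmul x y =>
        change BTensor.tmul (ι _ ((C.d ab.1.1 (ab.1.1 + 1)).hom x)) (ι' _ y) = _
        rw [H.comm]; rfl
    have h2 : tensorComplexExt H H' (j + 1) (tensorDRight C C' ab x) =
        tensorDRight D D' ab (tensorExt (H.ext ab.1.1) (H'.ext ab.1.2) x) := by
      refine (tensorComplexExt_incl H H' ab.incr _).trans ?_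
      change tensorIncl D D' ab.incr _ = tensorIncl D D' ab.incr _
      congr 1
      clear h1
      induction x using BTensor.induction with
      | zero => simp only [map_zero]
      | add x y hx hy => simp only [map_add, hx, hy]
      | tmul x y =>
        change BTensor.tmul (ι _ x) (ι' _ ((C'.d ab.1.2 (ab.1.2 + 1)).hom y)) = _
        rw [H'.comm]; rfl
    rw [h1, h2]

theorem tensorComplexExt_graded (H : IsPolyExtComplex gC gD oC oD ι)
    (H' : IsPolyExtComplex gC' gD' oC' oD' ι') (j : ℤ) :
    IsGradedExt k n (tensorDegrees gC gC' j) (tensorDegrees gD gD' j)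
      (tensorComplexExt H H' j) := by
  intro d
  refine iSup_le fun ab => ?_
  set S : AddSubgroup (tensorX D D' j) := AddSubgroup.closure {e | ∃ (i : ℕ) (x : tensorX C C' j),
    x ∈ tensorDegrees gC gC' j (d - 2 * i) ∧
    e = (lef (lastX k n ^ i) : Env (Poly k (n + 1))) • tensorComplexExt H H' j x}
  rintro _ ⟨y, hy, rfl⟩
  have h := isGradedExt_tensorExt (H.ext ab.1.1) (H'.ext ab.1.2) (H.graded ab.1.1)
    (H'.graded ab.1.2) d
  refine ((AddSubgroup.closure_le (S.comap (tensorIncl D D' ab).toAddMonoidHom)).2 ?_) (h hy)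
  rintro _ ⟨i, x, hx, rfl⟩
  refine AddSubgroup.subset_closure ⟨i, tensorIncl C C' ab x,
    AddSubgroup.mem_iSup_of_mem ab ⟨x, hx, rfl⟩, ?_⟩
  refine (map_smul (tensorIncl D D' ab) _ _).trans ?_
  rw [← tensorComplexExt_incl H H' ab x]

theorem tensorDegrees_stable (h : ∀ j, IsRigStable k n (gC' j)) (j : ℤ) :
    IsRigStable k n (M := tensorX C C' j) (tensorDegrees gC gC' j) := by
  intro d e r hr x hx
  have : (tensorDegrees gC gC' j d : AddSubgroup (tensorX C C' j)) ≤
      AddSubgroup.comap (DistribSMul.toAddMonoidHom (tensorX C C' j)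
        (rig r : Env (Poly k n))) (tensorDegrees gC gC' j (d + e)) := by
    refine iSup_le fun ab => ?_
    rintro _ ⟨x, hx, rfl⟩
    refine AddSubgroup.mem_iSup_of_mem ab ⟨(rig r : Env (Poly k n)) • x,
      isRigStable_tensorDeg (h ab.1.2) d e r hr x hx, ?_⟩
    exact map_smul (tensorIncl C C' ab) _ _
  exact this hx

theorem isPolyExtComplex_tensor (H : IsPolyExtComplex gC gD oC oD ι)
    (H' : IsPolyExtComplex gC' gD' oC' oD' ι') :
    IsPolyExtComplex (C := tensorComplex C C') (D := tensorComplex D D') (tensorDegrees gC gC')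
      (tensorDegrees gD gD') (fun p => tensorPowers (oC p) (oC' p))
      (fun p => tensorPowers (oD p) (oD' p)) (tensorComplexExt H H') where
  ext j := isPolyExt_directSum fun ab => isPolyExt_tensorExt _ _
  comm j x := by
    rw [tensorComplex_d, tensorComplex_d]
    exact tensorComplexExt_comm H H' j x
  graded := tensorComplexExt_graded H H'
  stable := tensorDegrees_stable H'.stable
  power p j := isPowerExt_directSum fun ab =>
    isPowerExt_tensorExt _ _ (H.power p ab.1.1) (H'.power p ab.1.2)

end

theorem isGradedExt_zero (g : ℤ → AddSubgroup PUnit) :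
    IsGradedExt k n (fun _ => (⊤ : AddSubgroup PUnit)) g (0 : (PUnit : Type) →+ (PUnit : Type)) :=
  fun _ x _ => Subsingleton.elim 0 x ▸ AddSubgroup.zero_mem _

/-- The maps from the complex of the empty word to the one on one more strand. -/
def oneExt : ∀ j, (oneComplex k n).X j →+ (oneComplex k (n + 1)).X j
  | .ofNat 0 => (ubInc : UB k n →+ UB k (n + 1))
  | .ofNat (_ + 1) => (0 : (PUnit : Type) →+ (PUnit : Type))
  | .negSucc _ => (0 : (PUnit : Type) →+ (PUnit : Type))

/-- The maps from the complex of `σ_i` to the one on one more strand. -/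
def posExt (i : Fin m) : ∀ j, (posComplex k i).X j →+ (posComplex k i.castSucc).X j
  | .ofNat 0 => (ubInc : UB k (m + 1) →+ UB k (m + 1 + 1))
  | .ofNat (_ + 1) => (0 : (PUnit : Type) →+ (PUnit : Type))
  | .negSucc 0 => (sbInc i : SB k i →+ SB k i.castSucc)
  | .negSucc (_ + 1) => (0 : (PUnit : Type) →+ (PUnit : Type))

/-- The maps from the complex of `σ_i⁻¹` to the one on one more strand. -/
def negExt (i : Fin m) : ∀ j, (negComplex k i).X j →+ (negComplex k i.castSucc).X j
  | .ofNat 0 => (ubInc : UB k (m + 1) →+ UB k (m + 1 + 1))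
  | .ofNat 1 => (sbInc i : SB k i →+ SB k i.castSucc)
  | .ofNat (_ + 2) => (0 : (PUnit : Type) →+ (PUnit : Type))
  | .negSucc _ => (0 : (PUnit : Type) →+ (PUnit : Type))

theorem isPolyExtComplex_one : IsPolyExtComplex (oneDegrees (k := k) (n := n)) oneDegrees
    (fun p => onePowers p) (fun p => onePowers p) oneExt where
  ext
    | .ofNat 0 => isPolyExt_ubInc
    | .ofNat (_ + 1) => isPolyExt_zero
    | .negSucc _ => isPolyExt_zero
  comm j x := by
    have h1 : (oneComplex k n).d j (j + 1) = 0 :=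
      CochainComplex.of_d (oneX k n) (fun _ => 0) j
    have h2 : (oneComplex k (n + 1)).d j (j + 1) = 0 :=
      CochainComplex.of_d (oneX k (n + 1)) (fun _ => 0) j
    rw [h1, h2]
    exact map_zero _
  graded
    | .ofNat 0 => isGradedExt_ubInc
    | .ofNat (_ + 1) => isGradedExt_zero _
    | .negSucc _ => isGradedExt_zero _
  stable
    | .ofNat 0 => isRigStable_ubDeg
    | .ofNat (_ + 1) => fun _ _ _ _ _ _ => AddSubgroup.mem_top _
    | .negSucc _ => fun _ _ _ _ _ _ => AddSubgroup.mem_top _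
  power p
    | .ofNat 0 => isPowerExt_ubInc p
    | .ofNat (_ + 1) => fun _ _ => rfl
    | .negSucc _ => fun _ _ => rfl

theorem isGradedExt_sbInc' (i : Fin m) :
    IsGradedExt k (m + 1) (fun d => sbDeg (k := k) i d) (fun d => sbDeg i.castSucc d)
      (sbInc i) := by
  have := isGradedExt_sbInc (k := k) i 0
  simpa only [add_zero] using this

theorem isRigStable_sbDeg' (i : Fin m) :
    IsRigStable k (m + 1) (fun d => sbDeg (k := k) i d) := by
  have := isRigStable_sbDeg (k := k) i 0
  simpa only [add_zero] using this

theorem sbInc_rb (i : Fin m) (x : Poly k (m + 1)) :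
    sbInc i (zeta k i * sbLeft k i x) = zeta k i.castSucc * sbLeft k i.castSucc (inc x) := by
  have := sbInc_left (k := k) i x (zeta k i)
  rw [mul_comm, this, sbInc_zeta, mul_comm]

variable [IsDomain k]

theorem isPolyExtComplex_pos (i : Fin m) : IsPolyExtComplex (posDegrees (k := k) i)
    (posDegrees i.castSucc) (fun p => posPowers p i) (fun p => posPowers p i.castSucc)
    (posExt i) where
  ext
    | .ofNat 0 => isPolyExt_ubInc
    | .ofNat (_ + 1) => isPolyExt_zero
    | .negSucc 0 => isPolyExt_sbInc i
    | .negSucc (_ + 1) => isPolyExt_zero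
  comm j x := by
    have h1 : (posComplex k i).d j (j + 1) = posD k i j := CochainComplex.of_d _ _ j
    have h2 : (posComplex k i.castSucc).d j (j + 1) = posD k i.castSucc j :=
      CochainComplex.of_d _ _ j
    rw [h1, h2]
    match j with
    | .ofNat _ => exact map_zero _
    | .negSucc 0 => exact (sbMulPoly_sbInc i (x : SB k i)).symm
    | .negSucc (_ + 1) => exact map_zero _
  graded
    | .ofNat 0 => isGradedExt_ubInc
    | .ofNat (_ + 1) => isGradedExt_zero _
    | .negSucc 0 => isGradedExt_sbInc' i
    | .negSucc (_ + 1) => isGradedExt_zero _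
  stable
    | .ofNat 0 => isRigStable_ubDeg
    | .ofNat (_ + 1) => fun _ _ _ _ _ _ => AddSubgroup.mem_top _
    | .negSucc 0 => isRigStable_sbDeg' i
    | .negSucc (_ + 1) => fun _ _ _ _ _ _ => AddSubgroup.mem_top _
  power p
    | .ofNat 0 => isPowerExt_ubInc p
    | .ofNat (_ + 1) => fun _ _ => rfl
    | .negSucc 0 => isPowerExt_sbInc i p
    | .negSucc (_ + 1) => fun _ _ => rfl

theorem isPolyExtComplex_neg (i : Fin m) : IsPolyExtComplex (negDegrees (k := k) i)
    (negDegrees i.castSucc) (fun p => negPowers p i) (fun p => negPowers p i.castSucc)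
    (negExt i) where
  ext
    | .ofNat 0 => isPolyExt_ubInc
    | .ofNat 1 => isPolyExt_sbInc i
    | .ofNat (_ + 2) => isPolyExt_zero
    | .negSucc _ => isPolyExt_zero
  comm j x := by
    have h1 : (negComplex k i).d j (j + 1) = negD k i j := CochainComplex.of_d _ _ j
    have h2 : (negComplex k i.castSucc).d j (j + 1) = negD k i.castSucc j :=
      CochainComplex.of_d _ _ j
    rw [h1, h2]
    match j with
    | .ofNat 0 => exact sbInc_rb i (x : Poly k (m + 1))
    | .ofNat (_ + 1) => exact map_zero _
    | .negSucc _ => exact map_zero _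
  graded
    | .ofNat 0 => isGradedExt_ubInc
    | .ofNat 1 => isGradedExt_sbInc i 2
    | .ofNat (_ + 2) => isGradedExt_zero _
    | .negSucc _ => isGradedExt_zero _
  stable
    | .ofNat 0 => isRigStable_ubDeg
    | .ofNat 1 => isRigStable_sbDeg i 2
    | .ofNat (_ + 2) => fun _ _ _ _ _ _ => AddSubgroup.mem_top _
    | .negSucc _ => fun _ _ _ _ _ _ => AddSubgroup.mem_top _
  power p
    | .ofNat 0 => isPowerExt_ubInc p
    | .ofNat 1 => isPowerExt_twist i p
    | .ofNat (_ + 2) => fun _ _ => rfl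
    | .negSucc _ => fun _ _ => rfl

/-- The complex of a word on one more strand is the polynomial extension of the complex of the
word. -/
theorem exists_isPolyExtComplex_word (w : BraidWord m) :
    ∃ ι, IsPolyExtComplex (wordDegrees k w) (wordDegrees k w.extend)
      (fun p => wordPowers k p w) (fun p => wordPowers k p w.extend) ι := by
  induction w with
  | nil => exact ⟨_, isPolyExtComplex_one⟩
  | cons l w ih =>
    obtain ⟨ι, H⟩ := ih
    match l with
    | (i, true) => exact ⟨_, isPolyExtComplex_tensor (isPolyExtComplex_pos i) H⟩
    | (i, false) => exact ⟨_, isPolyExtComplex_tensor (isPolyExtComplex_neg i) H⟩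

end Complexes

/-! ### Evaluation of the last variable -/

section Eval

variable {k : Type} [CommRing k] {m : ℕ}

variable (k m) in
/-- The difference `x - t` of the last two variables. -/
abbrev lastRoot : Poly k (m + 1 + 1) := root k (Fin.last m)

theorem lastRoot_eq : lastRoot k m = inc (lastX k m) - lastX k (m + 1) := by
  rw [MvPolynomial.rename_X]; rfl

variable {M E : Type} [AddCommGroup M] [Module (Env (Poly k (m + 1))) M] [AddCommGroup E]
  [Module (Env (Poly k (m + 1 + 1))) E] {ι : M →+ E}

theorem IsPolyExt.exists_eval (H : IsPolyExt k (m + 1) ι) : ∃ ρ : E →+ M, (∀ x, ρ (ι x) = x) ∧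
    ∀ e, ρ ((lef (lastX k (m + 1)) : Env (Poly k (m + 1 + 1))) • e) =
      (rig (lastX k m) : Env (Poly k (m + 1))) • ρ e :=
  H.exists_lift M (AddMonoidHom.id M)
    (DistribSMul.toAddMonoidHom M (rig (lastX k m) : Env (Poly k (m + 1))))

/-- The map `M[t] → M` that evaluates `t` at the right action of the last variable of the smaller
polynomial ring. -/
def IsPolyExt.eval (H : IsPolyExt k (m + 1) ι) : E →+ M := H.exists_eval.choose

theorem IsPolyExt.eval_ι (H : IsPolyExt k (m + 1) ι) (x : M) : H.eval (ι x) = x :=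
  H.exists_eval.choose_spec.1 x

theorem IsPolyExt.eval_lastX (H : IsPolyExt k (m + 1) ι) (e : E) :
    H.eval ((lef (lastX k (m + 1)) : Env (Poly k (m + 1 + 1))) • e) =
      (rig (lastX k m) : Env (Poly k (m + 1))) • H.eval e :=
  H.exists_eval.choose_spec.2 e

theorem IsPolyExt.eval_lef (H : IsPolyExt k (m + 1) ι) (r : Poly k (m + 1)) (e : E) :
    H.eval ((lef (inc r) : Env (Poly k (m + 1 + 1))) • e) =
      (lef r : Env (Poly k (m + 1))) • H.eval e := by
  refine DFunLike.congr_fun (f := H.eval.comp (DistribSMul.toAddMonoidHom E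
    (lef (inc r) : Env (Poly k (m + 1 + 1))))) (g := (DistribSMul.toAddMonoidHom M
    (lef r : Env (Poly k (m + 1)))).comp H.eval) ?_ e
  refine H.hom_ext (fun x => (rig (lastX k m) : Env (Poly k (m + 1))) • x) (fun x => ?_)
    (fun e => ?_) (fun e => ?_)
  · change H.eval ((lef (inc r) : Env (Poly k (m + 1 + 1))) • ι x) =
      (lef r : Env (Poly k (m + 1))) • H.eval (ι x)
    rw [← H.lef_smul, H.eval_ι, H.eval_ι]
  · change H.eval ((lef (inc r) : Env (Poly k (m + 1 + 1))) •
      (lef (lastX k (m + 1)) : Env (Poly k (m + 1 + 1))) • e) = _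
    rw [smul_comm, H.eval_lastX]; rfl
  · change (lef r : Env (Poly k (m + 1))) •
      H.eval ((lef (lastX k (m + 1)) : Env (Poly k (m + 1 + 1))) • e) = _
    rw [H.eval_lastX, smul_comm]; rfl

theorem IsPolyExt.eval_rig (H : IsPolyExt k (m + 1) ι) (r : Poly k (m + 1)) (e : E) :
    H.eval ((rig (inc r) : Env (Poly k (m + 1 + 1))) • e) =
      (rig r : Env (Poly k (m + 1))) • H.eval e := by
  refine DFunLike.congr_fun (f := H.eval.comp (DistribSMul.toAddMonoidHom E
    (rig (inc r) : Env (Poly k (m + 1 + 1))))) (g := (DistribSMul.toAddMonoidHom M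
    (rig r : Env (Poly k (m + 1)))).comp H.eval) ?_ e
  refine H.hom_ext (fun x => (rig (lastX k m) : Env (Poly k (m + 1))) • x) (fun x => ?_)
    (fun e => ?_) (fun e => ?_)
  · change H.eval ((rig (inc r) : Env (Poly k (m + 1 + 1))) • ι x) =
      (rig r : Env (Poly k (m + 1))) • H.eval (ι x)
    rw [← H.rig_smul, H.eval_ι, H.eval_ι]
  · change H.eval ((rig (inc r) : Env (Poly k (m + 1 + 1))) •
      (lef (lastX k (m + 1)) : Env (Poly k (m + 1 + 1))) • e) = _
    rw [smul_comm, H.eval_lastX]; rfl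
  · change (rig r : Env (Poly k (m + 1))) •
      H.eval ((lef (lastX k (m + 1)) : Env (Poly k (m + 1 + 1))) • e) = _
    rw [H.eval_lastX, smul_comm]; rfl

theorem IsPolyExt.eval_rig_lastX (H : IsPolyExt k (m + 1) ι) (e : E) :
    H.eval ((rig (lastX k (m + 1)) : Env (Poly k (m + 1 + 1))) • e) =
      (rig (lastX k m) : Env (Poly k (m + 1))) • H.eval e := by
  rw [← H.central, H.eval_lastX]

theorem IsPolyExt.eval_lastRoot (H : IsPolyExt k (m + 1) ι) (e : E) :
    H.eval ((rig (lastRoot k m) : Env (Poly k (m + 1 + 1))) • e) = 0 := by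
  rw [lastRoot_eq, map_sub, sub_smul, map_sub, H.eval_rig, H.eval_rig_lastX, sub_self]

/-- The kernel of the evaluation consists of the multiples of `x - t`. -/
theorem IsPolyExt.exists_eq_lastRoot_smul (H : IsPolyExt k (m + 1) ι) {e : E} (he : H.eval e = 0) :
    ∃ u : E, (rig (lastRoot k m) : Env (Poly k (m + 1 + 1))) • u = e := by
  let S : AddSubgroup E :=
    { carrier := {e | ∃ u : E, (rig (lastRoot k m) : Env (Poly k (m + 1 + 1))) • u =
        e - ι (H.eval e)}
      zero_mem' := ⟨0, by rw [smul_zero, map_zero, map_zero, sub_zero]⟩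
      add_mem' := by
        rintro a b ⟨u, hu⟩ ⟨v, hv⟩
        exact ⟨u + v, by rw [smul_add, hu, hv, map_add, map_add]; abel⟩
      neg_mem' := by
        rintro a ⟨u, hu⟩
        exact ⟨-u, by rw [smul_neg, hu, map_neg, map_neg]; abel⟩ }
  have hS : S = ⊤ := by
    refine H.generate S (fun x => ⟨0, by rw [smul_zero, H.eval_ι, sub_self]⟩) ?_
    rintro e ⟨u, hu⟩
    -- `t e - x ρ(e) = t (e - ρ(e)) - (x - t) ρ(e)`
    refine ⟨(lef (lastX k (m + 1)) : Env (Poly k (m + 1 + 1))) • u - ι (H.eval e), ?_⟩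
    rw [smul_sub, smul_comm, hu, H.eval_lastX, H.rig_smul, lastRoot_eq, map_sub, sub_smul, smul_sub,
      ← H.central]
    abel
  obtain ⟨u, hu⟩ : e ∈ S := hS ▸ AddSubgroup.mem_top e
  exact ⟨u, by rw [hu, he, map_zero, sub_zero]⟩

theorem IsPolyExt.lastRoot_smul_injective (H : IsPolyExt k (m + 1) ι) {e : E}
    (he : (rig (lastRoot k m) : Env (Poly k (m + 1 + 1))) • e = 0) : e = 0 := by
  -- The division `σ` of `e - ρ(e)` by `x - t` satisfies `σ(t e) = t σ(e) - ρ(e)`, so that the pair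
  -- `(σ, ρ)` is provided by the universal property.
  let T : E × M →+ E × M :=
    AddMonoidHom.prod
      ((DistribSMul.toAddMonoidHom E (lef (lastX k (m + 1)) : Env (Poly k (m + 1 + 1)))).comp
        (AddMonoidHom.fst E M) - ι.comp (AddMonoidHom.snd E M))
      ((DistribSMul.toAddMonoidHom M (rig (lastX k m) : Env (Poly k (m + 1)))).comp
        (AddMonoidHom.snd E M))
  obtain ⟨g, h1, h2⟩ := H.exists_lift (E × M) (AddMonoidHom.inr E M) T
  have hρ : (AddMonoidHom.snd E M).comp g = H.eval :=
    H.hom_ext (fun x => (rig (lastX k m) : Env (Poly k (m + 1))) • x)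
      (fun x => by rw [H.eval_ι]; exact congrArg Prod.snd (h1 x))
      (fun e => congrArg Prod.snd (h2 e)) H.eval_lastX
  have hσ : ∀ e, (g ((lef (lastX k (m + 1)) : Env (Poly k (m + 1 + 1))) • e)).1 =
      (lef (lastX k (m + 1)) : Env (Poly k (m + 1 + 1))) • (g e).1 - ι (H.eval e) := fun e => by
    rw [← hρ, h2]; rfl
  have hx : ∀ e, g ((rig (inc (lastX k m)) : Env (Poly k (m + 1 + 1))) • e) =
      ((rig (inc (lastX k m)) : Env (Poly k (m + 1 + 1))) • (g e).1,
        (rig (lastX k m) : Env (Poly k (m + 1))) • (g e).2) := by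
    intro e
    let X : E × M →+ E × M := AddMonoidHom.prodMap
      (DistribSMul.toAddMonoidHom E (rig (inc (lastX k m)) : Env (Poly k (m + 1 + 1))))
      (DistribSMul.toAddMonoidHom M (rig (lastX k m) : Env (Poly k (m + 1))))
    have hXT : ∀ y, X (T y) = T (X y) := by
      rintro ⟨u, v⟩
      refine Prod.ext ?_ rfl
      change (rig (inc (lastX k m)) : Env (Poly k (m + 1 + 1))) •
        ((lef (lastX k (m + 1)) : Env (Poly k (m + 1 + 1))) • u - ι v) =
        (lef (lastX k (m + 1)) : Env (Poly k (m + 1 + 1))) •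
          (rig (inc (lastX k m)) : Env (Poly k (m + 1 + 1))) • u -
          ι ((rig (lastX k m) : Env (Poly k (m + 1))) • v)
      rw [smul_sub, smul_comm, H.rig_smul]
    refine DFunLike.congr_fun (f := g.comp (DistribSMul.toAddMonoidHom E
      (rig (inc (lastX k m)) : Env (Poly k (m + 1 + 1))))) (g := X.comp g) ?_ e
    refine H.hom_ext T (fun x => ?_) (fun e => ?_) (fun e => ?_)
    · change g ((rig (inc (lastX k m)) : Env (Poly k (m + 1 + 1))) • ι x) = X (g (ι x))
      rw [← H.rig_smul, h1, h1]
      exact Prod.ext (smul_zero _).symm rfl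
    · change g ((rig (inc (lastX k m)) : Env (Poly k (m + 1 + 1))) •
        (lef (lastX k (m + 1)) : Env (Poly k (m + 1 + 1))) • e) = _
      rw [smul_comm, h2]; rfl
    · change X (g _) = T (X (g e))
      rw [h2, hXT]
  have hdiv : ∀ e, (g ((rig (lastRoot k m) : Env (Poly k (m + 1 + 1))) • e)).1 = e := by
    intro e
    refine DFunLike.congr_fun (f := (AddMonoidHom.fst E M).comp (g.comp
      (DistribSMul.toAddMonoidHom E (rig (lastRoot k m) : Env (Poly k (m + 1 + 1))))))
      (g := AddMonoidHom.id E) ?_ e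
    have key : ∀ e, (g ((rig (lastRoot k m) : Env (Poly k (m + 1 + 1))) • e)).1 =
        (rig (inc (lastX k m)) : Env (Poly k (m + 1 + 1))) • (g e).1 -
          ((lef (lastX k (m + 1)) : Env (Poly k (m + 1 + 1))) • (g e).1 - ι (H.eval e)) := by
      intro e
      rw [lastRoot_eq, map_sub, sub_smul, map_sub, ← H.central, Prod.fst_sub, hσ, hx]
    refine H.hom_ext (fun e => (lef (lastX k (m + 1)) : Env (Poly k (m + 1 + 1))) • e) (fun x => ?_)
      (fun e => ?_) (fun e => rfl)
    · refine (key (ι x)).trans ?_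
      rw [h1, H.eval_ι]
      change (rig (inc (lastX k m)) : Env (Poly k (m + 1 + 1))) • (0 : E) -
        ((lef (lastX k (m + 1)) : Env (Poly k (m + 1 + 1))) • (0 : E) - ι x) = ι x
      rw [smul_zero, smul_zero, zero_sub, zero_sub, neg_neg]
    · change (g ((rig (lastRoot k m) : Env (Poly k (m + 1 + 1))) •
        (lef (lastX k (m + 1)) : Env (Poly k (m + 1 + 1))) • e)).1 =
        (lef (lastX k (m + 1)) : Env (Poly k (m + 1 + 1))) •
          (g ((rig (lastRoot k m) : Env (Poly k (m + 1 + 1))) • e)).1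
      rw [smul_comm, hσ, H.eval_lastRoot, map_zero, sub_zero]
  rw [← hdiv e, he, map_zero]; rfl

theorem IsPolyExt.eval_natural (H : IsPolyExt k (m + 1) ι) {M' E' : Type} [AddCommGroup M']
    [Module (Env (Poly k (m + 1))) M'] [AddCommGroup E'] [Module (Env (Poly k (m + 1 + 1))) E']
    {ι' : M' →+ E'} (H' : IsPolyExt k (m + 1) ι') (f : M →ₗ[Env (Poly k (m + 1))] M')
    (g : E →ₗ[Env (Poly k (m + 1 + 1))] E') (h : ∀ x, ι' (f x) = g (ι x)) (e : E) :
    H'.eval (g e) = f (H.eval e) := by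
  refine DFunLike.congr_fun (f := H'.eval.comp g.toAddMonoidHom)
    (g := f.toAddMonoidHom.comp H.eval) ?_ e
  refine H.hom_ext (fun x => (rig (lastX k m) : Env (Poly k (m + 1))) • x) (fun x => ?_)
    (fun e => ?_) (fun e => ?_)
  · change H'.eval (g (ι x)) = f (H.eval (ι x))
    rw [← h, H.eval_ι, H'.eval_ι]
  · change H'.eval (g ((lef (lastX k (m + 1)) : Env (Poly k (m + 1 + 1))) • e)) = _
    rw [map_smul, H'.eval_lastX]; rfl
  · change f (H.eval ((lef (lastX k (m + 1)) : Env (Poly k (m + 1 + 1))) • e)) = _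
    rw [H.eval_lastX, map_smul]; rfl

theorem IsPolyExt.eval_lef_pow (H : IsPolyExt k (m + 1) ι) (i : ℕ) (e : E) :
    H.eval ((lef (lastX k (m + 1) ^ i) : Env (Poly k (m + 1 + 1))) • e) =
      (rig (lastX k m ^ i) : Env (Poly k (m + 1))) • H.eval e := by
  induction i with
  | zero => rw [pow_zero, pow_zero, map_one, map_one, one_smul, one_smul]
  | succ i ih => rw [pow_succ', map_mul, mul_smul, H.eval_lastX, ih, pow_succ', map_mul, mul_smul]

theorem lastX_pow_mem_polyDeg (i : ℕ) : lastX k m ^ i ∈ polyDeg (k := k) (2 * i) :=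
  AddSubgroup.mem_iSup_of_mem i (AddSubgroup.mem_iSup_of_mem rfl
    (by simpa using (MvPolynomial.isHomogeneous_X k (Fin.last m)).pow i))

theorem IsPolyExt.eval_mem (H : IsPolyExt k (m + 1) ι) {gM : ℤ → AddSubgroup M}
    {gE : ℤ → AddSubgroup E} (h : IsGradedExt k (m + 1) gM gE ι) (hs : IsRigStable k (m + 1) gM)
    {d : ℤ} {e : E} (he : e ∈ gE d) : H.eval e ∈ gM d := by
  refine (AddSubgroup.closure_le ((gM d).comap H.eval)).2 ?_ (h d he)
  rintro _ ⟨i, x, hx, rfl⟩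
  change H.eval _ ∈ gM d
  rw [H.eval_lef_pow, H.eval_ι]
  have := hs _ _ _ (lastX_pow_mem_polyDeg i) x hx
  rwa [sub_add_cancel] at this

/-- The evaluation of a product of homogeneous elements is homogeneous. -/
theorem IsPolyExt.eval_rig_mem (H : IsPolyExt k (m + 1) ι) {gM : ℤ → AddSubgroup M}
    {gE : ℤ → AddSubgroup E} (h : IsGradedExt k (m + 1) gM gE ι) (hs : IsRigStable k (m + 1) gM)
    {d d' : ℤ} {e : E} (he : e ∈ gE d) {f : Poly k (m + 1 + 1)} (hf : f ∈ polyDeg (k := k) d') :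
    H.eval ((rig f : Env (Poly k (m + 1 + 1))) • e) ∈ gM (d + d') := by
  let φ : Poly k (m + 1 + 1) →+ M := AddMonoidHom.mk'
    (fun f => H.eval ((rig f : Env (Poly k (m + 1 + 1))) • e))
    (fun f g => by rw [map_add, add_smul, map_add])
  refine (AddSubgroup.closure_le ((gM (d + d')).comap φ)).2 ?_ (polyDeg_le d' hf)
  rintro _ ⟨i, g, hg, rfl⟩
  change H.eval _ ∈ gM (d + d')
  have hpow : ∀ i : ℕ, ∀ e : E, H.eval ((rig (lastX k (m + 1) ^ i) : Env (Poly k (m + 1 + 1))) • e) =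
      (rig (lastX k m ^ i) : Env (Poly k (m + 1))) • H.eval e := by
    intro i e
    induction i with
    | zero => rw [pow_zero, pow_zero, map_one, map_one, one_smul, one_smul]
    | succ i ih =>
      rw [pow_succ', map_mul, mul_smul, H.eval_rig_lastX, ih, pow_succ', map_mul, mul_smul]
  rw [map_mul, mul_smul, hpow, H.eval_rig]
  have h1 := hs _ _ g hg _ (H.eval_mem h hs he)
  have h2 := hs _ _ _ (lastX_pow_mem_polyDeg i) _ h1
  rwa [add_assoc, sub_add_cancel] at h2

theorem conv_powT_X {n p : ℕ} {M : Type} [AddCommGroup M] [Module (Env (Poly k n)) M] (a : Fin n)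
    (φ : Poly k n →+* Env (Poly k n)) (s : ℕ → M) (c : ℕ) :
    conv (PowerSeries.map φ (powT p (MvPolynomial.X a))) s c = φ (MvPolynomial.X a) • s c +
      conv (PowerSeries.X * PowerSeries.C (φ (MvPolynomial.X a) ^ p)) s c := by
  rw [powT_X, map_add, map_mul, PowerSeries.map_C, PowerSeries.map_C, PowerSeries.map_X, map_pow]
  rw [← conv_C, conv, conv, conv, ← Finset.sum_add_distrib]
  exact Finset.sum_congr rfl fun ab _ => by rw [map_add, add_smul]

theorem conv_X_mul_zero {A M : Type} [CommRing A] [AddCommGroup M] [Module A M] (g : PowerSeries A)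
    (s : ℕ → M) : conv (PowerSeries.X * g) s 0 = 0 := by
  simp [conv]

theorem conv_X_mul_C_succ {A M : Type} [CommRing A] [AddCommGroup M] [Module A M] (a : A)
    (s : ℕ → M) (c : ℕ) : conv (PowerSeries.X * PowerSeries.C a) s (c + 1) = a • s c := by
  rw [← conv_C a s c, conv, conv, Finset.Nat.sum_antidiagonal_succ]
  simp only [PowerSeries.coeff_zero_X_mul, zero_smul, zero_add, PowerSeries.coeff_succ_X_mul]

/-- The evaluation commutes with the reduced powers. -/
theorem IsPolyExt.eval_power (H : IsPolyExt k (m + 1) ι) {p : ℕ} {oM : PowerOps k (m + 1) p M}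
    {oE : PowerOps k (m + 1 + 1) p E} (h : IsPowerExt oM oE ι) (e : E) (c : ℕ) :
    H.eval (oE.P e c) = oM.P (H.eval e) c := by
  let P₁ : E →+ (ℕ → M) := (AddMonoidHom.compLeft H.eval ℕ).comp oE.P
  have hpow : ∀ i : ℕ, ∀ e : E, H.eval ((lef (lastX k (m + 1)) ^ i : Env (Poly k (m + 1 + 1))) • e) =
      (rig (lastX k m) ^ i : Env (Poly k (m + 1))) • H.eval e := fun i e => by
    rw [← map_pow, H.eval_lef_pow, map_pow]
  have key : P₁ = oM.P.comp H.eval := by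
    refine H.hom_ext (conv (PowerSeries.map (rig : Poly k (m + 1) →+* Env (Poly k (m + 1)))
      (powT p (lastX k m)))) (fun x => ?_) (fun e => ?_) (fun e => ?_)
    · funext c
      change H.eval (oE.P (ι x) c) = oM.P (H.eval (ι x)) c
      rw [h, H.eval_ι, H.eval_ι]
    · funext c
      change H.eval (oE.P _ c) = _
      rw [oE.cartan_left, conv_powT_X, conv_powT_X, map_add, H.eval_lastX]
      congr 1
      cases c with
      | zero => rw [conv_X_mul_zero, conv_X_mul_zero, map_zero]
      | succ c => rw [conv_X_mul_C_succ, conv_X_mul_C_succ, hpow]; rfl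
    · change oM.P (H.eval _) = conv _ (oM.P (H.eval e))
      rw [H.eval_lastX, oM.cartan_right]
  exact congrFun (DFunLike.congr_fun key e) c

end Eval

/-! ### The bimodule `E ⊗ B` -/

section TensorB

variable {k : Type} [CommRing k]

/-- An element of the bimodule `R` as a polynomial. -/
def ofUB {n : ℕ} : UB k n →+* Poly k n := RingHom.id _

theorem toUB_ofUB {n : ℕ} (r : UB k n) : toUB (ofUB r) = r := rfl

theorem ofUB_lef_smul {n : ℕ} (r : Poly k n) (x : UB k n) :
    ofUB ((lef r : Env (Poly k n)) • x) = r * ofUB x := congrArg ofUB (ub_lef_smul r x)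

theorem ofUB_rig_smul {n : ℕ} (r : Poly k n) (x : UB k n) :
    ofUB ((rig r : Env (Poly k n)) • x) = r * ofUB x := congrArg ofUB (ub_rig_smul r x)

/-- For a map of bimodules `f : N → R`, the map `E ⊗ N → E`, `e ⊗ x ↦ e f(x)`. -/
def mulBy {n : ℕ} (E : Type) {N : Type} [AddCommGroup E] [Module (Env (Poly k n)) E] [AddCommGroup N]
    [Module (Env (Poly k n)) N] (f : N →ₗ[Env (Poly k n)] UB k n) :
    BTensor (Poly k n) E N →ₗ[Env (Poly k n)] E :=
  let φ : BTensor (Poly k n) E N →+ E :=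
    BTensor.lift (AddMonoidHom.mk' (fun e => AddMonoidHom.mk'
      (fun x => (rig (ofUB (f x)) : Env (Poly k n)) • e)
      (fun x y => by rw [map_add, map_add, map_add, add_smul]))
      (fun e e' => AddMonoidHom.ext fun x => smul_add _ _ _))
      (fun r e x => by
        change (rig (ofUB (f x)) : Env (Poly k n)) • (rig r : Env (Poly k n)) • e =
          (rig (ofUB (f ((lef r : Env (Poly k n)) • x))) : Env (Poly k n)) • e
        rw [map_smul, ofUB_lef_smul, smul_comm, map_mul, mul_smul])
  { φ with
    map_smul' := env_smul_hom φ
      (fun r z => by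
        induction z using BTensor.induction with
        | zero => rw [smul_zero, map_zero, smul_zero]
        | add x y hx hy => rw [smul_add, map_add, map_add, smul_add, hx, hy]
        | tmul e x =>
          rw [BTensor.lef_smul]
          change (rig (ofUB (f x)) : Env (Poly k n)) • (lef r : Env (Poly k n)) • e =
            (lef r : Env (Poly k n)) • (rig (ofUB (f x)) : Env (Poly k n)) • e
          rw [smul_comm])
      (fun r z => by
        induction z using BTensor.induction with
        | zero => rw [smul_zero, map_zero, smul_zero]
        | add x y hx hy => rw [smul_add, map_add, map_add, smul_add, hx, hy]
        | tmul e x =>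
          rw [BTensor.rig_smul]
          change (rig (ofUB (f ((rig r : Env (Poly k n)) • x))) : Env (Poly k n)) • e =
            (rig r : Env (Poly k n)) • (rig (ofUB (f x)) : Env (Poly k n)) • e
          rw [map_smul, ofUB_rig_smul, map_mul, mul_smul]) }

theorem mulBy_tmul {n : ℕ} {E N : Type} [AddCommGroup E] [Module (Env (Poly k n)) E]
    [AddCommGroup N] [Module (Env (Poly k n)) N] (f : N →ₗ[Env (Poly k n)] UB k n) (e : E) (x : N) :
    mulBy E f (BTensor.tmul e x) = (rig (ofUB (f x)) : Env (Poly k n)) • e := rfl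

variable (k) in
/-- The isomorphism `E → E ⊗ R`. -/
def tensorOne (n : ℕ) (E : Type) [AddCommGroup E] [Module (Env (Poly k n)) E] :
    E →ₗ[Env (Poly k n)] BTensor (Poly k n) E (UB k n) :=
  let φ : E →+ BTensor (Poly k n) E (UB k n) :=
    (BTensor.mk (Poly k n) E (UB k n)).flip (toUB 1)
  { φ with
    map_smul' := env_smul_hom φ (fun r e => (BTensor.lef_smul r e (toUB 1)).symm) (fun r e => by
      change BTensor.tmul _ _ = (rig r : Env (Poly k n)) • BTensor.tmul e (toUB 1)
      rw [BTensor.balanced, BTensor.rig_smul, ub_lef_smul, ub_rig_smul]) }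

theorem mulBy_tensorOne {n : ℕ} {E : Type} [AddCommGroup E] [Module (Env (Poly k n)) E] (e : E) :
    mulBy E (LinearMap.id : UB k n →ₗ[Env (Poly k n)] UB k n) (tensorOne k n E e) = e := by
  change (rig (1 : Poly k n) : Env (Poly k n)) • e = e
  rw [map_one, one_smul]

theorem tensorOne_mulBy {n : ℕ} {E : Type} [AddCommGroup E] [Module (Env (Poly k n)) E]
    (z : BTensor (Poly k n) E (UB k n)) :
    tensorOne k n E (mulBy E (LinearMap.id : UB k n →ₗ[Env (Poly k n)] UB k n) z) = z := by
  induction z using BTensor.induction with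
  | zero => rw [map_zero, map_zero]
  | add x y hx hy => rw [map_add, map_add, hx, hy]
  | tmul e x =>
    change BTensor.tmul ((rig (ofUB x) : Env (Poly k n)) • e) (toUB 1) = _
    rw [BTensor.balanced, ub_lef_smul, mul_one, toUB_ofUB]

variable {m : ℕ}

section

variable (k) (E : Type) [AddCommGroup E] [Module (Env (Poly k (m + 1))) E] (i : Fin m)

/-- The map `E ⊗ B_i → E`, `e ⊗ b ↦ e br(b)`. -/
def brE : BTensor (Poly k (m + 1)) E (SB k i) →ₗ[Env (Poly k (m + 1))] E := mulBy E (br k i)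

/-- The map `E → E ⊗ B_i`, `e ↦ e ⊗ ζ_i`. -/
def rbE : E →ₗ[Env (Poly k (m + 1))] BTensor (Poly k (m + 1)) E (SB k i) :=
  BTensor.map LinearMap.id (rb k i) ∘ₗ tensorOne k (m + 1) E

/-- The map `E → E ⊗ B_i`, `e ↦ e ⊗ 1`; it is linear for the left action only. -/
def secE : E →+ BTensor (Poly k (m + 1)) E (SB k i) :=
  (BTensor.mk (Poly k (m + 1)) E (SB k i)).flip 1

variable {k E}

theorem brE_tmul (e : E) (b : SB k i) :
    brE k E i (BTensor.tmul e b) = (rig (sbMulPoly k i b) : Env (Poly k (m + 1))) • e := rfl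

theorem brE_secE (e : E) : brE k E i (secE k E i e) = e := by
  change (rig (sbMulPoly k i 1) : Env (Poly k (m + 1))) • e = e
  rw [map_one, map_one, one_smul]

theorem rbE_apply (e : E) : rbE k E i e = BTensor.tmul e (zeta k i) := by
  change BTensor.tmul e (zeta k i * sbLeft k i 1) = _
  rw [map_one, mul_one]

theorem brE_rbE (e : E) : brE k E i (rbE k E i e) = (rig (root k i) : Env (Poly k (m + 1))) • e := by
  rw [rbE_apply, brE_tmul, zeta_eq, map_sub, sbMulPoly_left, sbMulPoly_right, root]

theorem tmul_sbLeft_mul (r : Poly k (m + 1)) (e : E) (b : SB k i) :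
    (BTensor.tmul e (sbLeft k i r * b) : BTensor (Poly k (m + 1)) E (SB k i)) =
      BTensor.tmul ((rig r : Env (Poly k (m + 1))) • e) b := by
  rw [BTensor.balanced, sb_smul, sbOfEnv_lef]

theorem tmul_sbRight_mul (r : Poly k (m + 1)) (e : E) (b : SB k i) :
    (BTensor.tmul e (sbRight k i r * b) : BTensor (Poly k (m + 1)) E (SB k i)) =
      (rig r : Env (Poly k (m + 1))) • BTensor.tmul e b := by
  rw [BTensor.rig_smul, sb_smul, sbOfEnv_rig]

variable [IsDomain k]

variable (k E) in
/-- The second coordinate of an element of `E ⊗ B_i` with respect to the decomposition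
`E ⊗ 1 ⊕ E ⊗ (1 ⊗ x_i - x_i ⊗ 1)`. The first coordinate is the map `E ⊗ B_i → E`. -/
def coordE : BTensor (Poly k (m + 1)) E (SB k i) →+ E :=
  BTensor.lift (AddMonoidHom.mk' (fun e => AddMonoidHom.mk'
      (fun b => (rig (sbCoord k i b) : Env (Poly k (m + 1))) • e)
      (fun x y => by rw [map_add, map_add, add_smul]))
      (fun e e' => AddMonoidHom.ext fun x => smul_add _ _ _))
    (fun r e b => by
      change (rig (sbCoord k i b) : Env (Poly k (m + 1))) • (rig r : Env (Poly k (m + 1))) • e =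
        (rig (sbCoord k i _) : Env (Poly k (m + 1))) • e
      rw [sb_smul, sbOfEnv_lef, sbCoord_left, map_mul, ← mul_smul, mul_comm])

theorem coordE_tmul (e : E) (b : SB k i) :
    coordE k E i (BTensor.tmul e b) = (rig (sbCoord k i b) : Env (Poly k (m + 1))) • e := rfl

theorem coordE_lef (r : Poly k (m + 1)) (z : BTensor (Poly k (m + 1)) E (SB k i)) :
    coordE k E i ((lef r : Env (Poly k (m + 1))) • z) =
      (lef r : Env (Poly k (m + 1))) • coordE k E i z := by
  induction z using BTensor.induction with
  | zero => rw [smul_zero, map_zero, smul_zero]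
  | add x y hx hy => rw [smul_add, map_add, map_add, smul_add, hx, hy]
  | tmul e b => rw [BTensor.lef_smul, coordE_tmul, coordE_tmul, smul_comm]

theorem coordE_rig (r : Poly k (m + 1)) (z : BTensor (Poly k (m + 1)) E (SB k i)) :
    coordE k E i ((rig r : Env (Poly k (m + 1))) • z) =
      (rig (swapVars k i r) : Env (Poly k (m + 1))) • coordE k E i z +
      (rig (divDiff k i r) : Env (Poly k (m + 1))) • brE k E i z := by
  induction z using BTensor.induction with
  | zero => simp only [smul_zero, map_zero, add_zero]
  | add x y hx hy => rw [smul_add, map_add, map_add, map_add, smul_add, smul_add, hx, hy]; abel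
  | tmul e b =>
    rw [BTensor.rig_smul, coordE_tmul, coordE_tmul, brE_tmul, sb_smul, sbOfEnv_rig, sbCoord_right,
      map_add, add_smul, map_mul, map_mul, mul_smul, mul_smul]

theorem coordE_rbE (e : E) : coordE k E i (rbE k E i e) = e := by
  have h1 := sbCoord_left k i (MvPolynomial.X i.castSucc) 1
  have h2 := sbCoord_right k i (MvPolynomial.X i.succ) 1
  rw [mul_one, sbCoord_one, mul_zero] at h1
  rw [mul_one, sbCoord_one, mul_zero, divDiff_succ, map_one, zero_add, mul_one] at h2
  rw [rbE_apply, coordE_tmul, zeta_eq, map_sub, h1, h2, zero_sub, neg_neg, map_one, one_smul]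

end

/-! ### The case of the last generator -/

section Last

variable {E : Type} [AddCommGroup E] [Module (Env (Poly k (m + 1 + 1))) E]

variable (k m) in
/-- The element `t ⊗ 1 - 1 ⊗ t` of the enveloping ring, for the last variable `t`. -/
abbrev lastW : Env (Poly k (m + 1 + 1)) := wEnv k (m + 1 + 1) (Fin.last (m + 1))

variable (k m E) in
/-- The last variable is central in `E`. -/
def IsLastCentral : Prop := ∀ e : E, (lef (lastX k (m + 1)) : Env (Poly k (m + 1 + 1))) • e =
    (rig (lastX k (m + 1)) : Env (Poly k (m + 1 + 1))) • e

theorem lastW_smul_eq_zero (hE : IsLastCentral k m E) (e : E) : lastW k m • e = 0 := by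
  rw [lastW, wEnv, sub_smul, sub_eq_zero]
  exact hE e

theorem lastW_smul_tmul (hE : IsLastCentral k m E) (e : E) (b : SB k (Fin.last m)) :
    (lastW k m • BTensor.tmul e b : BTensor (Poly k (m + 1 + 1)) E (SB k (Fin.last m))) =
      BTensor.tmul e (sbW k (Fin.last m) * b) := by
  have h := sbLeft_add_eq k (Fin.last m)
  rw [Fin.succ_last] at h
  have h1 : sbW k (Fin.last m) = sbLeft k (Fin.last m) (lastX k (m + 1)) -
      sbRight k (Fin.last m) (lastX k (m + 1)) := by
    rw [sbW]
    linear_combination -h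
  rw [h1, sub_mul, lastW, wEnv, sub_smul, BTensor.lef_smul, hE, ← tmul_sbLeft_mul,
    ← tmul_sbRight_mul]
  exact (map_sub (BTensor.mk (Poly k (m + 1 + 1)) E (SB k (Fin.last m)) e) _ _).symm

theorem lef_smul_secE (r : Poly k (m + 1 + 1)) (e : E) :
    (lef r : Env (Poly k (m + 1 + 1))) • secE k E (Fin.last m) e =
      secE k E (Fin.last m) ((lef r : Env (Poly k (m + 1 + 1))) • e) :=
  BTensor.lef_smul r e 1

variable [IsDomain k]

/-- The decomposition of `E ⊗ B` into two copies of `E`. -/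
theorem eq_secE_add (hE : IsLastCentral k m E)
    (z : BTensor (Poly k (m + 1 + 1)) E (SB k (Fin.last m))) :
    z = secE k E (Fin.last m) (brE k E (Fin.last m) z) +
      lastW k m • secE k E (Fin.last m) (coordE k E (Fin.last m) z) := by
  induction z using BTensor.induction with
  | zero => simp only [map_zero, smul_zero, add_zero]
  | add x y hx hy =>
    rw [map_add, map_add, map_add, map_add, smul_add]
    nth_rewrite 1 [hx, hy]
    abel
  | tmul e b =>
    change _ = BTensor.tmul _ 1 + lastW k m • BTensor.tmul _ 1
    rw [lastW_smul_tmul hE, brE_tmul, coordE_tmul, ← tmul_sbLeft_mul, ← tmul_sbLeft_mul, mul_one,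
      mul_one, ← BTensor.tmul_add]
    congr 1
    exact sb_eq_coords k (Fin.last m) b

theorem exists_lastW_smul_of_brE_eq_zero (hE : IsLastCentral k m E)
    {z : BTensor (Poly k (m + 1 + 1)) E (SB k (Fin.last m))} (hz : brE k E (Fin.last m) z = 0) :
    ∃ u, lastW k m • u = z := by
  have h := eq_secE_add hE z
  rw [hz, map_zero, zero_add] at h
  exact ⟨_, h.symm⟩

theorem coordE_lastW (hE : IsLastCentral k m E)
    (z : BTensor (Poly k (m + 1 + 1)) E (SB k (Fin.last m))) :
    coordE k E (Fin.last m) (lastW k m • z) = brE k E (Fin.last m) z -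
      (rig (lastRoot k m) : Env (Poly k (m + 1 + 1))) • coordE k E (Fin.last m) z := by
  have h1 : swapVars k (Fin.last m) (lastX k (m + 1)) = MvPolynomial.X (Fin.last m).castSucc :=
    swapVars_succ k (Fin.last m)
  have h2 : divDiff k (Fin.last m) (lastX k (m + 1)) = -1 := divDiff_succ k (Fin.last m)
  rw [lastW, wEnv, sub_smul, map_sub, coordE_lef, coordE_rig, h1, h2, hE, lastRoot, root, map_sub,
    sub_smul, map_neg, map_one, neg_smul, one_smul, Fin.succ_last]
  abel

theorem exists_rbE_of_lastW_smul_eq_zero (hE : IsLastCentral k m E)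
    {z : BTensor (Poly k (m + 1 + 1)) E (SB k (Fin.last m))} (hz : lastW k m • z = 0) :
    ∃ u, rbE k E (Fin.last m) u = z := by
  refine ⟨coordE k E (Fin.last m) z, ?_⟩
  have h := coordE_lastW hE z
  rw [hz, map_zero, eq_comm, sub_eq_zero] at h
  rw [eq_secE_add hE (rbE k E (Fin.last m) _), brE_rbE, coordE_rbE, ← h]
  exact (eq_secE_add hE z).symm

theorem rbE_injective {e : E} (he : rbE k E (Fin.last m) e = 0) : e = 0 := by
  rw [← coordE_rbE (k := k) (Fin.last m) e, he, map_zero]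

theorem rig_smul_secE (hE : IsLastCentral k m E) (r : Poly k (m + 1 + 1)) (e : E) :
    (rig r : Env (Poly k (m + 1 + 1))) • secE k E (Fin.last m) e =
      secE k E (Fin.last m) ((rig r : Env (Poly k (m + 1 + 1))) • e) +
      lastW k m • secE k E (Fin.last m)
        ((rig (divDiff k (Fin.last m) r) : Env (Poly k (m + 1 + 1))) • e) := by
  change (rig r : Env (Poly k (m + 1 + 1))) • BTensor.tmul e 1 = BTensor.tmul _ 1 +
    lastW k m • BTensor.tmul _ 1
  rw [lastW_smul_tmul hE, ← tmul_sbRight_mul, ← tmul_sbLeft_mul, ← tmul_sbLeft_mul, mul_one, mul_one,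
    mul_one, ← BTensor.tmul_add, sbRight_eq]

end Last

end TensorB

/-! ### Koszul complexes of commuting endomorphisms -/

section TotalKoszul

variable {n : ℕ} {M N : Type} [AddCommGroup M] [AddCommGroup N]

/-- The Koszul differential of a family of endomorphisms, on chains of all degrees at once: a chain
`f` stands for `∑_S f(S) λ_S`. -/
def koszul (w : Fin n → M →+ M) : (Finset (Fin n) → M) →+ (Finset (Fin n) → M) where
  toFun f T := ∑ a, if a ∈ T then 0 else kosSign n a T • w a (f (insert a T))
  map_zero' := funext fun T => Finset.sum_eq_zero fun a _ => by
    rw [Pi.zero_apply, map_zero, smul_zero, ite_self]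
  map_add' f g := funext fun T => by
    rw [Pi.add_apply, ← Finset.sum_add_distrib]
    refine Finset.sum_congr rfl fun a _ => ?_
    split_ifs
    · rw [add_zero]
    · rw [Pi.add_apply, map_add, smul_add]

theorem koszul_apply (w : Fin n → M →+ M) (f : Finset (Fin n) → M) (T : Finset (Fin n)) :
    koszul w f T = ∑ a, if a ∈ T then 0 else kosSign n a T • w a (f (insert a T)) := rfl

/-- A map of coefficients applied to chains. -/
abbrev onChains (n : ℕ) (φ : M →+ N) : (Finset (Fin n) → M) →+ (Finset (Fin n) → N) :=
  φ.compLeft (Finset (Fin n))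

theorem koszul_onChains (w : Fin n → M →+ M) (w' : Fin n → N →+ N) (φ : M →+ N)
    (h : ∀ a x, φ (w a x) = w' a (φ x)) (f : Finset (Fin n) → M) :
    koszul w' (onChains n φ f) = onChains n φ (koszul w f) := by
  funext T
  change _ = φ (koszul w f T)
  rw [koszul_apply, koszul_apply, map_sum]
  refine Finset.sum_congr rfl fun a _ => ?_
  split_ifs
  · rw [map_zero]
  · rw [map_zsmul, h]; rfl

/-- A subset of `Fin n` as a subset of `Fin (n + 1)`. -/
abbrev castFinset (S : Finset (Fin n)) : Finset (Fin (n + 1)) := S.map Fin.castSuccEmb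

theorem last_notMem_castFinset (S : Finset (Fin n)) : Fin.last n ∉ castFinset S := by
  intro h
  obtain ⟨a, -, ha⟩ := Finset.mem_map.1 h
  exact (Fin.castSucc_lt_last a).ne ha

theorem exists_castFinset (S : Finset (Fin (n + 1))) :
    ∃ T : Finset (Fin n), S = castFinset T ∨ S = insert (Fin.last n) (castFinset T) := by
  have h : S.erase (Fin.last n) = castFinset (Finset.univ.filter fun a => Fin.castSucc a ∈ S) := by
    ext a
    induction a using Fin.lastCases with
    | last => simp
    | cast a => simp [(Fin.castSucc_lt_last a).ne]
  refine ⟨Finset.univ.filter fun a => Fin.castSucc a ∈ S, ?_⟩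
  by_cases hS : Fin.last n ∈ S
  · right
    rw [← h, Finset.insert_erase hS]
  · left
    rw [← h, Finset.erase_eq_of_notMem hS]

/-- The part of a chain that does not involve the last exterior generator. -/
def low : (Finset (Fin (n + 1)) → M) →+ (Finset (Fin n) → M) where
  toFun f S := f (castFinset S)
  map_zero' := rfl
  map_add' _ _ := rfl

/-- The coefficient of the last exterior generator, written on the left, in a chain. -/
def top : (Finset (Fin (n + 1)) → M) →+ (Finset (Fin n) → M) where
  toFun f S := (-1 : ℤ) ^ S.card • f (insert (Fin.last n) (castFinset S))
  map_zero' := funext fun _ => smul_zero _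
  map_add' _ _ := funext fun _ => smul_add _ _ _

/-- The chain with given components. -/
def join (f g : Finset (Fin n) → M) : Finset (Fin (n + 1)) → M := fun S =>
  if Fin.last n ∈ S then
    (-1 : ℤ) ^ (Finset.univ.filter fun a => Fin.castSucc a ∈ S).card •
      g (Finset.univ.filter fun a => Fin.castSucc a ∈ S)
  else f (Finset.univ.filter fun a => Fin.castSucc a ∈ S)

theorem low_join (f g : Finset (Fin n) → M) : low (join f g) = f := by
  funext S
  change join f g (castFinset S) = f S
  rw [join, if_neg (last_notMem_castFinset S)]
  congr 1
  ext a
  simp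

theorem top_join (f g : Finset (Fin n) → M) : top (join f g) = g := by
  funext S
  change (-1 : ℤ) ^ S.card • join f g (insert (Fin.last n) (castFinset S)) = g S
  have : (Finset.univ.filter fun a => Fin.castSucc a ∈ insert (Fin.last n) (castFinset S)) = S := by
    ext a
    simp
  rw [join, if_pos (Finset.mem_insert_self _ _), this, ← mul_smul, ← mul_pow]
  simp

theorem ext_low_top {f g : Finset (Fin (n + 1)) → M} (h : low f = low g) (h' : top f = top g) :
    f = g := by
  funext S
  obtain ⟨T, rfl | rfl⟩ := exists_castFinset S
  · exact congrFun h T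
  · have h2 := congrArg (fun x => (-1 : ℤ) ^ T.card • x) (congrFun h' T)
    simp only [top, AddMonoidHom.coe_mk, ZeroHom.coe_mk, ← mul_smul, ← mul_pow] at h2
    simpa using h2

theorem low_onChains (φ : M →+ N) (f : Finset (Fin (n + 1)) → M) :
    low (onChains (n + 1) φ f) = onChains n φ (low f) := rfl

theorem top_onChains (φ : M →+ N) (f : Finset (Fin (n + 1)) → M) :
    top (onChains (n + 1) φ f) = onChains n φ (top f) :=
  funext fun _ => (map_zsmul φ _ _).symm

theorem filter_lt_castFinset (a : Fin n) (S : Finset (Fin n)) :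
    (castFinset S).filter (· < a.castSucc) = castFinset (S.filter (· < a)) := by
  ext b
  induction b using Fin.lastCases with
  | last => simp
  | cast b => simp

theorem kosSign_castFinset (a : Fin n) (S : Finset (Fin n)) :
    kosSign (n + 1) a.castSucc (castFinset S) = kosSign n a S := by
  rw [kosSign, kosSign, filter_lt_castFinset, Finset.card_map]

theorem kosSign_insert_last (a : Fin n) (S : Finset (Fin n)) :
    kosSign (n + 1) a.castSucc (insert (Fin.last n) (castFinset S)) = kosSign n a S := by
  rw [← kosSign_castFinset a S, kosSign, kosSign, Finset.filter_insert,
    if_neg (Fin.castSucc_lt_last a).asymm]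

theorem kosSign_last (S : Finset (Fin n)) :
    kosSign (n + 1) (Fin.last n) (castFinset S) = (-1) ^ S.card := by
  rw [kosSign, Finset.filter_true_of_mem, Finset.card_map]
  intro b hb
  obtain ⟨a, -, rfl⟩ := Finset.mem_map.1 hb
  exact Fin.castSucc_lt_last a

theorem low_koszul (w : Fin (n + 1) → M →+ M) (f : Finset (Fin (n + 1)) → M) :
    low (koszul w f) = koszul (fun a => w a.castSucc) (low f) +
      onChains n (w (Fin.last n)) (top f) := by
  funext S
  change koszul w f (castFinset S) = koszul _ _ S + w (Fin.last n) ((-1 : ℤ) ^ S.card • _)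
  rw [koszul_apply, koszul_apply, Fin.sum_univ_castSucc, if_neg (last_notMem_castFinset S),
    kosSign_last, map_zsmul]
  congr 1
  refine Finset.sum_congr rfl fun a _ => ?_
  have : a.castSucc ∈ castFinset S ↔ a ∈ S := by simp
  rw [kosSign_castFinset, if_congr this rfl rfl]
  congr 3
  change _ = f (castFinset (insert a S))
  rw [castFinset, castFinset, Finset.map_insert]; rfl

theorem top_koszul (w : Fin (n + 1) → M →+ M) (f : Finset (Fin (n + 1)) → M) :
    top (koszul w f) = -koszul (fun a => w a.castSucc) (top f) := by
  funext S
  change (-1 : ℤ) ^ S.card • koszul w f (insert (Fin.last n) (castFinset S)) = -koszul _ _ S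
  rw [koszul_apply, koszul_apply, Fin.sum_univ_castSucc, if_pos (Finset.mem_insert_self _ _),
    add_zero, Finset.smul_sum, ← Finset.sum_neg_distrib]
  refine Finset.sum_congr rfl fun a _ => ?_
  have : a.castSucc ∈ insert (Fin.last n) (castFinset S) ↔ a ∈ S := by
    simp [(Fin.castSucc_lt_last a).ne]
  rw [kosSign_insert_last, if_congr this rfl rfl]
  split_ifs with h
  · rw [smul_zero, neg_zero]
  · have h1 : insert a.castSucc (insert (Fin.last n) (castFinset S)) =
        insert (Fin.last n) (castFinset (insert a S)) := by
      rw [Finset.insert_comm, castFinset, castFinset, Finset.map_insert]; rfl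
    change _ = -(kosSign n a S • w a.castSucc ((-1 : ℤ) ^ (insert a S).card • _))
    rw [h1, Finset.card_insert_of_notMem h, map_zsmul, pow_succ, smul_comm, mul_neg_one, neg_smul,
      smul_neg, neg_neg]

theorem koszul_koszul {n : ℕ} (w : Fin n → M →+ M) (hw : ∀ a b x, w a (w b x) = w b (w a x))
    (f : Finset (Fin n) → M) : koszul w (koszul w f) = 0 := by
  induction n with
  | zero => rfl
  | succ n ih =>
    have ih' := ih (fun a => w a.castSucc) (fun a b x => hw _ _ x)
    refine ext_low_top ?_ ?_
    · rw [low_koszul, low_koszul, top_koszul, map_add, ih', zero_add, map_neg,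
        koszul_onChains (fun a => w a.castSucc) (fun a => w a.castSucc) _ (fun a x => hw _ _ x),
        add_neg_cancel, map_zero]
    · rw [top_koszul, top_koszul, map_neg, ih', neg_zero, neg_zero, map_zero]

/-- The coefficient of the last exterior generator, as a chain of the same Koszul complex. -/
def contractLast : (Finset (Fin (n + 1)) → M) →+ (Finset (Fin (n + 1)) → M) where
  toFun f := join (top f) 0
  map_zero' := ext_low_top (by rw [low_join, map_zero, map_zero]) (by rw [top_join, map_zero])
  map_add' f g := ext_low_top (by rw [map_add, map_add, low_join, low_join, low_join])
    (by rw [map_add top (join _ _), top_join, top_join, top_join, add_zero])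

theorem low_contractLast (f : Finset (Fin (n + 1)) → M) : low (contractLast f) = top f :=
  low_join _ _

theorem top_contractLast (f : Finset (Fin (n + 1)) → M) : top (contractLast f) = 0 :=
  top_join _ _

theorem contractLast_contractLast (f : Finset (Fin (n + 1)) → M) :
    contractLast (contractLast f) = 0 := by
  refine ext_low_top ?_ ?_
  · rw [low_contractLast, top_contractLast, map_zero]
  · rw [top_contractLast, map_zero]

theorem contractLast_onChains (φ : M →+ N) (f : Finset (Fin (n + 1)) → M) :
    contractLast (onChains (n + 1) φ f) = onChains (n + 1) φ (contractLast f) := by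
  refine ext_low_top ?_ ?_
  · rw [low_contractLast, low_onChains, top_onChains, low_contractLast]
  · rw [top_contractLast, top_onChains, top_contractLast, map_zero]

theorem koszul_contractLast (w : Fin (n + 1) → M →+ M) (f : Finset (Fin (n + 1)) → M) :
    koszul w (contractLast f) = -contractLast (koszul w f) := by
  refine ext_low_top ?_ ?_
  · rw [low_koszul, low_contractLast, top_contractLast, map_zero, add_zero, map_neg,
      low_contractLast, top_koszul, neg_neg]
  · rw [top_koszul, top_contractLast, map_zero, map_neg, top_contractLast]

/-- A map of coefficients that commutes with all endomorphisms but the last. -/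
theorem onChains_koszul_last (w : Fin (n + 1) → M →+ M) (w' : Fin (n + 1) → N →+ N) (φ δ : M →+ N)
    (h : ∀ (a : Fin n) x, φ (w a.castSucc x) = w' a.castSucc (φ x))
    (h' : ∀ x, φ (w (Fin.last n) x) = w' (Fin.last n) (φ x) + δ x) (f : Finset (Fin (n + 1)) → M) :
    onChains (n + 1) φ (koszul w f) =
      koszul w' (onChains (n + 1) φ f) + onChains (n + 1) δ (contractLast f) := by
  have hk := fun g => koszul_onChains (fun a => w a.castSucc) (fun a => w' a.castSucc) φ h g
  refine ext_low_top ?_ ?_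
  · rw [map_add, low_koszul, low_onChains, low_onChains, low_onChains, low_koszul, top_onChains, hk,
      map_add, low_contractLast, add_assoc]
    congr 1
    exact funext fun S => h' _
  · rw [map_add, top_koszul, top_onChains, top_onChains, top_onChains, top_koszul,
      top_contractLast, map_zero, add_zero, hk, map_neg]

/-- Multiplication by the last endomorphism is null-homotopic. -/
theorem exists_koszul_eq_last (w : Fin (n + 1) → M →+ M) {f : Finset (Fin (n + 1)) → M}
    (hf : koszul w f = 0) : ∃ g, koszul w g = onChains (n + 1) (w (Fin.last n)) f := by
  refine ⟨join 0 (low f), ext_low_top ?_ ?_⟩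
  · rw [low_koszul, low_join, top_join, map_zero, zero_add, low_onChains]
  · rw [top_koszul, top_join, top_onChains]
    have := low_koszul w f
    rw [hf, map_zero] at this
    exact neg_eq_of_add_eq_zero_right this.symm

/-! ### Chains of a given degree -/

/-- The chains of degree `h`. -/
def IsChainOfDegree (h : ℤ) (f : Finset (Fin n) → M) : Prop := ∀ S, (S.card : ℤ) ≠ h → f S = 0

theorem isChainOfDegree_low {h : ℤ} {f : Finset (Fin (n + 1)) → M} (hf : IsChainOfDegree h f) :
    IsChainOfDegree h (low f) := fun S hS => hf _ (by rwa [Finset.card_map])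

theorem isChainOfDegree_top {h : ℤ} {f : Finset (Fin (n + 1)) → M} (hf : IsChainOfDegree h f) :
    IsChainOfDegree (h - 1) (top f) := fun S hS => by
  change (-1 : ℤ) ^ S.card • f (insert (Fin.last n) (castFinset S)) = 0
  rw [hf, smul_zero]
  rw [Finset.card_insert_of_notMem (last_notMem_castFinset S), Finset.card_map]
  push_cast
  omega

theorem isChainOfDegree_join {h : ℤ} {f g : Finset (Fin n) → M} (hf : IsChainOfDegree h f)
    (hg : IsChainOfDegree (h - 1) g) : IsChainOfDegree h (join f g) := by
  intro S hS
  obtain ⟨T, rfl | rfl⟩ := exists_castFinset S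
  · rw [Finset.card_map] at hS
    exact (congrFun (low_join f g) T).trans (hf T hS)
  · rw [Finset.card_insert_of_notMem (last_notMem_castFinset T), Finset.card_map] at hS
    have h1 := (congrFun (top_join f g) T).trans (hg T (by push_cast at hS; omega))
    change (-1 : ℤ) ^ T.card • join f g (insert (Fin.last n) (castFinset T)) = 0 at h1
    have h2 := congrArg (fun x => (-1 : ℤ) ^ T.card • x) h1
    simp only [← mul_smul, ← mul_pow, smul_zero] at h2
    simpa using h2

theorem isChainOfDegree_contractLast {h : ℤ} {f : Finset (Fin (n + 1)) → M}
    (hf : IsChainOfDegree h f) : IsChainOfDegree (h - 1) (contractLast f) :=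
  isChainOfDegree_join (isChainOfDegree_top hf) fun _ _ => rfl

theorem isChainOfDegree_onChains {h : ℤ} {f : Finset (Fin n) → M} (φ : M →+ N)
    (hf : IsChainOfDegree h f) : IsChainOfDegree h (onChains n φ f) := fun S hS => by
  change φ (f S) = 0
  rw [hf S hS, map_zero]

theorem isChainOfDegree_sub {h : ℤ} {f g : Finset (Fin n) → M} (hf : IsChainOfDegree h f)
    (hg : IsChainOfDegree h g) : IsChainOfDegree h (f - g) := fun S hS => by
  rw [Pi.sub_apply, hf S hS, hg S hS, sub_zero]

variable (n M) in
/-- The inclusion of the chains of degree `h` into all chains. -/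
def kosExt (h : ℤ) : Kos n M h →+ (Finset (Fin n) → M) where
  toFun f S := if H : (S.card : ℤ) = h then f ⟨S, H⟩ else 0
  map_zero' := funext fun S => by split_ifs <;> rfl
  map_add' f g := funext fun S => by
    rw [Pi.add_apply]
    split_ifs
    · rfl
    · rw [add_zero]

variable (n M) in
/-- The component of degree `h` of a chain. -/
def kosRes (h : ℤ) : (Finset (Fin n) → M) →+ Kos n M h where
  toFun f S := f S.1
  map_zero' := rfl
  map_add' _ _ := rfl

theorem kosExt_apply {h : ℤ} (f : Kos n M h) (S : {S : Finset (Fin n) // (S.card : ℤ) = h}) :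
    kosExt n M h f S.1 = f S := dif_pos S.2

theorem kosRes_kosExt (h : ℤ) (f : Kos n M h) : kosRes n M h (kosExt n M h f) = f :=
  funext fun S => kosExt_apply f S

theorem isChainOfDegree_kosExt (h : ℤ) (f : Kos n M h) : IsChainOfDegree h (kosExt n M h f) :=
  fun _ hS => dif_neg hS

theorem kosExt_kosRes {h : ℤ} {f : Finset (Fin n) → M} (hf : IsChainOfDegree h f) :
    kosExt n M h (kosRes n M h f) = f := by
  funext S
  by_cases hS : (S.card : ℤ) = h
  · exact kosExt_apply (kosRes n M h f) ⟨S, hS⟩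
  · rw [hf S hS]
    exact dif_neg hS

theorem kosExt_map (φ : M →+ N) (h : ℤ) (f : Kos n M h) :
    kosExt n N h (fun S => φ (f S)) = onChains n φ (kosExt n M h f) := by
  rw [← kosExt_kosRes (isChainOfDegree_onChains φ (isChainOfDegree_kosExt h f))]
  congr 1
  exact funext fun S => congrArg φ (kosExt_apply f S).symm

variable {k : Type} [CommRing k] [Module (Env (Poly k n)) M]

/-- The endomorphisms of a bimodule given by the elements `x_a ⊗ 1 - 1 ⊗ x_a`. -/
def wAct (k : Type) [CommRing k] (n : ℕ) (M : Type) [AddCommGroup M] [Module (Env (Poly k n)) M]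
    (a : Fin n) : M →+ M := DistribSMul.toAddMonoidHom M (wEnv k n a)

theorem wAct_apply (a : Fin n) (x : M) : wAct k n M a x = wEnv k n a • x := rfl

theorem wAct_comm (a b : Fin n) (x : M) :
    wAct k n M a (wAct k n M b x) = wAct k n M b (wAct k n M a x) := smul_comm _ _ _

theorem kosD_kosRes (h h' : ℤ) (hh : h = h' + 1) (f : Finset (Fin n) → M) :
    kosD k n M h h' (kosRes n M h f) = kosRes n M h' (koszul (wAct k n M) f) := by
  funext T
  change _ = koszul (wAct k n M) f T.1
  rw [kosD_apply, koszul_apply]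
  refine Finset.sum_congr rfl fun a _ => ?_
  by_cases ha : a ∈ T.1
  · rw [dif_neg (fun H => H.1 ha), if_pos ha]
  · rw [dif_pos, if_neg ha]
    · rfl
    · refine ⟨ha, ?_⟩
      rw [Finset.card_insert_of_notMem ha, Nat.cast_add, T.2, hh]
      rfl

theorem koszul_kosExt (h h' : ℤ) (hh : h = h' + 1) (f : Kos n M h) :
    koszul (wAct k n M) (kosExt n M h f) = kosExt n M h' (kosD k n M h h' f) := by
  have hd : IsChainOfDegree h' (koszul (wAct k n M) (kosExt n M h f)) := by
    intro T hT
    rw [koszul_apply]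
    refine Finset.sum_eq_zero fun a _ => ?_
    split_ifs with ha
    · rfl
    · rw [isChainOfDegree_kosExt h f, map_zero, smul_zero]
      rw [Finset.card_insert_of_notMem ha]
      push_cast
      omega
  rw [← kosExt_kosRes hd, ← kosD_kosRes h h' hh, kosRes_kosExt]

theorem koszul_kosExt_eq_zero {h : ℤ} {f : Kos n M h} (hf : kosD k n M h (h - 1) f = 0) :
    koszul (wAct k n M) (kosExt n M h f) = 0 := by
  rw [koszul_kosExt h (h - 1) (by ring), hf, map_zero]

end TotalKoszul

/-! ### Maps on Hochschild homology that remove the last variable -/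

section Reduction

variable {k : Type} [CommRing k] {m : ℕ}

variable (k m) in
/-- A map from a bimodule over the larger polynomial ring to one over the smaller polynomial ring
that is linear over the smaller ring and kills the multiples of `t ⊗ 1 - 1 ⊗ t`, for the last
variable `t`. -/
structure IsReduction {N M : Type} [AddCommGroup N] [Module (Env (Poly k (m + 1 + 1))) N]
    [AddCommGroup M] [Module (Env (Poly k (m + 1))) M] (q : N →+ M) : Prop where
  lef : ∀ (r : Poly k (m + 1)) (x : N),
    q ((lef (inc r) : Env (Poly k (m + 1 + 1))) • x) = (lef r : Env (Poly k (m + 1))) • q x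
  rig : ∀ (r : Poly k (m + 1)) (x : N),
    q ((rig (inc r) : Env (Poly k (m + 1 + 1))) • x) = (rig r : Env (Poly k (m + 1))) • q x
  last : ∀ x : N, q (lastW k m • x) = 0

/-- The chain map, up to a sign, that lowers the Hochschild degree by one: the coefficient of the
last exterior generator of the larger ring minus the contraction by the last exterior generator of
the smaller ring. -/
def posChain {N M : Type} [AddCommGroup N] [AddCommGroup M] (q : N →+ M) :
    (Finset (Fin (m + 1 + 1)) → N) →+ (Finset (Fin (m + 1)) → M) :=
  (onChains (m + 1) q).comp top - contractLast.comp ((onChains (m + 1) q).comp low)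

theorem posChain_apply {N M : Type} [AddCommGroup N] [AddCommGroup M] (q : N →+ M)
    (f : Finset (Fin (m + 1 + 1)) → N) : posChain q f =
      onChains (m + 1) q (top f) - contractLast (onChains (m + 1) q (low f)) := rfl

/-- The chain map that keeps the Hochschild degree: the part that does not involve the last exterior
generator of the larger ring. -/
def negChain {N M : Type} [AddCommGroup N] [AddCommGroup M] (q : N →+ M) :
    (Finset (Fin (m + 1 + 1)) → N) →+ (Finset (Fin (m + 1)) → M) :=
  (onChains (m + 1) q).comp low

theorem negChain_apply {N M : Type} [AddCommGroup N] [AddCommGroup M] (q : N →+ M)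
    (f : Finset (Fin (m + 1 + 1)) → N) : negChain q f = onChains (m + 1) q (low f) := rfl

theorem isChainOfDegree_posChain {N M : Type} [AddCommGroup N] [AddCommGroup M] (q : N →+ M) {h : ℤ}
    {f : Finset (Fin (m + 1 + 1)) → N} (hf : IsChainOfDegree h f) :
    IsChainOfDegree (h - 1) (posChain q f) :=
  isChainOfDegree_sub (isChainOfDegree_onChains q (isChainOfDegree_top hf))
    (isChainOfDegree_contractLast (isChainOfDegree_onChains q (isChainOfDegree_low hf)))

theorem isChainOfDegree_negChain {N M : Type} [AddCommGroup N] [AddCommGroup M] (q : N →+ M) {h : ℤ}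
    {f : Finset (Fin (m + 1 + 1)) → N} (hf : IsChainOfDegree h f) :
    IsChainOfDegree h (negChain q f) :=
  isChainOfDegree_onChains q (isChainOfDegree_low hf)

theorem posChain_natural {N M N' M' : Type} [AddCommGroup N] [AddCommGroup M] [AddCommGroup N']
    [AddCommGroup M'] {q : N →+ M} {q' : N' →+ M'} {φ : N →+ N'} {ψ : M →+ M'}
    (h : ∀ x, q' (φ x) = ψ (q x)) (f : Finset (Fin (m + 1 + 1)) → N) :
    posChain q' (onChains (m + 1 + 1) φ f) = onChains (m + 1) ψ (posChain q f) := by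
  have hq : ∀ g : Finset (Fin (m + 1)) → N, onChains (m + 1) q' (onChains (m + 1) φ g) =
      onChains (m + 1) ψ (onChains (m + 1) q g) := fun g => funext fun S => h _
  rw [posChain_apply, posChain_apply, low_onChains, top_onChains, hq, hq, map_sub,
    contractLast_onChains]

theorem negChain_natural {N M N' M' : Type} [AddCommGroup N] [AddCommGroup M] [AddCommGroup N']
    [AddCommGroup M'] {q : N →+ M} {q' : N' →+ M'} {φ : N →+ N'} {ψ : M →+ M'}
    (h : ∀ x, q' (φ x) = ψ (q x)) (f : Finset (Fin (m + 1 + 1)) → N) :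
    negChain q' (onChains (m + 1 + 1) φ f) = onChains (m + 1) ψ (negChain q f) :=
  funext fun _ => h _

section

variable {N M : Type} [AddCommGroup N] [Module (Env (Poly k (m + 1 + 1))) N]
    [AddCommGroup M] [Module (Env (Poly k (m + 1))) M] {q : N →+ M}

theorem IsReduction.wEnv_smul (hq : IsReduction k m q) (a : Fin (m + 1)) (x : N) :
    q (wEnv k (m + 1 + 1) a.castSucc • x) = wEnv k (m + 1) a • q x := by
  have := MvPolynomial.rename_X (R := k) Fin.castSucc a
  rw [wEnv, wEnv, ← this, sub_smul, sub_smul, map_sub, hq.lef, hq.rig]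

theorem IsReduction.koszul_low (hq : IsReduction k m q) (f : Finset (Fin (m + 1 + 1)) → N) :
    koszul (wAct k (m + 1) M) (onChains (m + 1) q (low f)) =
      onChains (m + 1) q (low (koszul (wAct k (m + 1 + 1) N) f)) := by
  rw [low_koszul, map_add, koszul_onChains (fun a => wAct k (m + 1 + 1) N a.castSucc)
    (wAct k (m + 1) M) q hq.wEnv_smul]
  have : onChains (m + 1) q (onChains (m + 1) (wAct k (m + 1 + 1) N (Fin.last (m + 1))) (top f)) = 0 :=
    funext fun S => hq.last _
  rw [this, add_zero]

theorem IsReduction.koszul_top (hq : IsReduction k m q) (f : Finset (Fin (m + 1 + 1)) → N) :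
    koszul (wAct k (m + 1) M) (onChains (m + 1) q (top f)) =
      -onChains (m + 1) q (top (koszul (wAct k (m + 1 + 1) N) f)) := by
  rw [top_koszul, map_neg, neg_neg, koszul_onChains (fun a => wAct k (m + 1 + 1) N a.castSucc)
    (wAct k (m + 1) M) q hq.wEnv_smul]

theorem IsReduction.koszul_posChain (hq : IsReduction k m q)
    (f : Finset (Fin (m + 1 + 1)) → N) : koszul (wAct k (m + 1) M) (posChain q f) =
      -posChain q (koszul (wAct k (m + 1 + 1) N) f) := by
  rw [posChain_apply, posChain_apply, map_sub, hq.koszul_top, koszul_contractLast, hq.koszul_low]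
  abel

theorem IsReduction.koszul_negChain (hq : IsReduction k m q)
    (f : Finset (Fin (m + 1 + 1)) → N) : koszul (wAct k (m + 1) M) (negChain q f) =
      negChain q (koszul (wAct k (m + 1 + 1) N) f) := hq.koszul_low f

end

section

variable {N : Bimod (Poly k (m + 1 + 1))} {M : Bimod (Poly k (m + 1))} {q : N →+ M}

theorem IsReduction.kosD_posChain (hq : IsReduction k m q) (h : ℤ)
    (f : Kos (m + 1 + 1) N h) (hf : kosD k (m + 1 + 1) N h (h - 1) f = 0) :
    kosD k (m + 1) M (h - 1) (h - 1 - 1)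
      (kosRes (m + 1) M (h - 1) (posChain q (kosExt (m + 1 + 1) N h f))) = 0 := by
  rw [kosD_kosRes _ _ (by ring), hq.koszul_posChain, koszul_kosExt_eq_zero hf, map_zero, neg_zero,
    map_zero]

theorem IsReduction.kosD_negChain (hq : IsReduction k m q) (h : ℤ)
    (f : Kos (m + 1 + 1) N h) (hf : kosD k (m + 1 + 1) N h (h - 1) f = 0) :
    kosD k (m + 1) M h (h - 1)
      (kosRes (m + 1) M h (negChain q (kosExt (m + 1 + 1) N h f))) = 0 := by
  rw [kosD_kosRes _ _ (by ring), hq.koszul_negChain, koszul_kosExt_eq_zero hf, map_zero, map_zero]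

theorem IsReduction.exists_posHom (hq : IsReduction k m q) (h : ℤ) :
    ∃ φ : (HH k (m + 1 + 1) h).obj N ⟶ (HH k (m + 1) (h - 1)).obj M, ∀ f hf, φ (HHcls f hf) =
      HHcls (k := k) (M := M) (kosRes (m + 1) M (h - 1) (posChain q (kosExt (m + 1 + 1) N h f)))
        (hq.kosD_posChain h f hf) := by
  refine exists_HH_hom
    ((kosRes (m + 1) M (h - 1)).comp ((posChain q).comp (kosExt (m + 1 + 1) N h)))
    (hq.kosD_posChain h) fun g => ⟨-kosRes (m + 1) M (h - 1 + 1)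
      (posChain q (kosExt (m + 1 + 1) N (h + 1) g)), ?_⟩
  change _ = kosRes (m + 1) M (h - 1) (posChain q (kosExt (m + 1 + 1) N h _))
  rw [map_neg, kosD_kosRes _ _ rfl, hq.koszul_posChain, map_neg, neg_neg, koszul_kosExt _ h rfl]

theorem IsReduction.exists_negHom (hq : IsReduction k m q) (h : ℤ) :
    ∃ φ : (HH k (m + 1 + 1) h).obj N ⟶ (HH k (m + 1) h).obj M, ∀ f hf, φ (HHcls f hf) =
      HHcls (k := k) (M := M) (kosRes (m + 1) M h (negChain q (kosExt (m + 1 + 1) N h f)))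
        (hq.kosD_negChain h f hf) := by
  refine exists_HH_hom
    ((kosRes (m + 1) M h).comp ((negChain q).comp (kosExt (m + 1 + 1) N h)))
    (hq.kosD_negChain h) fun g => ⟨kosRes (m + 1) M (h + 1)
      (negChain q (kosExt (m + 1 + 1) N (h + 1) g)), ?_⟩
  change _ = kosRes (m + 1) M h (negChain q (kosExt (m + 1 + 1) N h _))
  rw [kosD_kosRes _ _ rfl, hq.koszul_negChain, koszul_kosExt _ h rfl]

/-- The map on Hochschild homology that lowers the Hochschild degree by one. -/
def IsReduction.posHom (hq : IsReduction k m q) (h : ℤ) :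
    (HH k (m + 1 + 1) h).obj N ⟶ (HH k (m + 1) (h - 1)).obj M := (hq.exists_posHom h).choose

theorem IsReduction.posHom_HHcls (hq : IsReduction k m q) {h : ℤ} (f hf) :
    hq.posHom h (HHcls f hf) =
      HHcls (k := k) (M := M) (kosRes (m + 1) M (h - 1) (posChain q (kosExt (m + 1 + 1) N h f)))
        (hq.kosD_posChain h f hf) := (hq.exists_posHom h).choose_spec f hf

/-- The map on Hochschild homology that keeps the Hochschild degree. -/
def IsReduction.negHom (hq : IsReduction k m q) (h : ℤ) :
    (HH k (m + 1 + 1) h).obj N ⟶ (HH k (m + 1) h).obj M := (hq.exists_negHom h).choose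

theorem IsReduction.negHom_HHcls (hq : IsReduction k m q) {h : ℤ} (f hf) :
    hq.negHom h (HHcls f hf) =
      HHcls (k := k) (M := M) (kosRes (m + 1) M h (negChain q (kosExt (m + 1 + 1) N h f)))
        (hq.kosD_negChain h f hf) := (hq.exists_negHom h).choose_spec f hf

theorem HHcls_congr {n : ℕ} {M : Bimod (Poly k n)} {h : ℤ} {f g : Kos n M h} (e : f = g) (hf hg) :
    HHcls (k := k) (M := M) f hf = HHcls g hg := by
  subst e; rfl

theorem IsReduction.posHom_natural (hq : IsReduction k m q) {N' : Bimod (Poly k (m + 1 + 1))}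
    {M' : Bimod (Poly k (m + 1))} {q' : N' →+ M'} (hq' : IsReduction k m q') (φ : N ⟶ N')
    (ψ : M ⟶ M') (hφ : ∀ x, q' (φ.hom x) = ψ.hom (q x)) (h : ℤ) :
    (HH k (m + 1 + 1) h).map φ ≫ hq'.posHom h = hq.posHom h ≫ (HH k (m + 1) (h - 1)).map ψ := by
  refine ConcreteCategory.hom_ext _ _ fun x => ?_
  obtain ⟨f, hf, rfl⟩ := HHcls_surjective x
  rw [ConcreteCategory.comp_apply, ConcreteCategory.comp_apply, HH_map_HHcls, hq.posHom_HHcls,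
    hq'.posHom_HHcls, HH_map_HHcls]
  refine HHcls_congr ?_ _ _
  have e1 := kosExt_map φ.hom.toAddMonoidHom h f
  have e2 := posChain_natural (q := q) (q' := q') (φ := φ.hom.toAddMonoidHom)
    (ψ := ψ.hom.toAddMonoidHom) hφ (kosExt (m + 1 + 1) N h f)
  exact (congrArg (fun F => kosRes (m + 1) M' (h - 1) (posChain q' F)) e1).trans
    (congrArg (kosRes (m + 1) M' (h - 1)) e2)

theorem IsReduction.negHom_natural (hq : IsReduction k m q) {N' : Bimod (Poly k (m + 1 + 1))}
    {M' : Bimod (Poly k (m + 1))} {q' : N' →+ M'} (hq' : IsReduction k m q') (φ : N ⟶ N')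
    (ψ : M ⟶ M') (hφ : ∀ x, q' (φ.hom x) = ψ.hom (q x)) (h : ℤ) :
    (HH k (m + 1 + 1) h).map φ ≫ hq'.negHom h = hq.negHom h ≫ (HH k (m + 1) h).map ψ := by
  refine ConcreteCategory.hom_ext _ _ fun x => ?_
  obtain ⟨f, hf, rfl⟩ := HHcls_surjective x
  rw [ConcreteCategory.comp_apply, ConcreteCategory.comp_apply, HH_map_HHcls, hq.negHom_HHcls,
    hq'.negHom_HHcls, HH_map_HHcls]
  refine HHcls_congr ?_ _ _
  have e1 := kosExt_map φ.hom.toAddMonoidHom h f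
  have e2 := negChain_natural (q := q) (q' := q') (φ := φ.hom.toAddMonoidHom)
    (ψ := ψ.hom.toAddMonoidHom) hφ (kosExt (m + 1 + 1) N h f)
  exact (congrArg (fun F => kosRes (m + 1) M' h (negChain q' F)) e1).trans
    (congrArg (kosRes (m + 1) M' h) e2)

theorem IsReduction.posHom_HHAct (hq : IsReduction k m q) (h : ℤ) (r : Poly k (m + 1)) :
    HHAct N h (inc r) ≫ hq.posHom h = hq.posHom h ≫ HHAct M (h - 1) r :=
  hq.posHom_natural hq _ _ (hq.lef r) h

theorem IsReduction.negHom_HHAct (hq : IsReduction k m q) (h : ℤ) (r : Poly k (m + 1)) :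
    HHAct N h (inc r) ≫ hq.negHom h = hq.negHom h ≫ HHAct M h r :=
  hq.negHom_natural hq _ _ (hq.lef r) h

/-! ### Internal degrees -/

theorem kosExt_mem {n : ℕ} {M : Type} [AddCommGroup M] {g : ℤ → AddSubgroup M} {h d : ℤ}
    {f : Kos n M h} (hf : f ∈ kosDeg g h d) (S : Finset (Fin n)) :
    kosExt n M h f S ∈ g (d - 2 * h) := by
  by_cases H : (S.card : ℤ) = h
  · rw [kosExt_apply f ⟨S, H⟩]
    exact hf _ (Set.mem_univ _)
  · rw [isChainOfDegree_kosExt h f S H]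
    exact AddSubgroup.zero_mem _

theorem contractLast_mem {n : ℕ} {M : Type} [AddCommGroup M] {G : AddSubgroup M}
    {f : Finset (Fin (n + 1)) → M} (hf : ∀ S, f S ∈ G) (S : Finset (Fin (n + 1))) :
    contractLast f S ∈ G := by
  change join (top f) 0 S ∈ G
  rw [join]
  split_ifs
  · rw [Pi.zero_apply, smul_zero]
    exact G.zero_mem
  · exact G.zsmul_mem (hf _) _

theorem IsReduction.posHom_mem (hq : IsReduction k m q) {gN : ℤ → AddSubgroup N}
    {gM : ℤ → AddSubgroup M} (hg : ∀ d, ∀ x ∈ gN d, q x ∈ gM d) (h d : ℤ) :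
    HHDeg gN h d ≤ AddSubgroup.comap (hq.posHom h).hom (HHDeg gM (h - 1) (d + -2)) := by
  intro x hx
  obtain ⟨f, hf, hd, rfl⟩ := (mem_HHDeg_iff gN d x).1 hx
  change hq.posHom h (HHcls f hf) ∈ HHDeg gM (h - 1) (d + -2)
  rw [hq.posHom_HHcls]
  refine (mem_HHDeg_iff gM _ _).2 ⟨_, _, fun S _ => ?_, rfl⟩
  have e : d + -2 - 2 * (h - 1) = d - 2 * h := by ring
  rw [e]
  refine AddSubgroup.sub_mem _ (hg _ _ (AddSubgroup.zsmul_mem _ (kosExt_mem hd _) _)) ?_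
  exact contractLast_mem (fun T => hg _ _ (kosExt_mem hd _)) _

theorem IsReduction.negHom_mem (hq : IsReduction k m q) {gN : ℤ → AddSubgroup N}
    {gM : ℤ → AddSubgroup M} (hg : ∀ d, ∀ x ∈ gN d, q x ∈ gM (d + 2)) (h d : ℤ) :
    HHDeg gN h d ≤ AddSubgroup.comap (hq.negHom h).hom (HHDeg gM h (d + 2)) := by
  intro x hx
  obtain ⟨f, hf, hd, rfl⟩ := (mem_HHDeg_iff gN d x).1 hx
  change hq.negHom h (HHcls f hf) ∈ HHDeg gM h (d + 2)
  rw [hq.negHom_HHcls]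
  refine (mem_HHDeg_iff gM _ _).2 ⟨_, _, fun S _ => ?_, rfl⟩
  have e : d + 2 - 2 * h = d - 2 * h + 2 := by ring
  rw [e]
  exact hg _ _ (kosExt_mem hd _)

end

/-! ### Reduced powers -/

section

theorem conv_one_add {A M : Type} [CommRing A] [AddCommGroup M] [Module A M] (g : PowerSeries A)
    (s : ℕ → M) (c : ℕ) : conv (1 + g) s c = s c + conv g s c := by
  have h1 : conv (1 + g - g) s = conv (1 + g) s - conv g s := conv_sub_left _ _ _
  have h2 := conv_C (1 : A) s c
  rw [add_sub_cancel_right, ← map_one (PowerSeries.C (R := A))] at h1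
  rw [one_smul, h1, Pi.sub_apply] at h2
  rw [map_one] at h2
  rw [← h2, sub_add_cancel]

theorem map_conv_one_add {A A' N M : Type} [CommRing A] [CommRing A'] [AddCommGroup N] [Module A N]
    [AddCommGroup M] [Module A' M] (q : N →+ M) {a : A} {a' : A'} (h : ∀ x, q (a • x) = a' • q x)
    (s : ℕ → N) (c : ℕ) : q (conv (1 + PowerSeries.X * PowerSeries.C a) s c) =
      conv (1 + PowerSeries.X * PowerSeries.C a') (fun c => q (s c)) c := by
  rw [conv_one_add, conv_one_add, map_add]
  congr 1
  cases c with
  | zero => rw [conv_X_mul_zero, conv_X_mul_zero, map_zero]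
  | succ c => rw [conv_X_mul_C_succ, conv_X_mul_C_succ, h]

theorem pow_smul_natural {A A' N M : Type} [CommRing A] [CommRing A'] [AddCommGroup N] [Module A N]
    [AddCommGroup M] [Module A' M] (q : N →+ M) {a : A} {a' : A'} (h : ∀ x, q (a • x) = a' • q x)
    (i : ℕ) (x : N) : q (a ^ i • x) = a' ^ i • q x := by
  induction i with
  | zero => rw [pow_zero, pow_zero, one_smul, one_smul]
  | succ i ih => rw [pow_succ', pow_succ', mul_smul, mul_smul, h, ih]

variable {p : ℕ}

/-- The reduced powers on chains of all degrees at once. -/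
def totalPow {n : ℕ} {M : Type} [AddCommGroup M] [Module (Env (Poly k n)) M] (o : PowerOps k n p M)
    (c : ℕ) (f : Finset (Fin n) → M) : Finset (Fin n) → M :=
  fun S => (convHom (lamSeries (k := k) p S) c).comp o.P (f S)

theorem totalPow_kosExt {n : ℕ} {M : Type} [AddCommGroup M] [Module (Env (Poly k n)) M]
    (o : PowerOps k n p M) (c : ℕ) (h : ℤ) (f : Kos n M h) :
    totalPow o c (kosExt n M h f) = kosExt n M h (kosPow o c h f) := by
  funext S
  by_cases hS : (S.card : ℤ) = h
  · rw [kosExt_apply (kosPow o c h f) ⟨S, hS⟩, totalPow, kosExt_apply f ⟨S, hS⟩]; rfl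
  · rw [isChainOfDegree_kosExt h _ S hS, totalPow, isChainOfDegree_kosExt h f S hS, map_zero]

theorem kosRes_totalPow {n : ℕ} {M : Type} [AddCommGroup M] [Module (Env (Poly k n)) M]
    (o : PowerOps k n p M) (c : ℕ) (h : ℤ) (f : Finset (Fin n) → M) :
    kosRes n M h (totalPow o c f) = kosPow o c h (kosRes n M h f) := rfl

theorem totalPow_sub {n : ℕ} {M : Type} [AddCommGroup M] [Module (Env (Poly k n)) M]
    (o : PowerOps k n p M) (c : ℕ) (f g : Finset (Fin n) → M) :
    totalPow o c (f - g) = totalPow o c f - totalPow o c g :=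
  funext fun _ => map_sub _ _ _

variable {N M : Type} [AddCommGroup N] [Module (Env (Poly k (m + 1 + 1))) N]
    [AddCommGroup M] [Module (Env (Poly k (m + 1))) M] {q : N →+ M}

theorem IsReduction.conv_lamSeries (hq : IsReduction k m q) (S : Finset (Fin (m + 1)))
    (s : ℕ → N) (c : ℕ) : q (conv (lamSeries (k := k) p (castFinset S)) s c) =
      conv (lamSeries (k := k) p S) (fun c => q (s c)) c := by
  induction S using Finset.induction_on generalizing s c with
  | empty =>
    have h1 : ∀ n, lamSeries (k := k) p (∅ : Finset (Fin n)) = PowerSeries.C 1 := fun n => by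
      rw [map_one]; rfl
    rw [castFinset, Finset.map_empty, h1, h1, conv_C, conv_C, one_smul, one_smul]
  | insert a S ha ih =>
    have h1 : castFinset (insert a S) = insert a.castSucc (castFinset S) := by
      rw [castFinset, Finset.map_insert]; rfl
    have h2 : a.castSucc ∉ castFinset S := by simpa using ha
    rw [h1, lamSeries_insert p h2, lamSeries_insert p ha, conv_mul, conv_mul,
      map_conv_one_add q (pow_smul_natural q (hq.wEnv_smul a) (p - 1))]
    congr 1
    exact funext fun c => ih s c

variable {oN : PowerOps k (m + 1 + 1) p N} {oM : PowerOps k (m + 1) p M}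

theorem IsReduction.low_totalPow (hq : IsReduction k m q)
    (hP : ∀ x c, q (oN.P x c) = oM.P (q x) c) (c : ℕ) (f : Finset (Fin (m + 1 + 1)) → N) :
    onChains (m + 1) q (low (totalPow oN c f)) = totalPow oM c (onChains (m + 1) q (low f)) := by
  funext S
  refine (hq.conv_lamSeries S _ c).trans ?_
  change _ = conv _ (oM.P (q (f (castFinset S)))) c
  congr 1
  exact funext fun c => hP _ c

theorem IsReduction.top_totalPow (hq : IsReduction k m q) (hp : p.Prime)
    (hP : ∀ x c, q (oN.P x c) = oM.P (q x) c) (c : ℕ) (f : Finset (Fin (m + 1 + 1)) → N) :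
    onChains (m + 1) q (top (totalPow oN c f)) = totalPow oM c (onChains (m + 1) q (top f)) := by
  funext S
  change q ((-1 : ℤ) ^ S.card • conv _ (oN.P (f (insert (Fin.last (m + 1)) (castFinset S)))) c) =
    (convHom (lamSeries (k := k) p S) c).comp oM.P (q ((-1 : ℤ) ^ S.card •
      f (insert (Fin.last (m + 1)) (castFinset S))))
  rw [map_zsmul, map_zsmul, map_zsmul, lamSeries_insert p (last_notMem_castFinset S), mul_comm,
    conv_mul, hq.conv_lamSeries]
  have h1 : ∀ s : ℕ → N, (fun c => q (conv (1 + PowerSeries.X *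
      PowerSeries.C (wEnv k (m + 1 + 1) (Fin.last (m + 1)) ^ (p - 1))) s c)) = fun c => q (s c) := by
    intro s
    funext c
    rw [conv_one_add, map_add]
    have : q (conv (PowerSeries.X *
      PowerSeries.C (wEnv k (m + 1 + 1) (Fin.last (m + 1)) ^ (p - 1))) s c) = 0 := by
      cases c with
      | zero => rw [conv_X_mul_zero, map_zero]
      | succ c =>
        obtain ⟨i, hi⟩ : ∃ i, p - 1 = i + 1 := ⟨p - 2, by have := hp.two_le; omega⟩
        rw [conv_X_mul_C_succ, hi, pow_succ', mul_smul]
        exact hq.last _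
    rw [this, add_zero]
  rw [h1]
  have h2 : (fun c => q (oN.P (f (insert (Fin.last (m + 1)) (castFinset S))) c)) =
      oM.P (q (f (insert (Fin.last (m + 1)) (castFinset S)))) := funext fun c => hP _ c
  rw [h2]; rfl

theorem contractLast_insert_last {n : ℕ} {M : Type} [AddCommGroup M] (f : Finset (Fin (n + 1)) → M)
    (S : Finset (Fin n)) : contractLast f (insert (Fin.last n) (castFinset S)) = 0 := by
  change join (top f) 0 _ = 0
  rw [join, if_pos (Finset.mem_insert_self _ _), Pi.zero_apply, smul_zero]

theorem contractLast_totalPow_zero {n : ℕ} {M : Type} [AddCommGroup M]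
    [Module (Env (Poly k (n + 1))) M] (o : PowerOps k (n + 1) p M) (f : Finset (Fin (n + 1)) → M) :
    contractLast (totalPow o 0 f) = totalPow o 0 (contractLast f) := by
  funext S
  obtain ⟨T, rfl | rfl⟩ := exists_castFinset S
  · have h1 : contractLast f (castFinset T) = top f T := congrFun (low_contractLast f) T
    refine (congrFun (low_contractLast _) T).trans ?_
    rw [totalPow, h1]
    change (-1 : ℤ) ^ T.card • conv _ _ 0 = (convHom _ 0).comp o.P ((-1 : ℤ) ^ T.card • _)
    rw [map_zsmul, lamSeries_insert p (last_notMem_castFinset T), conv_mul, conv_one_add,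
      conv_X_mul_zero, add_zero]; rfl
  · rw [contractLast_insert_last, totalPow, contractLast_insert_last, map_zero]

theorem contractLast_totalPow_succ {n : ℕ} {M : Type} [AddCommGroup M]
    [Module (Env (Poly k (n + 1))) M] (o : PowerOps k (n + 1) p M) (c : ℕ)
    (f : Finset (Fin (n + 1)) → M) :
    contractLast (totalPow o (c + 1) f) = totalPow o (c + 1) (contractLast f) +
      wEnv k (n + 1) (Fin.last n) ^ (p - 1) • totalPow o c (contractLast f) := by
  funext S
  rw [Pi.add_apply, Pi.smul_apply]
  obtain ⟨T, rfl | rfl⟩ := exists_castFinset S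
  · have h1 : contractLast f (castFinset T) = top f T := congrFun (low_contractLast f) T
    refine (congrFun (low_contractLast _) T).trans ?_
    rw [totalPow, totalPow, h1]
    change (-1 : ℤ) ^ T.card • conv _ _ (c + 1) =
      (convHom _ (c + 1)).comp o.P ((-1 : ℤ) ^ T.card • _) +
        _ • (convHom _ c).comp o.P ((-1 : ℤ) ^ T.card • _)
    rw [map_zsmul, map_zsmul, lamSeries_insert p (last_notMem_castFinset T), conv_mul, conv_one_add,
      conv_X_mul_C_succ, smul_add, smul_comm (wEnv k (n + 1) (Fin.last n) ^ (p - 1))]; rfl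
  · rw [contractLast_insert_last, totalPow, totalPow, contractLast_insert_last, map_zero, map_zero,
      smul_zero, add_zero]

end

section

variable {p : ℕ} [CharP k p] [hp : Fact p.Prime] {N : Bimod (Poly k (m + 1 + 1))}
  {M : Bimod (Poly k (m + 1))} {q : N →+ M} {oN : PowerOps k (m + 1 + 1) p N}
  {oM : PowerOps k (m + 1) p M}

theorem IsReduction.negHom_HHPow (hq : IsReduction k m q)
    (hP : ∀ x c, q (oN.P x c) = oM.P (q x) c) (c : ℕ) (h : ℤ) :
    HHPow oN c h ≫ hq.negHom h = hq.negHom h ≫ HHPow oM c h := by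
  refine ConcreteCategory.hom_ext _ _ fun x => ?_
  obtain ⟨f, hf, rfl⟩ := HHcls_surjective x
  rw [ConcreteCategory.comp_apply, ConcreteCategory.comp_apply, HHPow_HHcls, hq.negHom_HHcls,
    hq.negHom_HHcls, HHPow_HHcls]
  refine HHcls_congr ?_ _ _
  rw [← kosRes_totalPow, ← totalPow_kosExt, negChain_apply, negChain_apply, hq.low_totalPow hP]

/-- The failure of the chain map to commute with `𝒫^c` is a multiple of `x ⊗ 1 - 1 ⊗ x`, for the
last variable `x` of the smaller ring, hence null-homotopic. -/
theorem IsReduction.posHom_HHPow (hq : IsReduction k m q)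
    (hP : ∀ x c, q (oN.P x c) = oM.P (q x) c) (c : ℕ) (h : ℤ) :
    HHPow oN c h ≫ hq.posHom h = hq.posHom h ≫ HHPow oM c (h - 1) := by
  refine ConcreteCategory.hom_ext _ _ fun x => ?_
  obtain ⟨f, hf, rfl⟩ := HHcls_surjective x
  rw [ConcreteCategory.comp_apply, ConcreteCategory.comp_apply, HHPow_HHcls, hq.posHom_HHcls,
    hq.posHom_HHcls, HHPow_HHcls, HHcls_eq_iff]
  rw [← kosRes_totalPow, ← totalPow_kosExt, posChain_apply, posChain_apply, totalPow_sub,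
    hq.low_totalPow hP, hq.top_totalPow hp.out hP]
  set z := onChains (m + 1) q (low (kosExt (m + 1 + 1) N h f)) with hz
  have hzd : IsChainOfDegree (h - 1) (contractLast z) := isChainOfDegree_contractLast
    (isChainOfDegree_onChains q (isChainOfDegree_low (isChainOfDegree_kosExt h f)))
  have hzc : koszul (wAct k (m + 1) M) (contractLast z) = 0 := by
    rw [koszul_contractLast, hz, hq.koszul_low, koszul_kosExt_eq_zero hf, map_zero, map_zero,
      map_zero, neg_zero]
  cases c with
  | zero => exact ⟨0, by rw [map_zero, contractLast_totalPow_zero, sub_self]⟩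
  | succ c =>
    rw [contractLast_totalPow_succ]
    have hc : koszul (wAct k (m + 1) M) (totalPow oM c (contractLast z)) = 0 := by
      rw [← kosExt_kosRes hzd, totalPow_kosExt]
      refine koszul_kosExt_eq_zero (kosD_kosPow_eq_zero oM c ?_)
      rw [kosD_kosRes _ _ (by ring), hzc, map_zero]
    obtain ⟨i, hi⟩ : ∃ i, p - 1 = i + 1 := ⟨p - 2, by have := hp.out.two_le; omega⟩
    have hc' : koszul (wAct k (m + 1) M) (wEnv k (m + 1) (Fin.last m) ^ i •
        totalPow oM c (contractLast z)) = 0 := by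
      refine (koszul_onChains (wAct k (m + 1) M) (wAct k (m + 1) M)
        (DistribSMul.toAddMonoidHom M (wEnv k (m + 1) (Fin.last m) ^ i))
        (fun a x => smul_comm _ _ _) _).trans ?_
      rw [hc, map_zero]
    obtain ⟨g, hg⟩ := exists_koszul_eq_last _ hc'
    refine ⟨-kosRes (m + 1) M (h - 1 + 1) g, ?_⟩
    rw [map_neg, kosD_kosRes _ _ rfl, hg, ← map_neg, ← map_sub, hi]
    have e : wEnv k (m + 1) (Fin.last m) ^ (i + 1) • totalPow oM c (contractLast z) =
        onChains (m + 1) (wAct k (m + 1) M (Fin.last m))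
          (wEnv k (m + 1) (Fin.last m) ^ i • totalPow oM c (contractLast z)) := funext fun S => by
      change wEnv k (m + 1) (Fin.last m) ^ (i + 1) • totalPow oM c (contractLast z) S =
        wEnv k (m + 1) (Fin.last m) • wEnv k (m + 1) (Fin.last m) ^ i •
          totalPow oM c (contractLast z) S
      rw [pow_succ', mul_smul]
    rw [e]
    congr 1
    abel

end

end Reduction

/-! ### Exactness on the level of chains -/

section Chase

/-- The relations between the Koszul complexes over the smaller ring of a bimodule `M`, of
`E = M[t]`, and of `A = E ⊗ B`. The Koszul complex of `E` over the larger ring is the direct sum of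
two copies of `(E, dE)`, and that of `A` is the cone of `W`, the action of `t ⊗ 1 - 1 ⊗ t`. The map
`x` is the action of `x - t`, and `κE` is the contraction by the last exterior generator of the
smaller ring. The maps `br` and `rb` are the bimodule maps between `E` and `A`, and `s`, `c` are the
inclusion of `1` into `B` and the second coordinate of `B`, which are chain maps up to `κE`. -/
structure IsStabilization {M E A : Type} [AddCommGroup M] [AddCommGroup E] [AddCommGroup A]
    (dM : M →+ M) (dE κE : E →+ E) (dA W : A →+ A) (ι : M →+ E) (ρ : E →+ M) (x : E →+ E)
    (br : A →+ E) (rb s : E →+ A) (c : A →+ M) : Prop where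
  dE_dE : ∀ e, dE (dE e) = 0
  dA_dA : ∀ z, dA (dA z) = 0
  dE_ι : ∀ r, dE (ι r) = ι (dM r)
  dM_ρ : ∀ e, dM (ρ e) = ρ (dE e)
  dE_x : ∀ e, dE (x e) = x (dE e)
  dE_br : ∀ z, dE (br z) = br (dA z)
  dA_rb : ∀ e, dA (rb e) = rb (dE e)
  dA_W : ∀ z, dA (W z) = W (dA z)
  dA_s : ∀ e, dA (s e) = s (dE e) - W (s (κE e))
  c_dA : ∀ z, c (dA z) = dM (c z) - ρ (κE (br z))
  c_W : ∀ z, c (W z) = ρ (br z)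
  κE_κE : ∀ e, κE (κE e) = 0
  dE_κE : ∀ e, dE (κE e) = -κE (dE e)
  ρ_ι : ∀ r, ρ (ι r) = r
  ρ_x : ∀ e, ρ (x e) = 0
  exists_x : ∀ e, ρ e = 0 → ∃ u, x u = e
  x_injective : ∀ e, x e = 0 → e = 0
  br_s : ∀ e, br (s e) = e
  br_W : ∀ z, br (W z) = 0
  br_rb : ∀ e, br (rb e) = x e
  W_rb : ∀ e, W (rb e) = 0
  exists_W : ∀ z, br z = 0 → ∃ u, W u = z
  exists_rb : ∀ z, W z = 0 → ∃ e, rb e = z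
  rb_injective : ∀ e, rb e = 0 → e = 0

namespace IsStabilization

variable {M E A : Type} [AddCommGroup M] [AddCommGroup E] [AddCommGroup A]
    {dM : M →+ M} {dE κE : E →+ E} {dA W : A →+ A} {ι : M →+ E} {ρ : E →+ M} {x : E →+ E}
    {br : A →+ E} {rb s : E →+ A} {c : A →+ M}
    (H : IsStabilization dM dE κE dA W ι ρ x br rb s c)

include H

/-- The division by `x` of a boundary is a boundary. -/
theorem exists_dE_of_x {e h : E} (hh : x e = dE h) : ∃ g, dE g = e := by
  have h1 : dM (ρ h) = 0 := by rw [H.dM_ρ, ← hh, H.ρ_x]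
  obtain ⟨g, hg⟩ := H.exists_x (h - ι (ρ h)) (by rw [map_sub, H.ρ_ι, sub_self])
  refine ⟨g, ?_⟩
  have h2 : x (dE g - e) = 0 := by
    rw [map_sub, ← H.dE_x, hg, map_sub, H.dE_ι, h1, map_zero, sub_zero, hh, sub_self]
  exact sub_eq_zero.1 (H.x_injective _ h2)

theorem dE_eq_zero_of_rb {e : E} (h : dA (rb e) = 0) : dE e = 0 :=
  H.rb_injective _ (by rw [← H.dA_rb, h])

theorem dE_eq_zero_of_x {e : E} (h : dE (x e) = 0) : dE e = 0 :=
  H.x_injective _ (by rw [← H.dE_x, h])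

theorem dA_s_κE (e : E) : dA (s (κE e)) = -s (κE (dE e)) := by
  rw [H.dA_s, H.κE_κE, map_zero, map_zero, sub_zero, H.dE_κE, map_neg]

/-- On the image of a cycle of `A`, the part with the contraction by the last exterior generator makes
the map to the Koszul complex of `M` a boundary. -/
theorem pos_br {f g : A} (h : dA f + W g = 0) : ρ (br g) - ρ (κE (br f)) = dM (-c f) := by
  have := congrArg c h
  rw [map_add, H.c_dA, H.c_W, map_zero] at this
  rw [map_neg, eq_neg_iff_add_eq_zero, ← this]
  abel

/-- A cycle of two copies of `E` that is sent to a boundary of `M` comes, up to a boundary, from a cycle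
of the cone of `W`. -/
theorem exists_br_of_pos {f g : E} {r : M} (hf : dE f = 0) (hg : dE g = 0)
    (hr : ρ g - ρ (κE f) = dM r) :
    ∃ f' g', dA f' + W g' = 0 ∧ dA g' = 0 ∧ br f' = f ∧ br g' - g = dE (-ι r) := by
  obtain ⟨e, he⟩ := H.exists_x (g - κE f - dE (ι r)) (by
    rw [map_sub, map_sub, hr, H.dE_ι, H.ρ_ι, sub_self])
  have he' : dE e = 0 := H.dE_eq_zero_of_x (by
    rw [he, map_sub, map_sub, hg, H.dE_κE, hf, H.dE_dE, map_zero, neg_zero, sub_zero, sub_zero])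
  refine ⟨s f, s (κE f) + rb e, ?_, ?_, H.br_s f, ?_⟩
  · rw [H.dA_s, map_add, H.W_rb, hf, map_zero]
    abel
  · rw [map_add, H.dA_s_κE, H.dA_rb, hf, he', map_zero, map_zero, map_zero, neg_zero, add_zero]
  · rw [map_add, H.br_s, H.br_rb, he, map_neg]
    abel

/-- A cycle of the cone of `W` whose image in two copies of `E` is a boundary is a boundary. -/
theorem exists_of_br {f g : A} {f' g' : E} (h : dA f + W g = 0)
    (hf' : br f = dE f') (hg' : br g = -dE g') : ∃ u v, f = dA u + W v ∧ g = -dA v := by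
  obtain ⟨u, hu⟩ := H.exists_W (f - s (dE f')) (by rw [map_sub, H.br_s, hf', sub_self])
  -- subtracting boundaries makes the first component vanish
  have h1 : f = dA (s f') + W (s (κE f') + u) := by
    rw [map_add, hu, H.dA_s]
    abel
  have h2 : W (g + dA (s (κE f') + u)) = 0 := by
    rw [map_add, ← H.dA_W, ← h]
    rw [h1, map_add dA (dA _), H.dA_dA, zero_add, add_comm]
  obtain ⟨e, he⟩ := H.exists_rb _ h2
  obtain ⟨v, hv⟩ := H.exists_dE_of_x (h := κE f' + br u - g') (by
    rw [← H.br_rb, he, map_add, hg', ← H.dE_br, map_add, H.br_s, map_sub]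
    abel)
  refine ⟨s f', s (κE f') + u - rb v, ?_, ?_⟩
  · rw [map_sub, H.W_rb, sub_zero, h1]
  · rw [map_sub, H.dA_rb, hv, he]
    abel

/-- A cycle of the cone of `W` that is sent to a boundary of `M` comes, up to a boundary, from a cycle of
two copies of `E`. -/
theorem exists_rb_of_neg {f g : A} {r : M} (h : dA f + W g = 0) (hg : dA g = 0)
    (hr : ρ (br f) = dM r) : ∃ e v a b, dE e = 0 ∧ dE v = 0 ∧ rb e - f = dA a + W b ∧
      rb v - g = -dA b := by
  obtain ⟨e, he⟩ := H.exists_x (br f - dE (ι r)) (by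
    rw [map_sub, hr, H.dE_ι, H.ρ_ι, sub_self])
  have hbf : dE (br f) = 0 := by
    rw [H.dE_br, eq_neg_of_add_eq_zero_left h, map_neg, H.br_W, neg_zero]
  have he' : dE e = 0 := H.dE_eq_zero_of_x (by rw [he, map_sub, hbf, H.dE_dE, sub_zero])
  obtain ⟨u, hu⟩ := H.exists_W (f - rb e - dA (s (ι r))) (by
    rw [map_sub, map_sub, H.br_rb, he, ← H.dE_br, H.br_s]
    abel)
  have h1 : W (g + dA u) = 0 := by
    rw [map_add, ← H.dA_W, hu, map_sub, map_sub, H.dA_rb, he', H.dA_dA, map_zero, sub_zero,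
      sub_zero, add_comm, h]
  obtain ⟨v, hv⟩ := H.exists_rb _ h1
  refine ⟨e, v, -s (ι r), -u, he', H.dE_eq_zero_of_rb ?_, ?_, ?_⟩
  · rw [hv, map_add, hg, H.dA_dA, add_zero]
  · rw [map_neg, map_neg, hu]
    abel
  · rw [hv, map_neg]
    abel

/-- A cycle of two copies of `E` whose image in the cone of `W` is a boundary is a boundary. -/
theorem exists_of_rb {f g : E} {a b : A} (h : rb f = dA a + W b)
    (h' : rb g = -dA b) : ∃ u v, f = dE u ∧ g = -dE v := by
  obtain ⟨u, hu⟩ := H.exists_dE_of_x (h := br a) (by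
    rw [← H.br_rb, h, map_add, H.br_W, add_zero, H.dE_br])
  set a' := a - rb u with ha'
  have h1 : dA a' = -W b := by
    rw [ha', map_sub, H.dA_rb, hu, h]
    abel
  have hb : dE (br a') = 0 := by rw [H.dE_br, h1, map_neg, H.br_W, neg_zero]
  obtain ⟨y, hy⟩ := H.exists_W (a' - s (br a')) (by rw [map_sub, H.br_s, sub_self])
  have h2 : W (dA y + b - s (κE (br a'))) = 0 := by
    rw [map_sub, map_add, ← H.dA_W, hy, map_sub, H.dA_s, hb, map_zero, h1]
    abel
  obtain ⟨v, hv⟩ := H.exists_rb _ h2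
  refine ⟨u, v, hu.symm, sub_eq_zero.1 (H.rb_injective _ ?_)⟩
  rw [map_sub, map_neg, ← H.dA_rb, hv, h', map_sub, map_add, H.dA_dA, H.dA_s_κE, hb, map_zero,
    map_zero]
  abel

end IsStabilization

end Chase

/-! ### Exactness on Hochschild homology -/

section Exactness

variable {k : Type} [CommRing k] {m : ℕ}

theorem exists_onChains_eq {n : ℕ} {M N P : Type} [AddCommGroup M] [AddCommGroup N] [AddCommGroup P]
    {φ : M →+ N} {ψ : N →+ P} (h : ∀ y, ψ y = 0 → ∃ x, φ x = y) (f : Finset (Fin n) → N)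
    (hf : onChains n ψ f = 0) : ∃ g, onChains n φ g = f := by
  choose g hg using fun S => h (f S) (congrFun hf S)
  exact ⟨g, funext hg⟩

theorem onChains_injective {n : ℕ} {M N : Type} [AddCommGroup M] [AddCommGroup N] {φ : M →+ N}
    (h : ∀ x, φ x = 0 → x = 0) (f : Finset (Fin n) → M) (hf : onChains n φ f = 0) : f = 0 :=
  funext fun S => h _ (congrFun hf S)

section

variable {M E : Type} [AddCommGroup M] [Module (Env (Poly k (m + 1))) M] [AddCommGroup E]
  [Module (Env (Poly k (m + 1 + 1))) E] {ι : M →+ E}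

theorem IsPolyExt.isReduction_eval (H : IsPolyExt k (m + 1) ι) : IsReduction k m H.eval where
  lef := H.eval_lef
  rig := H.eval_rig
  last x := by rw [lastW_smul_eq_zero H.central, map_zero]

theorem IsPolyExt.isReduction_eval_brE (H : IsPolyExt k (m + 1) ι) :
    IsReduction k m (H.eval.comp (brE k E (Fin.last m)).toAddMonoidHom) where
  lef _ x := (congrArg H.eval (map_smul (brE k E (Fin.last m)) _ x)).trans (H.eval_lef _ _)
  rig _ x := (congrArg H.eval (map_smul (brE k E (Fin.last m)) _ x)).trans (H.eval_rig _ _)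
  last x := (congrArg H.eval (map_smul (brE k E (Fin.last m)) _ x)).trans
    (H.isReduction_eval.last _)

theorem IsPolyExt.ι_wAct (H : IsPolyExt k (m + 1) ι) (a : Fin (m + 1)) (x : M) :
    ι (wAct k (m + 1) M a x) = wAct k (m + 1 + 1) E a.castSucc (ι x) := by
  have := MvPolynomial.rename_X (R := k) Fin.castSucc a
  rw [wAct_apply, wAct_apply, wEnv, wEnv, ← this, sub_smul, sub_smul, map_sub, H.lef_smul,
    H.rig_smul]

theorem swapVars_last_of_lt (a : Fin m) :
    swapVars k (Fin.last m) (MvPolynomial.X a.castSucc.castSucc) =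
      MvPolynomial.X a.castSucc.castSucc :=
  swapVars_of_ne (i := Fin.last m) k
    (fun h => (Fin.castSucc_lt_last a).ne (Fin.castSucc_injective _ h))
    (fun h => (Fin.castSucc_lt_last a.castSucc).ne (h.trans (Fin.succ_last m)))

variable [IsDomain k]

theorem wEnv_smul_secE (hE : IsLastCentral k m E) (b : Fin (m + 1 + 1)) (e : E) :
    secE k E (Fin.last m) (wEnv k (m + 1 + 1) b • e) =
      wEnv k (m + 1 + 1) b • secE k E (Fin.last m) e + lastW k m • secE k E (Fin.last m)
        ((rig (divDiff k (Fin.last m) (MvPolynomial.X b)) : Env (Poly k (m + 1 + 1))) • e) := by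
  rw [wEnv, sub_smul, sub_smul, map_sub, lef_smul_secE, rig_smul_secE hE]
  abel

theorem coordE_wEnv_smul (b : Fin (m + 1 + 1))
    (z : BTensor (Poly k (m + 1 + 1)) E (SB k (Fin.last m))) :
    coordE k E (Fin.last m) (wEnv k (m + 1 + 1) b • z) =
      (lef (MvPolynomial.X b) : Env (Poly k (m + 1 + 1))) • coordE k E (Fin.last m) z -
      ((rig (swapVars k (Fin.last m) (MvPolynomial.X b)) : Env (Poly k (m + 1 + 1))) •
          coordE k E (Fin.last m) z +
        (rig (divDiff k (Fin.last m) (MvPolynomial.X b)) : Env (Poly k (m + 1 + 1))) •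
          brE k E (Fin.last m) z) := by
  rw [wEnv, sub_smul, map_sub, coordE_lef, coordE_rig]

/-- The bimodules `M`, `M[t]` and `M[t] ⊗ B` satisfy the relations from which exactness follows. -/
theorem IsPolyExt.isStabilization (H : IsPolyExt k (m + 1) ι) : IsStabilization
    (koszul (wAct k (m + 1) M)) (koszul fun a => wAct k (m + 1 + 1) E a.castSucc) contractLast
    (koszul fun a => wAct k (m + 1 + 1)
      (BTensor (Poly k (m + 1 + 1)) E (SB k (Fin.last m))) a.castSucc)
    (onChains (m + 1) (wAct k (m + 1 + 1)
      (BTensor (Poly k (m + 1 + 1)) E (SB k (Fin.last m))) (Fin.last (m + 1))))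
    (onChains (m + 1) ι) (onChains (m + 1) H.eval)
    (onChains (m + 1) (DistribSMul.toAddMonoidHom E
      (rig (lastRoot k m) : Env (Poly k (m + 1 + 1)))))
    (onChains (m + 1) (brE k E (Fin.last m)).toAddMonoidHom)
    (onChains (m + 1) (rbE k E (Fin.last m)).toAddMonoidHom)
    (onChains (m + 1) (secE k E (Fin.last m)))
    (onChains (m + 1) (H.eval.comp (coordE k E (Fin.last m)))) where
  dE_dE := koszul_koszul _ fun a b x => wAct_comm _ _ x
  dA_dA := koszul_koszul _ fun a b x => wAct_comm _ _ x
  dE_ι := koszul_onChains _ _ _ H.ι_wAct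
  dM_ρ := koszul_onChains _ _ _ H.isReduction_eval.wEnv_smul
  dE_x := koszul_onChains _ _ _ fun a x => smul_comm _ _ _
  dE_br := koszul_onChains _ _ _ fun a z =>
    map_smul (brE k E (Fin.last m)) (wEnv k (m + 1 + 1) a.castSucc) z
  dA_rb := koszul_onChains _ _ _ fun a x => map_smul (rbE k E (Fin.last m)) _ _
  dA_W := koszul_onChains _ _ _ fun a x => wAct_comm _ _ x
  dA_s f := by
    refine eq_sub_of_add_eq (onChains_koszul_last (fun a => wAct k (m + 1 + 1) E a.castSucc)
      (fun a => wAct k (m + 1 + 1)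
        (BTensor (Poly k (m + 1 + 1)) E (SB k (Fin.last m))) a.castSucc)
      (secE k E (Fin.last m)) ((wAct k (m + 1 + 1)
        (BTensor (Poly k (m + 1 + 1)) E (SB k (Fin.last m))) (Fin.last (m + 1))).comp
          (secE k E (Fin.last m))) (fun a x => ?_) (fun x => ?_) f).symm
    · refine (wEnv_smul_secE H.central _ x).trans ?_
      rw [divDiff_of_invariant k (Fin.last m) (swapVars_last_of_lt a), rig_zero_smul, map_zero,
        smul_zero, add_zero]; rfl
    · refine (wEnv_smul_secE H.central _ x).trans ?_
      rw [divDiff_castSucc, map_one, one_smul]; rfl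
  c_dA f := by
    have hδ := onChains_koszul_last
      (fun a => wAct k (m + 1 + 1)
        (BTensor (Poly k (m + 1 + 1)) E (SB k (Fin.last m))) a.castSucc) (wAct k (m + 1) M)
      (H.eval.comp (coordE k E (Fin.last m)))
      (-H.eval.comp (brE k E (Fin.last m)).toAddMonoidHom) (fun a z => ?_) (fun z => ?_) f
    · rw [hδ, contractLast_onChains, sub_eq_add_neg]; rfl
    · change H.eval (coordE k E (Fin.last m) (wEnv k (m + 1 + 1) a.castSucc.castSucc • z)) =
        wEnv k (m + 1) a.castSucc • H.eval (coordE k E (Fin.last m) z)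
      rw [coordE_wEnv_smul, divDiff_of_invariant k (Fin.last m) (swapVars_last_of_lt a),
        rig_zero_smul, add_zero, swapVars_last_of_lt, ← sub_smul]
      exact H.isReduction_eval.wEnv_smul a.castSucc _
    · refine Eq.trans ?_ (sub_eq_add_neg _ _)
      change H.eval (coordE k E (Fin.last m) (wEnv k (m + 1 + 1) (Fin.last m).castSucc • z)) =
        wEnv k (m + 1) (Fin.last m) • H.eval (coordE k E (Fin.last m) z) -
          H.eval (brE k E (Fin.last m) z)
      have h1 : (MvPolynomial.X (Fin.last m).castSucc : Poly k (m + 1 + 1)) = inc (lastX k m) :=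
        (MvPolynomial.rename_X _ _).symm
      rw [coordE_wEnv_smul, divDiff_castSucc, map_one, one_smul, swapVars_castSucc, Fin.succ_last,
        map_sub, map_add, H.eval_rig_lastX, h1, H.eval_lef, wEnv, sub_smul, sub_sub]
  c_W f := funext fun S => by
    change H.eval (coordE k E (Fin.last m) (lastW k m • f S)) = H.eval (brE k E (Fin.last m) (f S))
    rw [coordE_lastW H.central, map_sub, H.eval_lastRoot, sub_zero]
  κE_κE := contractLast_contractLast
  dE_κE := koszul_contractLast _
  ρ_ι f := funext fun S => H.eval_ι _
  ρ_x f := funext fun S => H.eval_lastRoot _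
  exists_x := exists_onChains_eq fun e he => H.exists_eq_lastRoot_smul he
  x_injective := onChains_injective fun e he => H.lastRoot_smul_injective he
  br_s f := funext fun S => brE_secE _ _
  br_W f := funext fun S => (map_smul (brE k E (Fin.last m)) _ _).trans
    (lastW_smul_eq_zero H.central _)
  br_rb f := funext fun S => brE_rbE _ _
  W_rb f := funext fun S => (map_smul (rbE k E (Fin.last m)) (lastW k m) (f S)).symm.trans
    ((congrArg (rbE k E (Fin.last m)) (lastW_smul_eq_zero H.central _)).trans (map_zero _))
  exists_W := exists_onChains_eq fun z hz => exists_lastW_smul_of_brE_eq_zero H.central hz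
  exists_rb := exists_onChains_eq fun z hz => exists_rbE_of_lastW_smul_eq_zero H.central hz
  rb_injective := onChains_injective fun e he => rbE_injective he

end

section

variable {n : ℕ} {M N : Bimod (Poly k n)}

theorem kosD_kosRes_eq_zero {F : Finset (Fin n) → M} (hF : koszul (wAct k n M) F = 0) (h : ℤ) :
    kosD k n M h (h - 1) (kosRes n M h F) = 0 := by
  rw [kosD_kosRes _ _ (by ring), hF, map_zero]

/-- The class of the component of degree `h` of a cycle. -/
def HHtot (h : ℤ) (F : Finset (Fin n) → M) (hF : koszul (wAct k n M) F = 0) : (HH k n h).obj M :=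
  HHcls (kosRes n M h F) (kosD_kosRes_eq_zero hF h)

theorem exists_HHtot {h : ℤ} (x : (HH k n h).obj M) :
    ∃ F hF, IsChainOfDegree h F ∧ x = HHtot (k := k) (M := M) h F hF := by
  obtain ⟨f, hf, rfl⟩ := HHcls_surjective x
  exact ⟨_, koszul_kosExt_eq_zero hf, isChainOfDegree_kosExt h f,
    HHcls_congr (kosRes_kosExt h f).symm _ _⟩

theorem HHtot_eq {h : ℤ} {F F' G : Finset (Fin n) → M} (hF hF')
    (hG : koszul (wAct k n M) G = F - F') :
    HHtot (k := k) (M := M) h F hF = HHtot (k := k) (M := M) h F' hF' :=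
  (HHcls_eq_iff _ _ _ _).2 ⟨kosRes n M (h + 1) G, by rw [kosD_kosRes _ _ rfl, hG, map_sub]⟩

theorem HHtot_eq_zero {h : ℤ} {F G : Finset (Fin n) → M} (hF) (hG : koszul (wAct k n M) G = F) :
    HHtot (k := k) (M := M) h F hF = 0 :=
  (HHcls_eq_zero_iff _ _).2 ⟨kosRes n M (h + 1) G, by rw [kosD_kosRes _ _ rfl, hG]⟩

theorem exists_koszul_of_HHtot_eq_zero {h : ℤ} {F : Finset (Fin n) → M} (hd : IsChainOfDegree h F)
    (hF) (h0 : HHtot (k := k) (M := M) h F hF = 0) : ∃ G, koszul (wAct k n M) G = F := by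
  obtain ⟨g, hg⟩ := (HHcls_eq_zero_iff _ _).1 h0
  exact ⟨kosExt n M (h + 1) g, by rw [koszul_kosExt _ h rfl, hg, kosExt_kosRes hd]⟩

theorem koszul_map_eq_zero (φ : M ⟶ N) {F : Finset (Fin n) → M} (hF : koszul (wAct k n M) F = 0) :
    koszul (wAct k n N) (onChains n φ.hom.toAddMonoidHom F) = 0 := by
  rw [koszul_onChains (wAct k n M) (wAct k n N) _ (fun a x => map_smul φ.hom _ _), hF, map_zero]

theorem HH_map_HHtot (φ : M ⟶ N) {h : ℤ} (F : Finset (Fin n) → M) (hF) :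
    (HH k n h).map φ (HHtot h F hF) =
      HHtot (k := k) (M := N) h (onChains n φ.hom.toAddMonoidHom F) (koszul_map_eq_zero φ hF) :=
  HH_map_HHcls φ _ _

end

section

variable {N : Bimod (Poly k (m + 1 + 1))} {M : Bimod (Poly k (m + 1))} {q : N →+ M}

theorem IsReduction.posHom_HHtot (hq : IsReduction k m q) {h : ℤ} {F : Finset (Fin (m + 1 + 1)) → N}
    (hd : IsChainOfDegree h F) (hF) : hq.posHom h (HHtot h F hF) =
      HHtot (k := k) (M := M) (h - 1) (posChain q F)
        (by rw [hq.koszul_posChain, hF, map_zero, neg_zero]) := by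
  refine (hq.posHom_HHcls _ _).trans (HHcls_congr ?_ _ _)
  rw [kosExt_kosRes hd]

theorem IsReduction.negHom_HHtot (hq : IsReduction k m q) {h : ℤ} {F : Finset (Fin (m + 1 + 1)) → N}
    (hd : IsChainOfDegree h F) (hF) : hq.negHom h (HHtot h F hF) =
      HHtot (k := k) (M := M) h (negChain q F)
        (by rw [hq.koszul_negChain, hF, map_zero]) := by
  refine (hq.negHom_HHcls _ _).trans (HHcls_congr ?_ _ _)
  rw [kosExt_kosRes hd]

theorem koszul_eq_zero_iff {F : Finset (Fin (m + 1 + 1)) → N} :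
    koszul (wAct k (m + 1 + 1) N) F = 0 ↔
      koszul (fun a => wAct k (m + 1 + 1) N a.castSucc) (low F) +
        onChains (m + 1) (wAct k (m + 1 + 1) N (Fin.last (m + 1))) (top F) = 0 ∧
      koszul (fun a => wAct k (m + 1 + 1) N a.castSucc) (top F) = 0 := by
  rw [← low_koszul, ← neg_eq_zero (a := koszul (fun a => wAct k (m + 1 + 1) N a.castSucc) (top F)),
    ← top_koszul]
  refine ⟨fun h => by rw [h, map_zero, map_zero]; exact ⟨rfl, rfl⟩, fun h => ext_low_top ?_ ?_⟩
  · rw [h.1, map_zero]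
  · rw [h.2, map_zero]

end

section

variable {M : Bimod (Poly k (m + 1))} {E : Bimod (Poly k (m + 1 + 1))} {ι : M →+ E}

variable (k E) in
/-- The bimodule `E ⊗ B`. -/
abbrev tensorSB : Bimod (Poly k (m + 1 + 1)) :=
  ModuleCat.of _ (BTensor (Poly k (m + 1 + 1)) E (SB k (Fin.last m)))

variable (k E) in
/-- The map `E ⊗ B → E`, as a morphism. -/
abbrev brHom : tensorSB k E ⟶ E := ModuleCat.ofHom (brE k E (Fin.last m))

variable (k E) in
/-- The map `E → E ⊗ B`, as a morphism. -/
abbrev rbHom : E ⟶ tensorSB k E := ModuleCat.ofHom (rbE k E (Fin.last m))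

theorem koszul_eq_join (F G : Finset (Fin (m + 1 + 1)) → E)
    (f g : Finset (Fin (m + 1)) → E) (hE : IsLastCentral k m E)
    (hl : low F = koszul (fun a => wAct k (m + 1 + 1) E a.castSucc) f)
    (ht : top F = -koszul (fun a => wAct k (m + 1 + 1) E a.castSucc) g) (hG : G = join f g) :
    koszul (wAct k (m + 1 + 1) E) G = F := by
  have h0 : onChains (m + 1) (wAct k (m + 1 + 1) E (Fin.last (m + 1))) g = 0 :=
    funext fun S => lastW_smul_eq_zero hE _
  subst hG
  refine ext_low_top ?_ ?_
  · rw [low_koszul, low_join, top_join, h0, add_zero, hl]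
  · rw [top_koszul, top_join, ht]

theorem lastCentral_koszul_eq_zero_iff (hE : IsLastCentral k m E)
    {F : Finset (Fin (m + 1 + 1)) → E} : koszul (wAct k (m + 1 + 1) E) F = 0 ↔
      koszul (fun a => wAct k (m + 1 + 1) E a.castSucc) (low F) = 0 ∧
      koszul (fun a => wAct k (m + 1 + 1) E a.castSucc) (top F) = 0 := by
  have h0 : onChains (m + 1) (wAct k (m + 1 + 1) E (Fin.last (m + 1))) (top F) = 0 :=
    funext fun S => lastW_smul_eq_zero hE _
  rw [koszul_eq_zero_iff, h0, add_zero]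

variable (H : IsPolyExt k (m + 1) ι) (h : ℤ)

include H in
/-- The composite `HH_h(E) → HH_h(E ⊗ B) → HH_h(M)` vanishes. -/
theorem IsPolyExt.negHom_rb (x : (HH k (m + 1 + 1) h).obj E) :
    H.isReduction_eval_brE.negHom (N := tensorSB k E) h
      ((HH k (m + 1 + 1) h).map (rbHom k E) x) = 0 := by
  obtain ⟨F, hF, hd, rfl⟩ := exists_HHtot x
  rw [HH_map_HHtot, IsReduction.negHom_HHtot _ (isChainOfDegree_onChains _ hd)]
  refine HHtot_eq_zero _ (G := 0) ?_
  rw [map_zero]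
  refine funext fun S => ?_
  change 0 = H.eval (brE k E (Fin.last m) (rbE k E (Fin.last m) _))
  rw [brE_rbE, H.eval_lastRoot]

variable [IsDomain k]

include H in
/-- The composite `HH_h(E ⊗ B) → HH_h(E) → HH_{h-1}(M)` vanishes. This is where the contraction in
`posChain` is needed. -/
theorem IsPolyExt.posHom_br (x : (HH k (m + 1 + 1) h).obj (tensorSB k E)) :
    H.isReduction_eval.posHom h ((HH k (m + 1 + 1) h).map (brHom k E) x) = 0 := by
  obtain ⟨F, hF, hd, rfl⟩ := exists_HHtot x
  rw [HH_map_HHtot, H.isReduction_eval.posHom_HHtot (isChainOfDegree_onChains _ hd)]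
  refine HHtot_eq_zero _ ((H.isStabilization.pos_br (koszul_eq_zero_iff.1 hF).1).symm.trans ?_)
  rw [posChain_apply, low_onChains, top_onChains, contractLast_onChains, contractLast_onChains,
    contractLast_onChains]
  rfl

theorem IsPolyExt.posHom_surjective : Function.Surjective (H.isReduction_eval.posHom h) := by
  intro y
  obtain ⟨r, hr, hd, rfl⟩ := exists_HHtot y
  have hF : koszul (wAct k (m + 1 + 1) E) (join 0 (onChains (m + 1) ι r)) = 0 := by
    rw [lastCentral_koszul_eq_zero_iff H.central, low_join, top_join, map_zero]
    exact ⟨rfl, by rw [H.isStabilization.dE_ι, hr, map_zero]⟩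
  refine ⟨HHtot h _ hF, ?_⟩
  rw [H.isReduction_eval.posHom_HHtot
    (isChainOfDegree_join (f := 0) (fun _ _ => rfl) (isChainOfDegree_onChains ι hd))]
  refine HHtot_eq _ _ (G := 0) ?_
  rw [posChain_apply, low_join, top_join, map_zero, map_zero, map_zero, H.isStabilization.ρ_ι,
    sub_zero, sub_self]

/-- Exactness of `HH_h(E ⊗ B) → HH_h(E) → HH_{h-1}(M)`. -/
theorem IsPolyExt.exists_br_of_posHom (x : (HH k (m + 1 + 1) h).obj E)
    (hx : H.isReduction_eval.posHom h x = 0) :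
    ∃ y, (HH k (m + 1 + 1) h).map (brHom k E) y = x := by
  obtain ⟨F, hF, hd, rfl⟩ := exists_HHtot x
  rw [H.isReduction_eval.posHom_HHtot hd] at hx
  obtain ⟨r, hr⟩ := exists_koszul_of_HHtot_eq_zero (isChainOfDegree_posChain _ hd) _ hx
  have hF' := (lastCentral_koszul_eq_zero_iff H.central).1 hF
  obtain ⟨f', g', h1, h2, h3, h4⟩ := H.isStabilization.exists_br_of_pos hF'.1 hF'.2 (r := r) (by
    rw [hr, posChain_apply, contractLast_onChains])
  have hA : koszul (wAct k (m + 1 + 1) (tensorSB k E)) (join f' g') = 0 := by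
    rw [koszul_eq_zero_iff, low_join, top_join]
    exact ⟨h1, h2⟩
  refine ⟨HHtot h _ hA, ?_⟩
  rw [HH_map_HHtot]
  refine HHtot_eq _ _ (koszul_eq_join _ _ 0 (onChains (m + 1) ι r) H.central ?_ ?_ rfl)
  · rw [map_sub, low_onChains, low_join, map_zero, sub_eq_zero]
    exact h3
  · rw [map_sub, top_onChains, top_join, ← map_neg]
    exact h4

include H in
theorem IsPolyExt.br_injective (y : (HH k (m + 1 + 1) h).obj (tensorSB k E))
    (hy : (HH k (m + 1 + 1) h).map (brHom k E) y = 0) : y = 0 := by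
  obtain ⟨F, hF, hd, rfl⟩ := exists_HHtot y
  rw [HH_map_HHtot] at hy
  obtain ⟨G, hG⟩ := exists_koszul_of_HHtot_eq_zero (isChainOfDegree_onChains _ hd) _ hy
  have h0 : onChains (m + 1) (wAct k (m + 1 + 1) E (Fin.last (m + 1))) (top G) = 0 :=
    funext fun S => lastW_smul_eq_zero H.central _
  obtain ⟨u, v, h1, h2⟩ := H.isStabilization.exists_of_br (koszul_eq_zero_iff.1 hF).1
    (f' := low G) (g' := top G)
    (by
      have := low_koszul (wAct k (m + 1 + 1) E) G
      rw [hG, h0, add_zero] at this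
      exact this)
    (by
      have := top_koszul (wAct k (m + 1 + 1) E) G
      rw [hG, top_onChains] at this
      exact this)
  refine HHtot_eq_zero (G := join u v) _ (ext_low_top ?_ ?_)
  · rw [low_koszul, low_join, top_join, h1]
  · rw [top_koszul, top_join, h2]

theorem IsPolyExt.negHom_surjective :
    Function.Surjective (H.isReduction_eval_brE.negHom (N := tensorSB k E) h) := by
  intro y
  obtain ⟨r, hr, hd, rfl⟩ := exists_HHtot y
  set e := onChains (m + 1) ι r
  have he : koszul (fun a => wAct k (m + 1 + 1) E a.castSucc) e = 0 := by
    rw [H.isStabilization.dE_ι, hr, map_zero]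
  have hF : koszul (wAct k (m + 1 + 1) (tensorSB k E))
      (join (onChains (m + 1) (secE k E (Fin.last m)) e)
        (onChains (m + 1) (secE k E (Fin.last m)) (contractLast e))) = 0 := by
    rw [koszul_eq_zero_iff, low_join, top_join]
    constructor
    · have := H.isStabilization.dA_s e
      rw [he, map_zero, zero_sub] at this
      exact add_eq_zero_iff_eq_neg.2 this
    · have := H.isStabilization.dA_s_κE e
      rw [he, map_zero, map_zero, neg_zero] at this
      exact this
  refine ⟨HHtot h _ hF, ?_⟩
  have hde := isChainOfDegree_onChains ι hd
  rw [IsReduction.negHom_HHtot _ (isChainOfDegree_join (isChainOfDegree_onChains _ hde)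
    (isChainOfDegree_onChains _ (isChainOfDegree_contractLast hde)))]
  refine HHtot_eq _ _ (G := 0) ?_
  rw [map_zero, eq_comm, sub_eq_zero, negChain_apply, low_join]
  refine funext fun S => ?_
  change H.eval (brE k E (Fin.last m) (secE k E (Fin.last m) (ι (r S)))) = r S
  rw [brE_secE, H.eval_ι]

/-- Exactness of `HH_h(E) → HH_h(E ⊗ B) → HH_h(M)`. -/
theorem IsPolyExt.exists_rb_of_negHom (x : (HH k (m + 1 + 1) h).obj (tensorSB k E))
    (hx : H.isReduction_eval_brE.negHom (N := tensorSB k E) h x = 0) :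
    ∃ y, (HH k (m + 1 + 1) h).map (rbHom k E) y = x := by
  obtain ⟨F, hF, hd, rfl⟩ := exists_HHtot x
  rw [IsReduction.negHom_HHtot _ hd] at hx
  obtain ⟨r, hr⟩ := exists_koszul_of_HHtot_eq_zero (isChainOfDegree_negChain _ hd) _ hx
  have hF' := koszul_eq_zero_iff.1 hF
  obtain ⟨e, v, a, b, h1, h2, h3, h4⟩ := H.isStabilization.exists_rb_of_neg hF'.1 hF'.2 (r := r)
    hr.symm
  have hE : koszul (wAct k (m + 1 + 1) E) (join e v) = 0 := by
    rw [lastCentral_koszul_eq_zero_iff H.central, low_join, top_join]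
    exact ⟨h1, h2⟩
  refine ⟨HHtot h _ hE, ?_⟩
  rw [HH_map_HHtot]
  refine HHtot_eq _ _ (G := join a b) (ext_low_top ?_ ?_)
  · rw [low_koszul, low_join, top_join, map_sub, low_onChains, low_join]
    exact h3.symm
  · rw [top_koszul, top_join, map_sub, top_onChains, top_join]
    exact h4.symm

include H in
theorem IsPolyExt.rb_injective (y : (HH k (m + 1 + 1) h).obj E)
    (hy : (HH k (m + 1 + 1) h).map (rbHom k E) y = 0) : y = 0 := by
  obtain ⟨F, hF, hd, rfl⟩ := exists_HHtot y
  rw [HH_map_HHtot] at hy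
  obtain ⟨G, hG⟩ := exists_koszul_of_HHtot_eq_zero (isChainOfDegree_onChains _ hd) _ hy
  obtain ⟨u, v, h1, h2⟩ := H.isStabilization.exists_of_rb (f := low F) (g := top F) (a := low G)
    (b := top G)
    (by
      have := low_koszul (wAct k (m + 1 + 1) (tensorSB k E)) G
      rw [hG] at this
      exact this)
    (by
      have := top_koszul (wAct k (m + 1 + 1) (tensorSB k E)) G
      rw [hG, top_onChains] at this
      exact this)
  exact HHtot_eq_zero _ (koszul_eq_join _ _ u v H.central h1 h2 rfl)

end

end Exactness

/-! ### Tensor products with the complex of the last generator -/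

section TwoTerm

section

variable {R : Type} [CommRing R] (C D : CochainComplex (Bimod R) ℤ)

/-- The projection to a summand. -/
def tensorProj {j : ℤ} (ab : Deg j) :
    tensorX C D j →ₗ[Env R] BTensor R (C.X ab.1.1) (D.X ab.1.2) :=
  DirectSum.component (Env R) (Deg j) (fun ab => BTensor R (C.X ab.1.1) (D.X ab.1.2)) ab

theorem tensorProj_incl {j : ℤ} (ab : Deg j) (x : BTensor R (C.X ab.1.1) (D.X ab.1.2)) :
    tensorProj C D ab (tensorIncl C D ab x) = x :=
  DirectSum.component.lof_self ..

theorem tensorProj_incl_of_ne {j : ℤ} {ab ab' : Deg j} (h : ab' ≠ ab)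
    (x : BTensor R (C.X ab'.1.1) (D.X ab'.1.2)) :
    tensorProj C D ab (tensorIncl C D ab' x) = 0 :=
  DFinsupp.single_eq_of_ne h.symm

/-- An element is the sum of its components at two positions if the other terms of the complex `D`
vanish. -/
theorem eq_tensorIncl_add {j : ℤ} {ab ab' : Deg j} (hne : ab ≠ ab')
    (h : ∀ cd : Deg j, cd ≠ ab → cd ≠ ab' → Subsingleton (D.X cd.1.2)) (x : tensorX C D j) :
    x = tensorIncl C D ab (tensorProj C D ab x) + tensorIncl C D ab' (tensorProj C D ab' x) := by
  induction x using DirectSum.induction_on with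
  | zero => simp only [map_zero, add_zero]
  | add x y hx hy =>
    rw [map_add, map_add, map_add, map_add]
    nth_rewrite 1 [hx, hy]
    abel
  | of cd y =>
    change tensorIncl C D cd y = _ + _
    by_cases h1 : cd = ab
    · subst h1
      change tensorIncl C D cd y = tensorIncl C D cd (tensorProj C D cd (tensorIncl C D cd y)) +
        tensorIncl C D ab' (tensorProj C D ab' (tensorIncl C D cd y))
      rw [tensorProj_incl, tensorProj_incl_of_ne C D hne, map_zero, add_zero]
    · by_cases h2 : cd = ab'
      · subst h2
        change tensorIncl C D cd y =
          tensorIncl C D ab (tensorProj C D ab (tensorIncl C D cd y)) +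
          tensorIncl C D cd (tensorProj C D cd (tensorIncl C D cd y))
        rw [tensorProj_incl, tensorProj_incl_of_ne C D h1, map_zero, zero_add]
      · have hy : y = 0 := by
          have := h cd h1 h2
          induction y using BTensor.induction with
          | zero => rfl
          | tmul c d =>
            rw [Subsingleton.elim d 0]
            exact map_zero (BTensor.mk R (C.X cd.1.1) (D.X cd.1.2) c)
          | add y z hy hz => rw [hy, hz, add_zero]
        change tensorIncl C D cd y =
          tensorIncl C D ab (tensorProj C D ab (tensorIncl C D cd y)) +
          tensorIncl C D ab' (tensorProj C D ab' (tensorIncl C D cd y))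
        simp only [hy, map_zero, add_zero]

end

variable {k : Type} [CommRing k] {m : ℕ}

/-- A morphism of complexes of abelian groups is a quasi-isomorphism if it is the composite of the
projection of each term `K^j` of the source, with kernel `Y^j`, to a quotient `X^j`, and of a
surjection whose kernel is identified with `Y^{j-1}` by the differential. -/
theorem quasiIso_of_exact {K L : CochainComplex Ab ℤ} (f : K ⟶ L) {X Y : ℤ → Type}
    [∀ j, AddCommGroup (X j)] [∀ j, AddCommGroup (Y j)] (p : ∀ j, K.X j →+ X j)
    (i : ∀ j, Y j →+ K.X j) (g : ∀ j, X j →+ L.X j) (hf : ∀ j x, f.f j x = g j (p j x))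
    (hp : ∀ j, Function.Surjective (p j)) (hg : ∀ j, Function.Surjective (g j))
    (hpi : ∀ j y, p j (i j y) = 0) (hk : ∀ j x, p j x = 0 → ∃ y, i j y = x)
    (hex : ∀ j z, g (j + 1) z = 0 → ∃ y, p (j + 1) (K.d j (j + 1) (i j y)) = z)
    (hinj : ∀ j y, p (j + 1) (K.d j (j + 1) (i j y)) = 0 → y = 0) : QuasiIso f := by
  have hdd : ∀ (j : ℤ) y, K.d (j + 1) (j + 1 + 1) (K.d j (j + 1) y) = 0 := fun j y =>
    ConcreteCategory.congr_hom (K.d_comp_d j (j + 1) (j + 1 + 1)) y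
  refine quasiIso_of_surjective_of_acyclic f (fun j z => ?_) fun j x hx hfx => ?_
  · obtain ⟨y, rfl⟩ := hg j z
    obtain ⟨x, rfl⟩ := hp j y
    exact ⟨x, hf j x⟩
  · rw [hf] at hfx
    obtain ⟨y, hy⟩ := hex j _ hfx
    refine ⟨i j y, ?_, by rw [hf, hpi, map_zero]⟩
    obtain ⟨y', hy'⟩ := hk (j + 1) (x - K.d j (j + 1) (i j y)) (by rw [map_sub, hy, sub_self])
    have h0 : y' = 0 := hinj (j + 1) y' (by rw [hy', map_sub, hx, hdd, sub_zero, map_zero])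
    rw [h0, map_zero] at hy'
    exact (sub_eq_zero.1 hy'.symm).symm

theorem HH_map_comp_apply {n : ℕ} {M N P : Bimod (Poly k n)} (φ : M ⟶ N) (ψ : N ⟶ P) (h : ℤ)
    (x : (HH k n h).obj M) :
    (HH k n h).map ψ ((HH k n h).map φ x) = (HH k n h).map (φ ≫ ψ) x := by
  rw [Functor.map_comp]; rfl

theorem HH_map_id_apply {n : ℕ} {M : Bimod (Poly k n)} (h : ℤ) (x : (HH k n h).obj M) :
    (HH k n h).map (𝟙 M) x = x := by
  rw [CategoryTheory.Functor.map_id]; rfl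

theorem HH_map_add_apply {n : ℕ} {M N : Bimod (Poly k n)} (φ ψ : M ⟶ N) (h : ℤ)
    (x : (HH k n h).obj M) :
    (HH k n h).map (φ + ψ) x = (HH k n h).map φ x + (HH k n h).map ψ x := by
  rw [Functor.map_add]; rfl

theorem HH_map_zero_apply {n : ℕ} {M N : Bimod (Poly k n)} (h : ℤ) (x : (HH k n h).obj M) :
    (HH k n h).map (0 : M ⟶ N) x = 0 := by
  rw [Functor.map_zero]; rfl

theorem HH_map_zsmul_apply {n : ℕ} {M N : Bimod (Poly k n)} (z : ℤ) (φ : M ⟶ N) (h : ℤ)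
    (x : (HH k n h).obj M) : (HH k n h).map (z • φ) x = z • (HH k n h).map φ x := by
  rw [Functor.map_zsmul]; rfl

section

variable {N N' : Bimod (Poly k (m + 1 + 1))} {M : Bimod (Poly k (m + 1))} {q : N →+ M}

theorem IsReduction.comp (hq : IsReduction k m q) (φ : N' ⟶ N) :
    IsReduction k m (q.comp φ.hom.toAddMonoidHom) where
  lef _ x := (congrArg q (map_smul φ.hom _ x)).trans (hq.lef _ _)
  rig _ x := (congrArg q (map_smul φ.hom _ x)).trans (hq.rig _ _)
  last x := (congrArg q (map_smul φ.hom _ x)).trans (hq.last _)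

theorem IsReduction.posHom_comp (hq : IsReduction k m q) (φ : N' ⟶ N) (h : ℤ) :
    (hq.comp φ).posHom h = (HH k (m + 1 + 1) h).map φ ≫ hq.posHom h := by
  have := (hq.comp φ).posHom_natural hq φ (𝟙 M) (fun _ => rfl) h
  rw [this, CategoryTheory.Functor.map_id, Category.comp_id]

theorem IsReduction.negHom_comp (hq : IsReduction k m q) (φ : N' ⟶ N) (h : ℤ) :
    (hq.comp φ).negHom h = (HH k (m + 1 + 1) h).map φ ≫ hq.negHom h := by
  have := (hq.comp φ).negHom_natural hq φ (𝟙 M) (fun _ => rfl) h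
  rw [this, CategoryTheory.Functor.map_id, Category.comp_id]

end

/-! ### Degrees and reduced powers of the evaluation of a product -/

section

variable {M E N : Type} [AddCommGroup M] [Module (Env (Poly k (m + 1))) M] [AddCommGroup E]
  [Module (Env (Poly k (m + 1 + 1))) E] [AddCommGroup N] [Module (Env (Poly k (m + 1 + 1))) N]
  {ι : M →+ E} (f : N →ₗ[Env (Poly k (m + 1 + 1))] UB k (m + 1 + 1))

theorem IsPolyExt.eval_mulBy_mem (H : IsPolyExt k (m + 1) ι) {gM : ℤ → AddSubgroup M}
    {gE : ℤ → AddSubgroup E} {gN : ℤ → AddSubgroup N} (h : IsGradedExt k (m + 1) gM gE ι)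
    (hs : IsRigStable k (m + 1) gM) {a : ℤ}
    (hf : ∀ d, ∀ x ∈ gN d, ofUB (f x) ∈ polyDeg (k := k) (d + a)) {d : ℤ}
    {z : BTensor (Poly k (m + 1 + 1)) E N} (hz : z ∈ tensorDeg k (m + 1 + 1) gE gN d) :
    H.eval (mulBy E f z) ∈ gM (d + a) := by
  induction hz using AddSubgroup.closure_induction with
  | zero => rw [map_zero, map_zero]; exact AddSubgroup.zero_mem _
  | add x y _ _ hx hy => rw [map_add, map_add]; exact AddSubgroup.add_mem _ hx hy
  | neg x _ hx => rw [map_neg, map_neg]; exact AddSubgroup.neg_mem _ hx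
  | mem x hx =>
    obtain ⟨d₁, d₂, c, c', hd, hc, hc', rfl⟩ := hx
    rw [← hd, add_assoc]
    exact H.eval_rig_mem h hs hc (hf d₂ c' hc')

/-- The evaluation of a product commutes with the reduced powers if the second factor does so up to
multiples of `x - t`. -/
theorem IsPolyExt.eval_mulBy_power (H : IsPolyExt k (m + 1) ι) {p : ℕ} {oM : PowerOps k (m + 1) p M}
    {oE : PowerOps k (m + 1 + 1) p E} {oN : PowerOps k (m + 1 + 1) p N} (h : IsPowerExt oM oE ι)
    (hf : ∀ b c, ∃ r, ofUB (f (oN.P b c)) =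
      PowerSeries.coeff c (powT p (ofUB (f b))) + r * lastRoot k m)
    (z : BTensor (Poly k (m + 1 + 1)) E N) (c : ℕ) :
    H.eval (mulBy E f ((oE.tensor oN).P z c)) = oM.P (H.eval (mulBy E f z)) c := by
  induction z using BTensor.induction with
  | zero => simp only [map_zero, Pi.zero_apply]
  | add x y hx hy => simp only [map_add, Pi.add_apply, hx, hy]
  | tmul e b =>
    have h1 : H.eval (mulBy E f ((oE.tensor oN).P (BTensor.tmul e b) c)) =
        ∑ ij ∈ Finset.HasAntidiagonal.antidiagonal c,
          H.eval ((rig (ofUB (f (oN.P b ij.2))) : Env (Poly k (m + 1 + 1))) • oE.P e ij.1) := by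
      change H.eval (mulBy E f (tconv (oE.P e) (oN.P b) c)) = _
      rw [tconv, map_sum, map_sum]; rfl
    rw [h1, mulBy_tmul, ← H.eval_power h, oE.cartan_right, conv, map_sum,
      ← Finset.Nat.sum_antidiagonal_swap]
    refine Finset.sum_congr rfl fun ij _ => ?_
    obtain ⟨r, hr⟩ := hf b ij.1
    rw [Prod.snd_swap, Prod.fst_swap, hr, PowerSeries.coeff_map, map_add, add_smul, map_add,
      mul_comm, map_mul, mul_smul, H.eval_lastRoot, add_zero]

end

theorem ofUB_id_unitOps {n : ℕ} {p : ℕ} (b : UB k n) (c : ℕ) :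
    ofUB ((LinearMap.id : UB k n →ₗ[Env (Poly k n)] UB k n) ((unitOps p).P b c)) =
      PowerSeries.coeff c (powT p (ofUB ((LinearMap.id : UB k n →ₗ[Env (Poly k n)] UB k n) b))) :=
  rfl

theorem ofUB_br (i : Fin m) (b : SB k i) : ofUB (br k i b) = sbMulPoly k i b := rfl

theorem sbMulPoly_sbOps (i : Fin m) {p : ℕ} (b : SB k i) (c : ℕ) :
    sbMulPoly k i ((sbOps p i).P b c) = PowerSeries.coeff c (powT p (sbMulPoly k i b)) := by
  change sbMulPoly k i (PowerSeries.coeff c (sbPow p i b)) = _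
  rw [← PowerSeries.coeff_map]
  congr 1
  have hl : ∀ f : PowerSeries (Poly k (m + 1)),
      PowerSeries.map (sbMulPoly k i) (PowerSeries.map (sbLeft k i) f) = f := fun f => by
    ext1 c
    rw [PowerSeries.coeff_map, PowerSeries.coeff_map, sbMulPoly_left]
  have hr : ∀ f : PowerSeries (Poly k (m + 1)),
      PowerSeries.map (sbMulPoly k i) (PowerSeries.map (sbRight k i) f) = f := fun f => by
    ext1 c
    rw [PowerSeries.coeff_map, PowerSeries.coeff_map, sbMulPoly_right]
  induction b using SB.induction with
  | zero => simp only [map_zero]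
  | add x y hx hy => simp only [map_add, hx, hy]
  | tmul a b => rw [sbPow_mul, map_mul, hl, hr, map_mul, map_mul, sbMulPoly_left, sbMulPoly_right]

/-- After multiplication `B_i → R`, the twist by the Thom class is not seen modulo `x_i - x_{i+1}`. -/
theorem exists_ofUB_br_twist (i : Fin m) {p : ℕ} (hp : p.Prime) (b : SB k i) (c : ℕ) :
    ∃ r, ofUB (br k i (((sbOps p i).twist (zEnv k i)).P b c)) =
      PowerSeries.coeff c (powT p (ofUB (br k i b))) + r * root k i := by
  have hz : ∀ x : SB k i, ofUB (br k i (zEnv k i • x)) = root k i * sbMulPoly k i x := fun x => by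
    rw [ofUB_br, sb_smul, map_mul]
    change sbMulPoly k i (zeta k i) * _ = _
    rw [zeta_eq, map_sub, sbMulPoly_left, sbMulPoly_right, root]
  have hc : ((sbOps p i).twist (zEnv k i)).P b c = (sbOps p i).P b c - zEnv k i •
      conv (PowerSeries.C (zEnv k i ^ (p - 2)) * (PowerSeries.X * thomInv p (zEnv k i)))
        ((sbOps p i).P b) c := by
    change conv (thomInv p (zEnv k i)) ((sbOps p i).P b) c = _
    have h1 : thomInv p (zEnv k i) = PowerSeries.C 1 - PowerSeries.C (zEnv k i) *
        (PowerSeries.C (zEnv k i ^ (p - 2)) * (PowerSeries.X * thomInv p (zEnv k i))) := by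
      have h2 := thomInv_mul p (zEnv k i)
      have h3 : zEnv k i ^ (p - 1) = zEnv k i * zEnv k i ^ (p - 2) := by
        rw [← pow_succ']
        congr 1
        have := hp.two_le
        omega
      rw [h3, map_mul] at h2
      rw [map_one]
      linear_combination h2
    nth_rewrite 1 [h1]
    rw [conv_sub_left, Pi.sub_apply, conv_C, one_smul, conv_mul, conv_C]
  refine ⟨-sbMulPoly k i (conv (PowerSeries.C (zEnv k i ^ (p - 2)) *
    (PowerSeries.X * thomInv p (zEnv k i))) ((sbOps p i).P b) c), ?_⟩
  rw [hc, map_sub, map_sub, hz, ofUB_br, sbMulPoly_sbOps, ofUB_br]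
  ring

theorem sbMulPoly_mem (i : Fin m) {d : ℤ} {b : SB k i} (hb : b ∈ sbDeg i d) :
    sbMulPoly k i b ∈ polyDeg (k := k) d := by
  induction hb using AddSubgroup.closure_induction with
  | zero => rw [map_zero]; exact AddSubgroup.zero_mem _
  | add x y _ _ hx hy => rw [map_add]; exact AddSubgroup.add_mem _ hx hy
  | neg x _ hx => rw [map_neg]; exact AddSubgroup.neg_mem _ hx
  | mem x hx =>
    obtain ⟨d₁, d₂, a, b, hd, ha, hb, rfl⟩ := hx
    rw [map_mul, sbMulPoly_left, sbMulPoly_right, ← hd]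
    exact mul_mem_polyDeg ha hb

theorem tensorProj_mem {n : ℕ} {C D : CochainComplex (Bimod (Poly k n)) ℤ} {gC : Degrees C}
    {gD : Degrees D} {j d : ℤ} {x : tensorX C D j} (hx : x ∈ tensorDegrees gC gD j d) (ab : Deg j) :
    tensorProj C D ab x ∈ tensorDeg k n (gC ab.1.1) (gD ab.1.2) d := by
  have : (tensorDegrees gC gD j d : AddSubgroup (tensorX C D j)) ≤ AddSubgroup.comap
      (tensorProj C D ab).toAddMonoidHom (tensorDeg k n (gC ab.1.1) (gD ab.1.2) d) := by
    refine iSup_le fun cd => ?_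
    rintro _ ⟨y, hy, rfl⟩
    change tensorProj C D ab (tensorIncl C D cd y) ∈ tensorDeg k n (gC ab.1.1) (gD ab.1.2) d
    by_cases h : cd = ab
    · subst h
      rw [tensorProj_incl]
      exact hy
    · rw [tensorProj_incl_of_ne C D h]
      exact AddSubgroup.zero_mem _
  exact this hx

end TwoTerm

section LastGenerator

variable {k : Type} [CommRing k] {m : ℕ}

theorem HH_map_split {n : ℕ} {K A B : Bimod (Poly k n)} {p : K ⟶ A} {s : A ⟶ K} {q : K ⟶ B}
    {t : B ⟶ K} (h1 : p ≫ s + q ≫ t = 𝟙 K) (h : ℤ) (x : (HH k n h).obj K) :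
    x = (HH k n h).map s ((HH k n h).map p x) + (HH k n h).map t ((HH k n h).map q x) := by
  rw [HH_map_comp_apply, HH_map_comp_apply, ← HH_map_add_apply, h1, HH_map_id_apply]

/-! ### The complex of the positive generator -/

section Pos

variable (D : CochainComplex (Bimod (Poly k (m + 1 + 1))) ℤ)

/-- The position of `D^j ⊗ R` in degree `j` of `D ⊗ F(σ)` and of `D ⊗ F(σ⁻¹)`. -/
abbrev unitIdx (j : ℤ) : Deg j := ⟨(j, 0), add_zero j⟩

/-- The position of `D^{j+1} ⊗ B` in degree `j` of `D ⊗ F(σ)`. -/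
abbrev posSBIdx (j : ℤ) : Deg j := ⟨(j + 1, -1), add_neg_cancel_right j 1⟩

theorem posComplex_d_neg_one (i : Fin m) : (posComplex k i).d (-1) 0 = posD k i (-1) :=
  CochainComplex.of_d (posX k i) (posD k i) (-1)

theorem posComplex_d_zero (i : Fin m) : (posComplex k i).d 0 1 = 0 :=
  CochainComplex.of_d (posX k i) (posD k i) 0

/-- `D ⊗ F(σ)` in degree `j`, projected to `D^j ⊗ R = D^j`. -/
def posUnitProj (j : ℤ) : (tensorComplex D (posComplex k (Fin.last m))).X j ⟶ D.X j :=
  ModuleCat.ofHom (mulBy (D.X j) (LinearMap.id : UB k (m + 1 + 1) →ₗ[Env (Poly k (m + 1 + 1))] _) ∘ₗ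
    tensorProj D (posComplex k (Fin.last m)) (unitIdx j))

/-- The inclusion of `D^j = D^j ⊗ R` in degree `j` of `D ⊗ F(σ)`. -/
def posUnitIncl (j : ℤ) : D.X j ⟶ (tensorComplex D (posComplex k (Fin.last m))).X j :=
  ModuleCat.ofHom (tensorIncl D (posComplex k (Fin.last m)) (unitIdx j) ∘ₗ
    tensorOne k (m + 1 + 1) (D.X j))

/-- `D ⊗ F(σ)` in degree `j`, projected to `D^{j+1} ⊗ B`. -/
def posSBProj (j : ℤ) :
    (tensorComplex D (posComplex k (Fin.last m))).X j ⟶ tensorSB k (D.X (j + 1)) :=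
  ModuleCat.ofHom (tensorProj D (posComplex k (Fin.last m)) (posSBIdx j))

/-- The inclusion of `D^{j+1} ⊗ B` in degree `j` of `D ⊗ F(σ)`. -/
def posSBIncl (j : ℤ) :
    tensorSB k (D.X (j + 1)) ⟶ (tensorComplex D (posComplex k (Fin.last m))).X j :=
  ModuleCat.ofHom (tensorIncl D (posComplex k (Fin.last m)) (posSBIdx j))

theorem posSBIdx_ne (j : ℤ) : posSBIdx j ≠ unitIdx j := fun h => by
  have := congrArg (fun ab : Deg j => ab.1.2) h
  simp at this

theorem posUnitIncl_proj (j : ℤ) : posUnitIncl D j ≫ posUnitProj D j = 𝟙 _ := by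
  refine ModuleCat.hom_ext (LinearMap.ext fun x => ?_)
  exact (congrArg (mulBy (D.X j) (LinearMap.id : UB k (m + 1 + 1) →ₗ[Env (Poly k (m + 1 + 1))] _))
    (tensorProj_incl D (posComplex k (Fin.last m)) (unitIdx j)
      (tensorOne k (m + 1 + 1) (D.X j) x))).trans (mulBy_tensorOne x)

theorem posSBIncl_proj (j : ℤ) : posSBIncl D j ≫ posUnitProj D j = 0 := by
  refine ModuleCat.hom_ext (LinearMap.ext fun x => ?_)
  exact (congrArg (mulBy (D.X j) (LinearMap.id : UB k (m + 1 + 1) →ₗ[Env (Poly k (m + 1 + 1))] _))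
    (tensorProj_incl_of_ne D (posComplex k (Fin.last m)) (posSBIdx_ne j) x)).trans (map_zero _)

theorem posX_subsingleton (i : Fin m) (b : ℤ) (h0 : b ≠ 0) (h1 : b ≠ -1) :
    Subsingleton ((posComplex k i).X b) := by
  match b with
  | .ofNat 0 => exact absurd rfl h0
  | .ofNat (_ + 1) => exact inferInstanceAs (Subsingleton PUnit)
  | .negSucc 0 => exact absurd rfl h1
  | .negSucc (_ + 1) => exact inferInstanceAs (Subsingleton PUnit)

/-- In each degree, `D ⊗ F(σ)` is the direct sum of `D^j ⊗ R` and `D^{j+1} ⊗ B`. -/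
theorem posSplit (j : ℤ) :
    posUnitProj D j ≫ posUnitIncl D j + posSBProj D j ≫ posSBIncl D j = 𝟙 _ := by
  refine ModuleCat.hom_ext (LinearMap.ext fun x => ?_)
  refine Eq.trans ?_ (eq_tensorIncl_add D (posComplex k (Fin.last m)) (posSBIdx_ne j).symm
    (fun cd h0 h1 => posX_subsingleton _ _ (fun h => h0 ?_) fun h => h1 ?_) x).symm
  · exact congrArg₂ (· + ·) (congrArg (tensorIncl D (posComplex k (Fin.last m)) (unitIdx j))
      (tensorOne_mulBy _)) rfl
  · obtain ⟨⟨a, b⟩, hab⟩ := cd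
    obtain rfl : b = 0 := h
    obtain rfl : a = j := by simpa using hab
    rfl
  · obtain ⟨⟨a, b⟩, hab⟩ := cd
    obtain rfl : b = -1 := h
    obtain rfl : a = j + 1 := by simp only at hab; omega
    rfl

/-- The component `D^j → D^{j+1}` of the differential of `D ⊗ F(σ)`. -/
theorem posUnitIncl_d_proj (j : ℤ) : posUnitIncl D j ≫
    (tensorComplex D (posComplex k (Fin.last m))).d j (j + 1) ≫ posUnitProj D (j + 1) =
      D.d j (j + 1) := by
  rw [tensorComplex_d]
  refine ModuleCat.hom_ext (LinearMap.ext fun x => ?_)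
  change (posUnitProj D (j + 1)).hom (tensorD D (posComplex k (Fin.last m)) j
    (tensorIncl D (posComplex k (Fin.last m)) (unitIdx j) (tensorOne k (m + 1 + 1) (D.X j) x))) = _
  have h1 := tensorD_incl D (posComplex k (Fin.last m)) (unitIdx j)
    (tensorOne k (m + 1 + 1) (D.X j) x)
  have h2 : tensorDRight D (posComplex k (Fin.last m)) (unitIdx j)
      (tensorOne k (m + 1 + 1) (D.X j) x) = 0 := by
    have := congrArg ModuleCat.Hom.hom (posComplex_d_zero (k := k) (Fin.last m))
    change tensorIncl D (posComplex k (Fin.last m)) (unitIdx j).incr (BTensor.tmul x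
      (((posComplex k (Fin.last m)).d 0 1).hom (toUB 1))) = 0
    rw [this]
    exact (congrArg (tensorIncl D (posComplex k (Fin.last m)) (unitIdx j).incr)
      (map_zero (BTensor.mk (Poly k (m + 1 + 1)) (D.X j) ((posComplex k (Fin.last m)).X 1) x))).trans
        (map_zero _)
  rw [h1, h2, smul_zero, add_zero]
  refine (congrArg (mulBy (D.X (j + 1))
    (LinearMap.id : UB k (m + 1 + 1) →ₗ[Env (Poly k (m + 1 + 1))] _))
    (tensorProj_incl D (posComplex k (Fin.last m)) (unitIdx (j + 1)) _)).trans ?_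
  exact mulBy_tensorOne ((D.d j (j + 1)).hom x)

/-- The component `D^{j+1} ⊗ B → D^{j+1}` of the differential of `D ⊗ F(σ)`. -/
theorem posSBIncl_d_proj (j : ℤ) : posSBIncl D j ≫
    (tensorComplex D (posComplex k (Fin.last m))).d j (j + 1) ≫ posUnitProj D (j + 1) =
      ((j + 1).negOnePow : ℤ) • brHom k (D.X (j + 1)) := by
  rw [tensorComplex_d]
  refine ModuleCat.hom_ext (BTensor.linear_ext fun e b => ?_)
  change (posUnitProj D (j + 1)).hom (tensorD D (posComplex k (Fin.last m)) j
    (tensorIncl D (posComplex k (Fin.last m)) (posSBIdx j) (BTensor.tmul e b))) = _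
  have h1 := tensorD_incl D (posComplex k (Fin.last m)) (posSBIdx j) (BTensor.tmul e b)
  have hadd : ∀ (z : ℤ) (x y : tensorX D (posComplex k (Fin.last m)) (j + 1)),
      (posUnitProj D (j + 1)).hom (x + z • y) =
        (posUnitProj D (j + 1)).hom x + z • (posUnitProj D (j + 1)).hom y := fun z x y =>
    (map_add _ _ _).trans (congrArg _ (map_zsmul _ _ _))
  rw [h1, hadd]
  have h2 : (posUnitProj D (j + 1)).hom (tensorDLeft D (posComplex k (Fin.last m)) (posSBIdx j)
      (BTensor.tmul e b)) = 0 :=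
    (congrArg (mulBy (D.X (j + 1))
      (LinearMap.id : UB k (m + 1 + 1) →ₗ[Env (Poly k (m + 1 + 1))] _))
      (tensorProj_incl_of_ne D (posComplex k (Fin.last m)) (posSBIdx_ne (j + 1)) _)).trans
        (map_zero _)
  rw [h2, zero_add]
  refine congrArg (((j + 1).negOnePow : ℤ) • ·) ?_
  refine (congrArg (mulBy (D.X (j + 1))
    (LinearMap.id : UB k (m + 1 + 1) →ₗ[Env (Poly k (m + 1 + 1))] _))
    (tensorProj_incl D (posComplex k (Fin.last m)) (unitIdx (j + 1)) _)).trans ?_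
  have h3 := congrArg ModuleCat.Hom.hom (posComplex_d_neg_one (k := k) (Fin.last m))
  change (rig (ofUB (((posComplex k (Fin.last m)).d (-1) 0).hom b)) : Env (Poly k (m + 1 + 1))) • e =
    _
  rw [h3]; rfl

theorem HH_posUnit_d (h j : ℤ) (y : (HH k (m + 1 + 1) h).obj (D.X j)) :
    (HH k (m + 1 + 1) h).map (posUnitProj D (j + 1)) ((HH k (m + 1 + 1) h).map
      ((tensorComplex D (posComplex k (Fin.last m))).d j (j + 1))
        ((HH k (m + 1 + 1) h).map (posUnitIncl D j) y)) =
      (HH k (m + 1 + 1) h).map (D.d j (j + 1)) y := by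
  rw [HH_map_comp_apply, HH_map_comp_apply, posUnitIncl_d_proj]

theorem HH_posSB_d (h j : ℤ) (y : (HH k (m + 1 + 1) h).obj (tensorSB k (D.X (j + 1)))) :
    (HH k (m + 1 + 1) h).map (posUnitProj D (j + 1)) ((HH k (m + 1 + 1) h).map
      ((tensorComplex D (posComplex k (Fin.last m))).d j (j + 1))
        ((HH k (m + 1 + 1) h).map (posSBIncl D j) y)) =
      ((j + 1).negOnePow : ℤ) • (HH k (m + 1 + 1) h).map (brHom k (D.X (j + 1))) y := by
  rw [HH_map_comp_apply, HH_map_comp_apply, posSBIncl_d_proj, HH_map_zsmul_apply]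

variable {D} {C : CochainComplex (Bimod (Poly k (m + 1))) ℤ} {gC : Degrees C} {gD : Degrees D}
  {oC : ∀ p, PowerFamily p C} {oD : ∀ p, PowerFamily p D} {ι : ∀ j, C.X j →+ D.X j}

theorem IsPolyExtComplex.isReduction_pos (H : IsPolyExtComplex gC gD oC oD ι) (j : ℤ) :
    IsReduction k m ((H.ext j).eval.comp (posUnitProj D j).hom.toAddMonoidHom) :=
  (H.ext j).isReduction_eval.comp _

theorem IsPolyExtComplex.eval_d (H : IsPolyExtComplex gC gD oC oD ι) (j : ℤ) (x : D.X j) :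
    (H.ext (j + 1)).eval ((D.d j (j + 1)).hom x) = (C.d j (j + 1)).hom ((H.ext j).eval x) :=
  (H.ext j).eval_natural (H.ext (j + 1)) _ _ (H.comm j) x

variable [IsDomain k]

theorem IsPolyExtComplex.posHom_d (H : IsPolyExtComplex gC gD oC oD ι) (h j : ℤ)
    (x : (HH k (m + 1 + 1) h).obj ((tensorComplex D (posComplex k (Fin.last m))).X j)) :
    (H.isReduction_pos (j + 1)).posHom h ((HH k (m + 1 + 1) h).map
      ((tensorComplex D (posComplex k (Fin.last m))).d j (j + 1)) x) =
    (HH k (m + 1) (h - 1)).map (C.d j (j + 1)) ((H.isReduction_pos j).posHom h x) := by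
  have e1 : ∀ (j : ℤ) y, (H.isReduction_pos j).posHom h y =
      (H.ext j).isReduction_eval.posHom h ((HH k (m + 1 + 1) h).map (posUnitProj D j) y) :=
    fun j y => ConcreteCategory.congr_hom ((H.ext j).isReduction_eval.posHom_comp _ h) y
  have e2 : ∀ y, (H.ext (j + 1)).isReduction_eval.posHom h
      ((HH k (m + 1 + 1) h).map (D.d j (j + 1)) y) =
      (HH k (m + 1) (h - 1)).map (C.d j (j + 1)) ((H.ext j).isReduction_eval.posHom h y) :=
    fun y => ConcreteCategory.congr_hom ((H.ext j).isReduction_eval.posHom_natural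
      (H.ext (j + 1)).isReduction_eval _ _ (H.eval_d j) h) y
  rw [e1, e1]
  nth_rewrite 1 [HH_map_split (posSplit D j) h x]
  rw [map_add, map_add, map_add, HH_posUnit_d, HH_posSB_d, map_zsmul, (H.ext (j + 1)).posHom_br,
    smul_zero, add_zero, e2]

/-- The map that lowers the Hochschild degree, for the positive generator. -/
def IsPolyExtComplex.posMap (H : IsPolyExtComplex gC gD oC oD ι) (h : ℤ) :
    HHComplex (tensorComplex D (posComplex k (Fin.last m))) h ⟶ HHComplex C (h - 1) where
  f j := (H.isReduction_pos j).posHom h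
  comm' i j hij := by
    obtain rfl : i + 1 = j := hij
    exact ConcreteCategory.hom_ext _ _ fun x => (H.posHom_d h i x).symm

theorem IsPolyExtComplex.quasiIso_posMap (H : IsPolyExtComplex gC gD oC oD ι) (h : ℤ) :
    QuasiIso (H.posMap h) := by
  refine quasiIso_of_exact (H.posMap h)
    (X := fun j => (HH k (m + 1 + 1) h).obj (D.X j))
    (Y := fun j => (HH k (m + 1 + 1) h).obj (tensorSB k (D.X (j + 1))))
    (fun j => ((HH k (m + 1 + 1) h).map (posUnitProj D j)).hom)
    (fun j => ((HH k (m + 1 + 1) h).map (posSBIncl D j)).hom)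
    (fun j => ((H.ext j).isReduction_eval.posHom h).hom)
    (fun j x => ConcreteCategory.congr_hom ((H.ext j).isReduction_eval.posHom_comp _ h) x)
    (fun j x => ⟨(HH k (m + 1 + 1) h).map (posUnitIncl D j) x, ?_⟩)
    (fun j => (H.ext j).posHom_surjective h) (fun j y => ?_)
    (fun j x hx => ⟨(HH k (m + 1 + 1) h).map (posSBProj D j) x, ?_⟩) (fun j z hz => ?_)
    (fun j y hy => ?_)
  · refine (HH_map_comp_apply _ _ _ _).trans ?_
    rw [posUnitIncl_proj, HH_map_id_apply]
  · refine (HH_map_comp_apply _ _ _ _).trans ?_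
    rw [posSBIncl_proj, HH_map_zero_apply]
  · refine Eq.trans ?_ (HH_map_split (posSplit D j) h x).symm
    refine (zero_add _).symm.trans (congrArg (· + _) ?_)
    exact ((congrArg _ hx).trans (map_zero _)).symm
  · obtain ⟨y, rfl⟩ := (H.ext (j + 1)).exists_br_of_posHom h z hz
    refine ⟨((j + 1).negOnePow : ℤ) • y, (HH_posSB_d D h j _).trans ?_⟩
    rw [map_zsmul, smul_smul, Int.units_coe_mul_self, one_smul]
  · have h1 := (HH_posSB_d D h j y).symm.trans hy
    have h2 := congrArg (((j + 1).negOnePow : ℤ) • ·) h1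
    simp only [smul_smul, Int.units_coe_mul_self, one_smul, smul_zero] at h2
    exact (H.ext (j + 1)).br_injective h y h2

theorem IsPolyExtComplex.isPolyLinear_posMap (H : IsPolyExtComplex gC gD oC oD ι) (h : ℤ) :
    IsPolyLinear (τ := fun j => j) (H.posMap h).f :=
  fun j r => (H.isReduction_pos j).posHom_HHAct h r

theorem IsPolyExtComplex.isHomogeneousOfDegree_posMap (H : IsPolyExtComplex gC gD oC oD ι) (h : ℤ) :
    IsHomogeneousOfDegree (τ := fun j => j) (tensorDegrees gD (posDegrees (Fin.last m))) gC (-2)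
      (H.posMap h).f := fun j d => by
  refine (H.isReduction_pos j).posHom_mem (fun d x hx => ?_) h d
  have := (H.ext j).eval_mulBy_mem (a := 0)
    (LinearMap.id : UB k (m + 1 + 1) →ₗ[Env (Poly k (m + 1 + 1))] _) (H.graded j) (H.stable j)
    (gN := ubDeg) (fun d x hx => by rw [add_zero]; exact hx) (tensorProj_mem hx (unitIdx j))
  rw [add_zero] at this
  exact this

theorem IsPolyExtComplex.respectsPowers_posMap (H : IsPolyExtComplex gC gD oC oD ι) (h : ℤ)
    (p : ℕ) [CharP k p] [Fact p.Prime] :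
    RespectsPowers (τ := fun j => j) (tensorPowers (oD p) (posPowers p (Fin.last m))) (oC p)
      (H.posMap h).f := fun j c =>
  (H.isReduction_pos j).posHom_HHPow (fun x c => (H.ext j).eval_mulBy_power
    (LinearMap.id : UB k (m + 1 + 1) →ₗ[Env (Poly k (m + 1 + 1))] _) (H.power p j)
    (fun b c => ⟨0, by rw [zero_mul, add_zero]; exact ofUB_id_unitOps b c⟩) _ c) c h

end Pos

end LastGenerator

section LastGenerator

variable {k : Type} [CommRing k] {m : ℕ}

/-! ### The complex of the negative generator -/

section Neg

variable (D : CochainComplex (Bimod (Poly k (m + 1 + 1))) ℤ)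

/-- The position of `D^a ⊗ B` in degree `j = a + 1` of `D ⊗ F(σ⁻¹)`. -/
abbrev negSBIdx {a j : ℤ} (h : a + 1 = j) : Deg j := ⟨(a, 1), h⟩

theorem negComplex_d_zero (i : Fin m) : (negComplex k i).d 0 1 = negD k i 0 :=
  CochainComplex.of_d (negX k i) (negD k i) 0

theorem negComplex_d_one (i : Fin m) : (negComplex k i).d 1 2 = 0 :=
  CochainComplex.of_d (negX k i) (negD k i) 1

/-- `D ⊗ F(σ⁻¹)` in degree `j = a + 1`, projected to `D^a ⊗ B`. -/
def negSBProj {a j : ℤ} (h : a + 1 = j) :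
    (tensorComplex D (negComplex k (Fin.last m))).X j ⟶ tensorSB k (D.X a) :=
  ModuleCat.ofHom (tensorProj D (negComplex k (Fin.last m)) (negSBIdx h))

/-- The inclusion of `D^a ⊗ B` in degree `j = a + 1` of `D ⊗ F(σ⁻¹)`. -/
def negSBIncl {a j : ℤ} (h : a + 1 = j) :
    tensorSB k (D.X a) ⟶ (tensorComplex D (negComplex k (Fin.last m))).X j :=
  ModuleCat.ofHom (tensorIncl D (negComplex k (Fin.last m)) (negSBIdx h))

/-- `D ⊗ F(σ⁻¹)` in degree `j`, projected to `D^j ⊗ R = D^j`. -/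
def negUnitProj (j : ℤ) : (tensorComplex D (negComplex k (Fin.last m))).X j ⟶ D.X j :=
  ModuleCat.ofHom (mulBy (D.X j) (LinearMap.id : UB k (m + 1 + 1) →ₗ[Env (Poly k (m + 1 + 1))] _) ∘ₗ
    tensorProj D (negComplex k (Fin.last m)) (unitIdx j))

/-- The inclusion of `D^j = D^j ⊗ R` in degree `j` of `D ⊗ F(σ⁻¹)`. -/
def negUnitIncl (j : ℤ) : D.X j ⟶ (tensorComplex D (negComplex k (Fin.last m))).X j :=
  ModuleCat.ofHom (tensorIncl D (negComplex k (Fin.last m)) (unitIdx j) ∘ₗ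
    tensorOne k (m + 1 + 1) (D.X j))

theorem negSBIdx_ne {a j : ℤ} (h : a + 1 = j) : negSBIdx h ≠ unitIdx j := fun h => by
  have := congrArg (fun ab : Deg j => ab.1.2) h
  simp at this

theorem negSBIncl_proj {a j : ℤ} (h : a + 1 = j) : negSBIncl D h ≫ negSBProj D h = 𝟙 _ :=
  ModuleCat.hom_ext (LinearMap.ext fun x =>
    tensorProj_incl D (negComplex k (Fin.last m)) (negSBIdx h) x)

theorem negUnitIncl_proj {a j : ℤ} (h : a + 1 = j) : negUnitIncl D j ≫ negSBProj D h = 0 :=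
  ModuleCat.hom_ext (LinearMap.ext fun x =>
    tensorProj_incl_of_ne D (negComplex k (Fin.last m)) (negSBIdx_ne h).symm
      (tensorOne k (m + 1 + 1) (D.X j) x))

theorem negX_subsingleton (i : Fin m) (b : ℤ) (h0 : b ≠ 0) (h1 : b ≠ 1) :
    Subsingleton ((negComplex k i).X b) := by
  match b with
  | .ofNat 0 => exact absurd rfl h0
  | .ofNat 1 => exact absurd rfl h1
  | .ofNat (_ + 2) => exact inferInstanceAs (Subsingleton PUnit)
  | .negSucc _ => exact inferInstanceAs (Subsingleton PUnit)

/-- In each degree, `D ⊗ F(σ⁻¹)` is the direct sum of `D^{j-1} ⊗ B` and `D^j ⊗ R`. -/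
theorem negSplit {a j : ℤ} (h : a + 1 = j) :
    negSBProj D h ≫ negSBIncl D h + negUnitProj D j ≫ negUnitIncl D j = 𝟙 _ := by
  refine ModuleCat.hom_ext (LinearMap.ext fun x => ?_)
  refine Eq.trans ?_ (eq_tensorIncl_add D (negComplex k (Fin.last m)) (negSBIdx_ne h)
    (fun cd h1 h0 => negX_subsingleton _ _ (fun h => h0 ?_) fun h => h1 ?_) x).symm
  · exact congrArg₂ (· + ·) rfl (congrArg (tensorIncl D (negComplex k (Fin.last m)) (unitIdx j))
      (tensorOne_mulBy _))
  · obtain ⟨⟨a, b⟩, hab⟩ := cd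
    obtain rfl : b = 0 := h
    obtain rfl : a = j := by simpa using hab
    rfl
  · obtain ⟨⟨a, b⟩, hab⟩ := cd
    obtain rfl : b = 1 := h
    refine Subtype.ext (Prod.ext ?_ rfl)
    simp only at hab ⊢
    omega

/-- The component `D^j ⊗ B → D^{j+1} ⊗ B` of the differential of `D ⊗ F(σ⁻¹)`. -/
theorem negSBIncl_d_proj (j : ℤ) : negSBIncl D (rfl : j + 1 = j + 1) ≫
    (tensorComplex D (negComplex k (Fin.last m))).d (j + 1) (j + 1 + 1) ≫
      negSBProj D (rfl : j + 1 + 1 = j + 1 + 1) =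
    ModuleCat.ofHom (BTensor.map (D.d j (j + 1)).hom LinearMap.id) := by
  rw [tensorComplex_d]
  refine ModuleCat.hom_ext (BTensor.linear_ext fun e b => ?_)
  change (negSBProj D (rfl : j + 1 + 1 = j + 1 + 1)).hom (tensorD D (negComplex k (Fin.last m)) (j + 1)
    (tensorIncl D (negComplex k (Fin.last m)) (negSBIdx rfl) (BTensor.tmul e b))) = _
  have h1 := tensorD_incl D (negComplex k (Fin.last m)) (negSBIdx (rfl : j + 1 = j + 1))
    (BTensor.tmul e b)
  have h2 : tensorDRight D (negComplex k (Fin.last m)) (negSBIdx (rfl : j + 1 = j + 1))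
      (BTensor.tmul e b) = 0 := by
    have := congrArg ModuleCat.Hom.hom (negComplex_d_one (k := k) (Fin.last m))
    change tensorIncl D (negComplex k (Fin.last m)) (negSBIdx (rfl : j + 1 = j + 1)).incr
      (BTensor.tmul e (((negComplex k (Fin.last m)).d 1 2).hom b)) = 0
    rw [this]
    exact (congrArg (tensorIncl D (negComplex k (Fin.last m))
      (negSBIdx (rfl : j + 1 = j + 1)).incr) (map_zero
        (BTensor.mk (Poly k (m + 1 + 1)) (D.X j) ((negComplex k (Fin.last m)).X 2) e))).trans
          (map_zero _)
  rw [h1, h2, smul_zero, add_zero]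
  exact tensorProj_incl D (negComplex k (Fin.last m)) (negSBIdx rfl) _

/-- The component `D^j → D^j ⊗ B` of the differential of `D ⊗ F(σ⁻¹)`. -/
theorem negUnitIncl_d_proj (j : ℤ) : negUnitIncl D j ≫
    (tensorComplex D (negComplex k (Fin.last m))).d j (j + 1) ≫ negSBProj D rfl =
      (j.negOnePow : ℤ) • rbHom k (D.X j) := by
  rw [tensorComplex_d]
  refine ModuleCat.hom_ext (LinearMap.ext fun x => ?_)
  change (negSBProj D rfl).hom (tensorD D (negComplex k (Fin.last m)) j
    (tensorIncl D (negComplex k (Fin.last m)) (unitIdx j) (tensorOne k (m + 1 + 1) (D.X j) x))) = _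
  have h1 := tensorD_incl D (negComplex k (Fin.last m)) (unitIdx j)
    (tensorOne k (m + 1 + 1) (D.X j) x)
  have hadd : ∀ (z : ℤ) (x y : tensorX D (negComplex k (Fin.last m)) (j + 1)),
      (negSBProj D (rfl : j + 1 = j + 1)).hom (x + z • y) =
        (negSBProj D (rfl : j + 1 = j + 1)).hom x + z • (negSBProj D (rfl : j + 1 = j + 1)).hom y :=
    fun z x y => (map_add _ _ _).trans (congrArg _ (map_zsmul _ _ _))
  rw [h1, hadd]
  have h2 : (negSBProj D (rfl : j + 1 = j + 1)).hom (tensorDLeft D (negComplex k (Fin.last m))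
      (unitIdx j) (tensorOne k (m + 1 + 1) (D.X j) x)) = 0 :=
    tensorProj_incl_of_ne D (negComplex k (Fin.last m)) (negSBIdx_ne rfl).symm _
  rw [h2, zero_add]
  refine congrArg ((j.negOnePow : ℤ) • ·) ?_
  refine (tensorProj_incl D (negComplex k (Fin.last m)) (negSBIdx rfl) _).trans ?_
  have h3 := congrArg ModuleCat.Hom.hom (negComplex_d_zero (k := k) (Fin.last m))
  change BTensor.map LinearMap.id ((negComplex k (Fin.last m)).d 0 1).hom
    (tensorOne k (m + 1 + 1) (D.X j) x) = _
  rw [h3]; rfl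

theorem HH_negSB_d (h j : ℤ) (y : (HH k (m + 1 + 1) h).obj (tensorSB k (D.X j))) :
    (HH k (m + 1 + 1) h).map (negSBProj D rfl) ((HH k (m + 1 + 1) h).map
      ((tensorComplex D (negComplex k (Fin.last m))).d (j + 1) (j + 1 + 1))
        ((HH k (m + 1 + 1) h).map (negSBIncl D rfl) y)) =
      (HH k (m + 1 + 1) h).map (ModuleCat.ofHom (BTensor.map (D.d j (j + 1)).hom LinearMap.id) :
        tensorSB k (D.X j) ⟶ tensorSB k (D.X (j + 1))) y := by
  rw [HH_map_comp_apply, HH_map_comp_apply, negSBIncl_d_proj]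

theorem HH_negUnit_d (h j : ℤ) (y : (HH k (m + 1 + 1) h).obj (D.X j)) :
    (HH k (m + 1 + 1) h).map (negSBProj D rfl) ((HH k (m + 1 + 1) h).map
      ((tensorComplex D (negComplex k (Fin.last m))).d j (j + 1))
        ((HH k (m + 1 + 1) h).map (negUnitIncl D j) y)) =
      (j.negOnePow : ℤ) • (HH k (m + 1 + 1) h).map (rbHom k (D.X j)) y := by
  rw [HH_map_comp_apply, HH_map_comp_apply, negUnitIncl_d_proj, HH_map_zsmul_apply]

variable {D} {C : CochainComplex (Bimod (Poly k (m + 1))) ℤ} {gC : Degrees C} {gD : Degrees D}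
  {oC : ∀ p, PowerFamily p C} {oD : ∀ p, PowerFamily p D} {ι : ∀ j, C.X j →+ D.X j}

theorem IsReduction.zsmul {N M : Type} [AddCommGroup N] [Module (Env (Poly k (m + 1 + 1))) N]
    [AddCommGroup M] [Module (Env (Poly k (m + 1))) M] {q : N →+ M} (hq : IsReduction k m q)
    (z : ℤ) : IsReduction k m (z • q) where
  lef r x := (congrArg (z • ·) (hq.lef r x)).trans (smul_comm _ _ _)
  rig r x := (congrArg (z • ·) (hq.rig r x)).trans (smul_comm _ _ _)
  last x := (congrArg (z • ·) (hq.last x)).trans (smul_zero z)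

/-- The reduction in degree `j = a + 1` of `D ⊗ F(σ⁻¹)`. The sign `(-1)^j` compensates for the sign
of the differential of the shifted complex. -/
theorem IsPolyExtComplex.isReduction_neg (H : IsPolyExtComplex gC gD oC oD ι) {a j : ℤ}
    (h : a + 1 = j) : IsReduction k m ((((j.negOnePow : ℤ) •
      (H.ext a).eval.comp (brE k (D.X a) (Fin.last m)).toAddMonoidHom)).comp
        (negSBProj D h).hom.toAddMonoidHom) :=
  ((H.ext a).isReduction_eval_brE.zsmul _).comp (N := tensorSB k (D.X a)) _

theorem IsReduction.negHom_zsmul {N : Bimod (Poly k (m + 1 + 1))} {M : Bimod (Poly k (m + 1))}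
    {q : N →+ M} (hq : IsReduction k m q) (z : ℤ) (h : ℤ) (x : (HH k (m + 1 + 1) h).obj N) :
    (hq.zsmul z).negHom h x = z • hq.negHom h x := by
  have := ConcreteCategory.congr_hom
    (hq.negHom_natural (hq.zsmul z) (𝟙 N) (z • 𝟙 M) (fun _ => rfl) h) x
  rw [CategoryTheory.Functor.map_id, Category.id_comp] at this
  refine this.trans ((HH_map_zsmul_apply _ _ _ _).trans ?_)
  rw [HH_map_id_apply]; rfl

theorem IsPolyExtComplex.negHom_apply (H : IsPolyExtComplex gC gD oC oD ι) {a j : ℤ}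
    (ha : a + 1 = j) (h : ℤ)
    (x : (HH k (m + 1 + 1) h).obj ((tensorComplex D (negComplex k (Fin.last m))).X j)) :
    (H.isReduction_neg ha).negHom h x = (j.negOnePow : ℤ) •
      (H.ext a).isReduction_eval_brE.negHom (N := tensorSB k (D.X a)) h
        ((HH k (m + 1 + 1) h).map (negSBProj D ha) x) :=
  (ConcreteCategory.congr_hom (((H.ext a).isReduction_eval_brE.zsmul
    (j.negOnePow : ℤ)).negHom_comp (N := tensorSB k (D.X a)) (negSBProj D ha) h) x).trans
      ((H.ext a).isReduction_eval_brE.negHom_zsmul (N := tensorSB k (D.X a)) _ h _)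

theorem IsPolyExtComplex.eval_brE_d (H : IsPolyExtComplex gC gD oC oD ι) (j : ℤ)
    (z : BTensor (Poly k (m + 1 + 1)) (D.X j) (SB k (Fin.last m))) :
    (H.ext (j + 1)).eval (brE k (D.X (j + 1)) (Fin.last m)
      (BTensor.map (D.d j (j + 1)).hom LinearMap.id z)) =
      (C.d j (j + 1)).hom ((H.ext j).eval (brE k (D.X j) (Fin.last m) z)) := by
  rw [← H.eval_d]
  congr 1
  refine LinearMap.congr_fun (f := brE k (D.X (j + 1)) (Fin.last m) ∘ₗ
    BTensor.map (D.d j (j + 1)).hom LinearMap.id)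
    (g := (D.d j (j + 1)).hom ∘ₗ brE k (D.X j) (Fin.last m)) (BTensor.linear_ext fun e b => ?_) z
  exact (map_smul (D.d j (j + 1)).hom _ _).symm

/-- The reductions form a map to the shifted complex, whose differential is the negative of that of
`C`: the signs of the reductions in degrees `j` and `j + 1` are opposite. -/
theorem IsPolyExtComplex.negHom_d (H : IsPolyExtComplex gC gD oC oD ι) (h : ℤ) {a b j : ℤ}
    (ha : a + 1 = j) (hb : b + 1 = j + 1)
    (x : (HH k (m + 1 + 1) h).obj ((tensorComplex D (negComplex k (Fin.last m))).X j)) :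
    (H.isReduction_neg hb).negHom h ((HH k (m + 1 + 1) h).map
      ((tensorComplex D (negComplex k (Fin.last m))).d j (j + 1)) x) =
    -(HH k (m + 1) h).map (C.d a b) ((H.isReduction_neg ha).negHom h x) := by
  obtain rfl : b = j := by omega
  subst ha
  have e : ∀ y, (H.ext (a + 1)).isReduction_eval_brE.negHom (N := tensorSB k (D.X (a + 1))) h
      ((HH k (m + 1 + 1) h).map (ModuleCat.ofHom
        (BTensor.map (D.d a (a + 1)).hom LinearMap.id) : tensorSB k (D.X a) ⟶ _) y) =
      (HH k (m + 1) h).map (C.d a (a + 1))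
        ((H.ext a).isReduction_eval_brE.negHom (N := tensorSB k (D.X a)) h y) := fun y =>
    ConcreteCategory.congr_hom ((H.ext a).isReduction_eval_brE.negHom_natural
      (N := tensorSB k (D.X a)) (H.ext (a + 1)).isReduction_eval_brE _ _ (H.eval_brE_d a) h) y
  rw [H.negHom_apply, H.negHom_apply]
  nth_rewrite 1 [HH_map_split (negSplit D rfl) h x]
  rw [map_add, map_add, map_add, HH_negSB_d, HH_negUnit_d, map_zsmul, (H.ext (a + 1)).negHom_rb,
    smul_zero, add_zero, e, map_zsmul, Int.negOnePow_succ (a + 1), Units.val_neg, neg_smul]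

/-- The map that keeps the Hochschild degree, for the negative generator. -/
def IsPolyExtComplex.negMap (H : IsPolyExtComplex gC gD oC oD ι) (h : ℤ) :
    HHComplex (tensorComplex D (negComplex k (Fin.last m))) h ⟶ (HHComplex C h)⟦(-1 : ℤ)⟧ where
  f j := ((H.isReduction_neg (sub_add_cancel j 1)).negHom h :
    (HHComplex (tensorComplex D (negComplex k (Fin.last m))) h).X j ⟶ (HHComplex C h).X (j - 1))
  comm' i j hij := by
    obtain rfl : i + 1 = j := hij
    refine ConcreteCategory.hom_ext _ _ fun x => ?_
    refine Eq.trans ?_ (H.negHom_d h (sub_add_cancel i 1) (sub_add_cancel (i + 1) 1) x).symm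
    have hd : ((HHComplex C h)⟦(-1 : ℤ)⟧).d i (i + 1) =
        -((HHComplex C h).d (i - 1) (i + 1 - 1)) := by
      rw [CochainComplex.shiftFunctor_obj_d', Int.negOnePow_neg, Int.negOnePow_one]
      exact (neg_smul (1 : ℤ) _).trans (congrArg Neg.neg (one_smul ℤ _))
    rw [hd]
    rfl

theorem IsPolyExtComplex.unshift_negMap (H : IsPolyExtComplex gC gD oC oD ι) (h j : ℤ) :
    unshift (H.negMap h) j = (H.isReduction_neg (sub_add_cancel j 1)).negHom h :=
  Category.comp_id _

section

variable [IsDomain k]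

theorem IsPolyExtComplex.exists_rb_of_negHom (H : IsPolyExtComplex gC gD oC oD ι) (h : ℤ) {a j : ℤ}
    (ha : a + 1 = j + 1) (z : (HH k (m + 1 + 1) h).obj (tensorSB k (D.X a)))
    (hz : (H.ext a).isReduction_eval_brE.negHom (N := tensorSB k (D.X a)) h z = 0) :
    ∃ y, (HH k (m + 1 + 1) h).map (negSBProj D ha) ((HH k (m + 1 + 1) h).map
      ((tensorComplex D (negComplex k (Fin.last m))).d j (j + 1))
        ((HH k (m + 1 + 1) h).map (negUnitIncl D j) y)) = z := by
  obtain rfl : a = j := by omega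
  obtain ⟨y, rfl⟩ := (H.ext a).exists_rb_of_negHom h z hz
  refine ⟨(a.negOnePow : ℤ) • y, (HH_negUnit_d D h a _).trans ?_⟩
  rw [map_zsmul, smul_smul, Int.units_coe_mul_self, one_smul]

theorem IsPolyExtComplex.negUnit_d_injective (H : IsPolyExtComplex gC gD oC oD ι) (h : ℤ) {a j : ℤ}
    (ha : a + 1 = j + 1) (y : (HH k (m + 1 + 1) h).obj (D.X j))
    (hy : (HH k (m + 1 + 1) h).map (negSBProj D ha) ((HH k (m + 1 + 1) h).map
      ((tensorComplex D (negComplex k (Fin.last m))).d j (j + 1))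
        ((HH k (m + 1 + 1) h).map (negUnitIncl D j) y)) = 0) : y = 0 := by
  obtain rfl : a = j := by omega
  have h1 := (HH_negUnit_d D h a y).symm.trans hy
  have h2 := congrArg ((a.negOnePow : ℤ) • ·) h1
  simp only [smul_smul, Int.units_coe_mul_self, one_smul, smul_zero] at h2
  exact (H.ext a).rb_injective h y h2

theorem IsPolyExtComplex.quasiIso_negMap (H : IsPolyExtComplex gC gD oC oD ι) (h : ℤ) :
    QuasiIso (H.negMap h) := by
  refine quasiIso_of_exact (H.negMap h)
    (X := fun j => (HH k (m + 1 + 1) h).obj (tensorSB k (D.X (j - 1))))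
    (Y := fun j => (HH k (m + 1 + 1) h).obj (D.X j))
    (fun j => ((HH k (m + 1 + 1) h).map (negSBProj D (sub_add_cancel j 1))).hom)
    (fun j => ((HH k (m + 1 + 1) h).map (negUnitIncl D j)).hom)
    (fun j => (j.negOnePow : ℤ) • ((H.ext (j - 1)).isReduction_eval_brE.negHom
      (N := tensorSB k (D.X (j - 1))) h).hom)
    (fun j x => H.negHom_apply (sub_add_cancel j 1) h x)
    (fun j x => ⟨(HH k (m + 1 + 1) h).map (negSBIncl D (sub_add_cancel j 1)) x, ?_⟩)
    (fun j y => ?_) (fun j y => ?_)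
    (fun j x hx => ⟨(HH k (m + 1 + 1) h).map (negUnitProj D j) x, ?_⟩) (fun j z hz => ?_)
    (fun j y hy => H.negUnit_d_injective h _ y hy)
  · refine (HH_map_comp_apply _ _ _ _).trans ?_
    rw [negSBIncl_proj, HH_map_id_apply]
  · obtain ⟨x, hx⟩ := (H.ext (j - 1)).negHom_surjective h y
    refine ⟨(j.negOnePow : ℤ) • x, ?_⟩
    refine (congrArg ((j.negOnePow : ℤ) • ·) (map_zsmul ((H.ext (j - 1)).isReduction_eval_brE.negHom
      (N := tensorSB k (D.X (j - 1))) h).hom _ _)).trans ?_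
    refine (smul_smul _ _ _).trans ?_
    rw [Int.units_coe_mul_self]
    exact (one_smul ℤ _).trans hx
  · refine (HH_map_comp_apply _ _ _ _).trans ?_
    rw [negUnitIncl_proj, HH_map_zero_apply]
  · refine Eq.trans ?_ (HH_map_split (negSplit D (sub_add_cancel j 1)) h x).symm
    refine (zero_add _).symm.trans (congrArg (· + _) ?_)
    exact ((congrArg _ hx).trans (map_zero _)).symm
  · refine H.exists_rb_of_negHom h _ z ?_
    have h2 := congrArg (((j + 1).negOnePow : ℤ) • ·) hz
    refine Eq.trans ?_ (h2.trans (smul_zero _))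
    refine Eq.trans ?_ (smul_smul _ _ _).symm
    rw [Int.units_coe_mul_self, one_smul]

end

theorem IsPolyExtComplex.isPolyLinear_negMap (H : IsPolyExtComplex gC gD oC oD ι) (h : ℤ) :
    IsPolyLinear (τ := fun j => j - 1) (unshift (H.negMap h)) := fun j r => by
  rw [H.unshift_negMap]
  exact (H.isReduction_neg _).negHom_HHAct h r

theorem IsPolyExtComplex.isHomogeneousOfDegree_negMap (H : IsPolyExtComplex gC gD oC oD ι) (h : ℤ) :
    IsHomogeneousOfDegree (τ := fun j => j - 1) (tensorDegrees gD (negDegrees (Fin.last m))) gC 2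
      (unshift (H.negMap h)) := fun j d => by
  rw [H.unshift_negMap]
  refine (H.isReduction_neg _).negHom_mem (fun d x hx => AddSubgroup.zsmul_mem _ ?_ _) h d
  exact (H.ext (j - 1)).eval_mulBy_mem (a := 2) (br k (Fin.last m)) (H.graded (j - 1))
    (H.stable (j - 1)) (gN := fun d => sbDeg (Fin.last m) (d + 2))
    (fun d x hx => sbMulPoly_mem (Fin.last m) hx)
    (tensorProj_mem hx (negSBIdx (sub_add_cancel j 1)))

theorem IsPolyExtComplex.respectsPowers_negMap (H : IsPolyExtComplex gC gD oC oD ι) (h : ℤ)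
    (p : ℕ) [CharP k p] [hp : Fact p.Prime] :
    RespectsPowers (τ := fun j => j - 1) (tensorPowers (oD p) (negPowers p (Fin.last m))) (oC p)
      (unshift (H.negMap h)) := fun j c => by
  rw [H.unshift_negMap]
  refine (H.isReduction_neg _).negHom_HHPow (fun x c => ?_) c h
  refine Eq.trans (congrArg ((j.negOnePow : ℤ) • ·)
    ((H.ext (j - 1)).eval_mulBy_power (br k (Fin.last m)) (H.power p (j - 1))
    (fun b c => exists_ofUB_br_twist (Fin.last m) hp.out b c) _ c)) ?_
  exact (congrFun (map_zsmul (oC p (j - 1)).P (j.negOnePow : ℤ) _) c).symm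

end Neg

end LastGenerator

end SoergelBraid

end

open SoergelBraid in
theorem mainTheorem4 (m : ℕ) (w : BraidWord m) (h : ℤ) :
    -- coefficients in `ℤ`, the generator `σ_n`
    (∃ f : HHComplex (stabComplex ℤ w true) h ⟶ HHComplex (wordComplex ℤ w) (h - 1),
      QuasiIso f ∧ IsPolyLinear (τ := fun j => j) f.f ∧
      IsHomogeneousOfDegree (τ := fun j => j) (stabDegrees ℤ w true) (wordDegrees ℤ w) (-2) f.f) ∧
    -- coefficients in `ℤ`, the generator `σ_n⁻¹`
    (∃ f : HHComplex (stabComplex ℤ w false) h ⟶ (HHComplex (wordComplex ℤ w) h)⟦(-1 : ℤ)⟧,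
      QuasiIso f ∧ IsPolyLinear (τ := fun j => j - 1) (unshift f) ∧
      IsHomogeneousOfDegree (τ := fun j => j - 1) (stabDegrees ℤ w false) (wordDegrees ℤ w) 2
        (unshift f)) ∧
    -- coefficients in `𝔽_p`
    (∀ (p : ℕ) [Fact p.Prime],
      (∃ f : HHComplex (stabComplex (ZMod p) w true) h ⟶ HHComplex (wordComplex (ZMod p) w) (h - 1),
        QuasiIso f ∧ IsPolyLinear (τ := fun j => j) f.f ∧
        IsHomogeneousOfDegree (τ := fun j => j) (stabDegrees (ZMod p) w true)
          (wordDegrees (ZMod p) w) (-2) f.f ∧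
        RespectsPowers (τ := fun j => j) (stabPowers (ZMod p) p w true)
          (wordPowers (ZMod p) p w) f.f) ∧
      (∃ f : HHComplex (stabComplex (ZMod p) w false) h ⟶
          (HHComplex (wordComplex (ZMod p) w) h)⟦(-1 : ℤ)⟧,
        QuasiIso f ∧ IsPolyLinear (τ := fun j => j - 1) (unshift f) ∧
        IsHomogeneousOfDegree (τ := fun j => j - 1) (stabDegrees (ZMod p) w false)
          (wordDegrees (ZMod p) w) 2 (unshift f) ∧
        RespectsPowers (τ := fun j => j - 1) (stabPowers (ZMod p) p w false)
          (wordPowers (ZMod p) p w) (unshift f))) := by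
  obtain ⟨ι, H⟩ := exists_isPolyExtComplex_word (k := ℤ) w
  refine ⟨⟨H.posMap h, H.quasiIso_posMap h, H.isPolyLinear_posMap h,
    H.isHomogeneousOfDegree_posMap h⟩, ⟨H.negMap h, H.quasiIso_negMap h, H.isPolyLinear_negMap h,
    H.isHomogeneousOfDegree_negMap h⟩, fun p _ => ?_⟩
  obtain ⟨ι, H⟩ := exists_isPolyExtComplex_word (k := ZMod p) w
  exact ⟨⟨H.posMap h, H.quasiIso_posMap h, H.isPolyLinear_posMap h,
    H.isHomogeneousOfDegree_posMap h, H.respectsPowers_posMap h p⟩, ⟨H.negMap h,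
    H.quasiIso_negMap h, H.isPolyLinear_negMap h, H.isHomogeneousOfDegree_negMap h,
    H.respectsPowers_negMap h p⟩⟩
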